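/- Let $\mathbb D$ be the open unit disk, $\mathbb T$ the unit circle, $|d\zeta|$ arc length on $\mathbb T$, $dA$ Lebesgue measure on $\mathbb D$, and write $|I|$ for the length of an arc $I\subseteq\mathbb T$. Let $1<p<\infty$ and $0<s<1$. The space $\mathcal Q^p_s(\mathbb T)$ consists of the $f\in L^p(\mathbb T)$ (complex-valued, with respect to arc length) such that $$\sup_{I\subseteq\mathbb T}\frac1{|I|^s}\int_I\int_I\frac{|f(\zeta)-f(\eta)|^p}{|\zeta-\eta|^{2-s}}\,|d\zeta|\,|d\eta|<\infty,$$ the supremum being over all arcs $I$ with $0<|I|\le 2\pi$. For $f\in L^1(\mathbb T)$ let $$\widehat f(z)=\frac1{2\pi}\int_{\mathbb T}f(\zeta)\frac{1-|z|^2}{|\zeta-z|^2}\,|d\zeta|,\qquad z\in\mathbb D,$$ be its Poisson extension, and put $|\nabla\widehat f|=(|\partial_x\widehat f|^2+|\partial_y\widehat f|^2)^{1/2}$. A positive Borel measure $\mu$ on $\mathbb D$ is an $s$-Carleson measure if $\sup_{I\subseteq\mathbb T}\mu(S(I))/|I|^s<\infty$, where the supremum is over the same arcs and $S(I)=\{r\zeta\in\mathbb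 D: 1-\frac{|I|}{2\pi}<r<1,\ \zeta\in I\}$. Theorem. Let $1<p<\infty$, $0<s<1$ and $f\in L^p(\mathbb T)$. The following conditions are equivalent. (a) $f\in\mathcal Q^p_s(\mathbb T)$. (b) $|\nabla\widehat f(z)|^p(1-|z|^2)^{p-2+s}\,dA(z)$ is an $s$-Carleson measure. (c) $$\sup_{a\in\mathbb D}\int_{\mathbb T}\int_{\mathbb T}\frac{|f(\zeta)-f(\eta)|^p}{|\zeta-\eta|^{2-s}}\left(\frac{1-|a|^2}{|\zeta-a|\,|\eta-a|}\right)^s|d\zeta|\,|d\eta|<\infty.$$ -/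

import Mathlib

open MeasureTheory
open scoped ENNReal

namespace QSpace

noncomputable section

/-- The unit circle carries its Borel σ-algebra. -/
instance : MeasurableSpace Circle := borel Circle

instance : BorelSpace Circle := ⟨rfl⟩

/-- Arc-length measure `|dζ|` on the unit circle, of total mass `2π`. -/
def arcLength : Measure Circle :=
  Measure.map Circle.exp (volume.restrict (Set.Ioc (-Real.pi) Real.pi))

/-- The (closed) arc of the unit circle with centre `e^{iθ}` and length `ℓ`,
used for `0 < ℓ ≤ 2π`. -/
def arc (θ ℓ : ℝ) : Set Circle :=
  Circle.exp '' Set.Icc (θ - ℓ / 2) (θ + ℓ / 2)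

/-- The Carleson sector `S(I) = {rζ ∈ 𝔻 : 1 - |I| / 2π < r < 1, ζ ∈ I}` over the arc `I` with
centre `e^{iθ}` and length `|I| = ℓ`. -/
def carlesonSector (θ ℓ : ℝ) : Set ℂ :=
  {z | ∃ r : ℝ, 1 - ℓ / (2 * Real.pi) < r ∧ r < 1 ∧ ∃ ζ ∈ arc θ ℓ, z = (r : ℂ) * (ζ : ℂ)}

/-- `μ` (a Borel measure on the plane, carried by the unit disk) is an `s`-Carleson measure:
`sup_I μ(S(I)) / |I|^s < ∞`, the supremum being over all arcs `I` of the unit circle. -/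
def IsCarlesonMeasure (s : ℝ) (μ : Measure ℂ) : Prop :=
  (⨆ (θ : ℝ) (ℓ ∈ Set.Ioc (0 : ℝ) (2 * Real.pi)),
    μ (carlesonSector θ ℓ) / ENNReal.ofReal (ℓ ^ s)) < ∞

/-- `‖f‖^p = sup_I |I|^{-s} ∫_I ∫_I |f(ζ) - f(η)|^p / |ζ - η|^{2 - s} |dζ| |dη|`, with values in
`[0, ∞]`, the supremum being over all arcs `I` of the unit circle. -/
def seminormPow (p s : ℝ) (f : Circle → ℂ) : ℝ≥0∞ :=
  ⨆ (θ : ℝ) (ℓ ∈ Set.Ioc (0 : ℝ) (2 * Real.pi)),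
    (∫⁻ ζ in arc θ ℓ, ∫⁻ η in arc θ ℓ,
      ENNReal.ofReal (‖f ζ - f η‖ ^ p / ‖(ζ : ℂ) - (η : ℂ)‖ ^ (2 - s)) ∂arcLength ∂arcLength) /
      ENNReal.ofReal (ℓ ^ s)

/-- The space `Q^p_s(𝕋)`. -/
def Q (p s : ℝ) : Set (Circle → ℂ) :=
  {f | MemLp f (ENNReal.ofReal p) arcLength ∧ seminormPow p s f < ∞}

/-- The Poisson extension
`f̂(z) = (1 / 2π) ∫_𝕋 f(ζ) (1 - |z|²) / |ζ - z|² |dζ|`. -/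
def poissonExt (f : Circle → ℂ) (z : ℂ) : ℂ :=
  (2 * Real.pi)⁻¹ • ∫ ζ, poissonKernel 0 z (ζ : ℂ) • f ζ ∂arcLength

/-- The length `|∇F| = (|∂F/∂x|² + |∂F/∂y|²)^{1/2}` of the gradient of a complex-valued function
on the plane. -/
def gradNorm (F : ℂ → ℂ) (z : ℂ) : ℝ :=
  Real.sqrt (‖fderiv ℝ F z 1‖ ^ 2 + ‖fderiv ℝ F z Complex.I‖ ^ 2)

/-- The measure `|∇F(z)|^p (1 - |z|²)^{p - 2 + s} dA(z)` on the unit disk, where `dA` is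
Lebesgue measure. -/
def gradMeasure (p s : ℝ) (F : ℂ → ℂ) : Measure ℂ :=
  (volume.restrict (Metric.ball (0 : ℂ) 1)).withDensity fun z =>
    ENNReal.ofReal (gradNorm F z ^ p * (1 - ‖z‖ ^ 2) ^ (p - 2 + s))

end

end QSpace

/-!
All three conditions are compared with a bound on the line: in angular coordinates, the double
integral of `|f(ζ) - f(η)|^p / |ζ - η|^{2 - s}` over an arc of length `ℓ` is `O(ℓ^s)` (`ArcBound`,
`seminormPow_lt_top_iff`).

The key to deducing the other two conditions from it is `ArcBound.exists_lintegral_diffKernel_le`: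
the bound persists when `η` ranges over the whole circle and only `ζ` is confined to the arc. By the
triangle inequality with constant close to `1`, averaged over an intermediate point, the integral of
`|f(ζ) - f(η)|^p` over `ζ` in an arc and `η` in its dilate by `2^m` grows at most like `ρ^m` for any
`ρ > 2`, whereas on the `m`-th annulus the kernel is of size `2^{-m(2 - s)}`, and `2 - s > 1`.

* The Möbius factor with two points is at most the sum of the factors `((1 - |a|²) / |ζ - a|²)^s` at
  each of them, so the invariant integral is at most twice the integral of that weight against a
  density satisfying a Carleson-type condition, which a dyadic decomposition bounds
  (`ArcBound.iSup_invariantIntegral_lt_top`). Conversely the factor at `a = (1 - ℓ/4π) e^{iθ}` is at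
  least a multiple of `ℓ^{-s}` on the arc of length `ℓ` around `e^{iθ}`
  (`seminormPow_lt_top_of_iSup_invariantIntegral_lt_top`).
* The gradient of the Poisson extension at `z = (1 - h) ξ` is at most a multiple of
  `∫ |f(η) - f(ξ)| / |η - z|² |dη|`, because constants may be subtracted. Hölder's inequality
  and integration over `h` turn this into the kernel of the seminorm, with `η` on the whole circle
  (`exists_lintegral_gradDensity_le`, `ArcBound.isCarlesonMeasure`).
* Conversely, the increment of `f` between `e^{ix}` and `e^{i(x + t)}` is bounded by the integral of
  the gradient down the radius to depth `h`, a fixed multiple of `|t|`, along the circle of that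
  depth, and up the other radius (`lintegral_diffPow_add_le`). The radial parts are handled by
  Hardy's inequality (`exists_hardy`), which needs `s < 1`. The boundary values of the extension are
  recovered almost everywhere along a sequence of radii, from convergence in `L¹`
  (`exists_seq_tendsto_poissonExt`, `SectorBound.exists_arcBound`).
-/

namespace QSpace

/-! ### Arc length in angular coordinates -/

open Real in
lemma setLIntegral_Ioc_eq_of_periodic {G : ℝ → ℝ≥0∞} (hG : Function.Periodic G (2 * π)) (a b : ℝ) :
    ∫⁻ x in Set.Ioc a (a + 2 * π), G x = ∫⁻ x in Set.Ioc b (b + 2 * π), G x := by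
  have h := two_pi_pos
  refine (isAddFundamentalDomain_Ioc h a).setLIntegral_eq (isAddFundamentalDomain_Ioc h b) G ?_
  rintro ⟨g, hg⟩ x
  obtain ⟨n, rfl⟩ := AddSubgroup.mem_zmultiples_iff.1 hg
  have := hG.zsmul n x
  rw [← this]
  simp only [AddSubgroup.vadd_def, vadd_eq_add, add_comm]

open Real in
lemma lintegral_arcLength {F : Circle → ℝ≥0∞} (hF : Measurable F) (a : ℝ) :
    ∫⁻ ζ, F ζ ∂arcLength = ∫⁻ x in Set.Ioc a (a + 2 * π), F (Circle.exp x) := by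
  rw [arcLength, lintegral_map hF Circle.exp.continuous.measurable]
  have hG : Function.Periodic (fun x => F (Circle.exp x)) (2 * π) := fun x => by
    simp only [Circle.periodic_exp x]
  rw [← setLIntegral_Ioc_eq_of_periodic hG (-π) a]
  congr 3
  ring

instance : IsFiniteMeasure arcLength := by
  unfold arcLength; infer_instance

lemma isCompact_arc (θ ℓ : ℝ) : IsCompact (arc θ ℓ) :=
  isCompact_Icc.image Circle.exp.continuous

lemma measurableSet_arc (θ ℓ : ℝ) : MeasurableSet (arc θ ℓ) :=
  (isCompact_arc θ ℓ).isClosed.measurableSet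

open Real in
/-- Within one period centred at `θ`, the parameters of the points of an arc are those of its
defining interval. -/
lemma exp_mem_arc_iff {θ ℓ x : ℝ} (hℓ : ℓ ≤ 2 * π) (hx : x ∈ Set.Ioc (θ - π) (θ - π + 2 * π)) :
    Circle.exp x ∈ arc θ ℓ ↔ x ∈ Set.Icc (θ - ℓ / 2) (θ + ℓ / 2) := by
  refine ⟨?_, fun h => ⟨x, h, rfl⟩⟩
  rintro ⟨y, hy, hxy⟩
  obtain ⟨m, hm⟩ := Circle.exp_eq_exp.1 hxy.symm
  have hpi := pi_pos
  obtain ⟨h1, h2⟩ := hx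
  obtain ⟨h3, h4⟩ := hy
  have hm1 : (m : ℝ) < 2 := by
    by_contra! h
    nlinarith
  have hm0 : (-1 : ℝ) < m := by
    by_contra! h
    nlinarith
  have hm1' : m < 2 := by exact_mod_cast hm1
  have hm0' : -1 < m := by exact_mod_cast hm0
  obtain rfl | rfl : m = 0 ∨ m = 1 := by omega
  · constructor <;> push_cast at hm <;> linarith
  · constructor <;> push_cast at hm <;> linarith

open Real in
lemma setLIntegral_arc {F : Circle → ℝ≥0∞} (hF : Measurable F) {θ ℓ : ℝ} (hℓ : ℓ ≤ 2 * π) :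
    ∫⁻ ζ in arc θ ℓ, F ζ ∂arcLength =
      ∫⁻ x in Set.Icc (θ - ℓ / 2) (θ + ℓ / 2), F (Circle.exp x) := by
  rw [← lintegral_indicator (measurableSet_arc θ ℓ),
    lintegral_arcLength (hF.indicator (measurableSet_arc θ ℓ)) (θ - π),
    ← lintegral_indicator measurableSet_Ioc, ← lintegral_indicator measurableSet_Icc]
  refine lintegral_congr_ae ?_
  have h0 : ∀ᵐ x : ℝ, x ≠ θ - π := by simp [ae_iff]
  filter_upwards [h0] with x hx
  by_cases hx1 : x ∈ Set.Ioc (θ - π) (θ - π + 2 * π)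
  · rw [Set.indicator_of_mem hx1]
    simp only [Set.indicator, exp_mem_arc_iff hℓ hx1]
  · rw [Set.indicator_of_notMem hx1, Set.indicator_of_notMem]
    rintro ⟨h1, h2⟩
    exact hx1 ⟨lt_of_le_of_ne (by linarith) (Ne.symm hx), by linarith⟩

lemma norm_exp_sub_exp (x y : ℝ) :
    ‖(Circle.exp x : ℂ) - Circle.exp y‖ = 2 * |Real.sin ((x - y) / 2)| := by
  have h : (Circle.exp x : ℂ) - Circle.exp y =
      Circle.exp y * (Complex.exp (Complex.I * ((x - y : ℝ) : ℂ)) - 1) := by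
    rw [mul_sub, mul_one, Circle.coe_exp, Circle.coe_exp, ← Complex.exp_add]
    congr 2
    push_cast; ring
  rw [h, norm_mul, Circle.norm_coe, one_mul, Complex.norm_exp_I_mul_ofReal_sub_one]
  simp

lemma norm_exp_sub_exp_le (x y : ℝ) : ‖(Circle.exp x : ℂ) - Circle.exp y‖ ≤ |x - y| := by
  rw [norm_exp_sub_exp]
  have : |Real.sin ((x - y) / 2)| ≤ |(x - y) / 2| := Real.abs_sin_le_abs
  rw [abs_div, abs_two] at this
  linarith

open Real in
/-- The factor `3π/2` leaves room for pairs of parameters that are more than half a turn apart. -/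
lemma le_norm_exp_sub_exp {x y : ℝ} (h : |x - y| ≤ 3 * π / 2) :
    |x - y| / 5 ≤ ‖(Circle.exp x : ℂ) - Circle.exp y‖ := by
  rw [norm_exp_sub_exp]
  wlog hxy : y ≤ x generalizing x y
  · have := this (x := y) (y := x) (by rwa [abs_sub_comm]) (by linarith)
    rw [abs_sub_comm, show (x - y) / 2 = - ((y - x) / 2) by ring, sin_neg, abs_neg]
    exact this
  rw [abs_of_nonneg (by linarith : (0:ℝ) ≤ x - y)] at h ⊢
  have hpi := pi_pos
  have hpi3 := pi_gt_three
  have hpi4 : π < 3.15 := pi_lt_d2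
  set d := (x - y) / 2 with hd
  have hd0 : 0 ≤ d := by rw [hd]; linarith
  have hxd : x - y = 2 * d := by rw [hd]; ring
  rw [hxd] at h ⊢
  have key : d / 5 ≤ sin d := by
    rcases le_total d (π / 2) with h1 | h1
    · have := mul_le_sin hd0 h1
      refine le_trans ?_ this
      rw [div_mul_eq_mul_div, le_div_iff₀ hpi]
      nlinarith
    · have := mul_le_sin (x := π - d) (by linarith) (by linarith)
      rw [sin_pi_sub] at this
      refine le_trans ?_ this
      rw [div_mul_eq_mul_div, le_div_iff₀ hpi]
      nlinarith
  have := le_abs_self (sin d)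
  linarith

/-! ### The kernel and the growth of oscillations over dilated arcs -/

/-- The integrand `|f(ζ) - f(η)|^p / |ζ - η|^{2 - s}` of the seminorm of `Q^p_s`. -/
noncomputable def diffKernel (p s : ℝ) (f : Circle → ℂ) (ζ η : Circle) : ℝ≥0∞ :=
  ENNReal.ofReal (‖f ζ - f η‖ ^ p / ‖(ζ : ℂ) - (η : ℂ)‖ ^ (2 - s))

/-- The power `|f(ζ) - f(η)|^p` of the increment of `f`. -/
noncomputable def diffPow (p : ℝ) (f : Circle → ℂ) (ζ η : Circle) : ℝ≥0∞ :=
  ENNReal.ofReal (‖f ζ - f η‖ ^ p)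

section Kernels

variable {p s : ℝ} {f : Circle → ℂ}

lemma diffKernel_comm (ζ η : Circle) : diffKernel p s f ζ η = diffKernel p s f η ζ := by
  rw [diffKernel, diffKernel, norm_sub_rev, norm_sub_rev (ζ : ℂ)]

lemma measurable_circle_coe : Measurable fun ζ : Circle => (ζ : ℂ) := by
  have h : Continuous fun ζ : Circle => (ζ : ℂ) := by fun_prop
  exact h.measurable

lemma measurable_circleExp : Measurable Circle.exp := Circle.exp.continuous.measurable

lemma measurable_diffPow_comp {α : Type*} [MeasurableSpace α] (hf : Measurable f)
    {u v : α → Circle} (hu : Measurable u) (hv : Measurable v) :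
    Measurable fun q => diffPow p f (u q) (v q) := by
  have h1 := (hf.comp hu).sub (hf.comp hv)
  exact (h1.norm.pow_const p).ennreal_ofReal

lemma measurable_diffKernel_comp {α : Type*} [MeasurableSpace α] (hf : Measurable f)
    {u v : α → Circle} (hu : Measurable u) (hv : Measurable v) :
    Measurable fun q => diffKernel p s f (u q) (v q) := by
  have h1 := (hf.comp hu).sub (hf.comp hv)
  have h2 := (measurable_circle_coe.comp hu).sub (measurable_circle_coe.comp hv)
  exact ((h1.norm.pow_const p).div (h2.norm.pow_const (2 - s))).ennreal_ofReal

lemma measurable_diffKernel_right (hf : Measurable f) (ζ : Circle) :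
    Measurable (diffKernel p s f ζ) :=
  measurable_diffKernel_comp hf measurable_const measurable_id

lemma measurable_diffKernel_exp (hf : Measurable f) :
    Measurable fun q : ℝ × ℝ => diffKernel p s f (Circle.exp q.1) (Circle.exp q.2) :=
  measurable_diffKernel_comp hf (measurable_circleExp.comp measurable_fst)
    (measurable_circleExp.comp measurable_snd)

lemma measurable_diffPow_exp (hf : Measurable f) :
    Measurable fun q : ℝ × ℝ => diffPow p f (Circle.exp q.1) (Circle.exp q.2) :=
  measurable_diffPow_comp hf (measurable_circleExp.comp measurable_fst)
    (measurable_circleExp.comp measurable_snd)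

lemma diffPow_le_diffKernel (hp : 0 < p) (hs : s < 2) {ζ η : Circle} {R : ℝ}
    (hR : ‖(ζ : ℂ) - η‖ ≤ R) :
    diffPow p f ζ η ≤ ENNReal.ofReal (R ^ (2 - s)) * diffKernel p s f ζ η := by
  have hR0 : 0 ≤ R := (norm_nonneg _).trans hR
  rw [diffPow, diffKernel, ← ENNReal.ofReal_mul (by positivity)]
  apply ENNReal.ofReal_le_ofReal
  rcases (norm_nonneg ((ζ : ℂ) - η)).eq_or_lt with h | h
  · have : ζ = η := Subtype.ext (sub_eq_zero.1 (norm_eq_zero.1 h.symm))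
    subst this
    simp [Real.zero_rpow hp.ne']
  · rw [← mul_div_assoc, le_div_iff₀ (by positivity), mul_comm]
    gcongr

lemma diffKernel_le_diffPow (hs : s < 2) {ζ η : Circle} {c : ℝ} (hc : 0 < c)
    (h : c ≤ ‖(ζ : ℂ) - η‖) :
    diffKernel p s f ζ η ≤ ENNReal.ofReal (c ^ (s - 2)) * diffPow p f ζ η := by
  rw [diffPow, diffKernel, ← ENNReal.ofReal_mul (by positivity)]
  apply ENNReal.ofReal_le_ofReal
  rw [div_eq_mul_inv, ← Real.rpow_neg (norm_nonneg _), mul_comm, neg_sub]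
  refine mul_le_mul_of_nonneg_right ?_ (by positivity)
  exact Real.rpow_le_rpow_of_nonpos hc h (by linarith)

end Kernels

/-- The factor in front of one summand can be taken as close to `1` as desired. -/
lemma exists_add_rpow_le {l p : ℝ} (hl : 1 < l) (hp : 0 < p) :
    ∃ C : ℝ, 0 ≤ C ∧ ∀ a b : ℝ, 0 ≤ a → 0 ≤ b → (a + b) ^ p ≤ l * a ^ p + C * b ^ p := by
  set e := l ^ p⁻¹ - 1 with he
  have he0 : 0 < e := sub_pos.2 (Real.one_lt_rpow hl (by positivity))
  have hle : (1 + e) ^ p = l := by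
    rw [he, add_sub_cancel, Real.rpow_inv_rpow (by linarith) hp.ne']
  refine ⟨(1 + 1 / e) ^ p, by positivity, fun a b ha hb => ?_⟩
  rcases le_total b (e * a) with h | h
  · calc (a + b) ^ p ≤ ((1 + e) * a) ^ p := by gcongr; linarith
      _ = l * a ^ p := by rw [Real.mul_rpow (by positivity) ha, hle]
      _ ≤ _ := le_add_of_nonneg_right (by positivity)
  · have h' : a ≤ 1 / e * b := by
      rw [div_mul_eq_mul_div, one_mul, le_div_iff₀ he0]; linarith
    calc (a + b) ^ p ≤ ((1 + 1 / e) * b) ^ p := by gcongr; linarith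
      _ = (1 + 1 / e) ^ p * b ^ p := by rw [Real.mul_rpow (by positivity) hb]
      _ ≤ _ := le_add_of_nonneg_left (by positivity)

lemma diffPow_triangle {l C p : ℝ} (hl : 0 ≤ l) (hC0 : 0 ≤ C) (hp : 0 < p)
    (hC : ∀ a b : ℝ, 0 ≤ a → 0 ≤ b → (a + b) ^ p ≤ l * a ^ p + C * b ^ p)
    (f : Circle → ℂ) (ζ ω η : Circle) :
    diffPow p f ζ η ≤
      ENNReal.ofReal l * diffPow p f ζ ω + ENNReal.ofReal C * diffPow p f ω η := by
  simp only [diffPow]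
  rw [← ENNReal.ofReal_mul hl, ← ENNReal.ofReal_mul hC0,
    ← ENNReal.ofReal_add (by positivity) (by positivity)]
  apply ENNReal.ofReal_le_ofReal
  refine le_trans ?_ (hC _ _ (norm_nonneg _) (norm_nonneg _))
  gcongr
  exact norm_sub_le_norm_sub_add_norm_sub _ _ _

/-- Averaging a quasi-triangle inequality over the intermediate point. -/
lemma volume_mul_lintegral_le_of_triangle {α : Type*} [MeasurableSpace α] {μ : Measure α}
    [SFinite μ] {W : α → α → ℝ≥0∞}
    (hW : Measurable (Function.uncurry W)) {l C : ℝ≥0∞}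
    (htri : ∀ x w y, W x y ≤ l * W x w + C * W w y) (A B E : Set α) :
    μ E * ∫⁻ x in A, ∫⁻ y in B, W x y ∂μ ∂μ ≤
      l * (μ B * ∫⁻ x in A, ∫⁻ w in E, W x w ∂μ ∂μ) +
        C * (μ A * ∫⁻ w in E, ∫⁻ y in B, W w y ∂μ ∂μ) := by
  have m1 : ∀ S : Set α, Measurable fun x => ∫⁻ y in S, W x y ∂μ :=
    fun S => hW.lintegral_prod_right'
  have m2 : ∀ x, Measurable (W x) := fun x => hW.of_uncurry_left
  calc μ E * ∫⁻ x in A, ∫⁻ y in B, W x y ∂μ ∂μ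
      = ∫⁻ x in A, ∫⁻ w in E, ∫⁻ y in B, W x y ∂μ ∂μ ∂μ := by
        simp only [lintegral_const, Measure.restrict_apply_univ]
        rw [mul_comm, lintegral_mul_const _ (m1 B)]
    _ ≤ ∫⁻ x in A, ∫⁻ w in E, ∫⁻ y in B, (l * W x w + C * W w y) ∂μ ∂μ ∂μ := by
        gcongr with x w y
        exact htri x w y
    _ = ∫⁻ x in A, ∫⁻ w in E, (l * W x w * μ B + C * ∫⁻ y in B, W w y ∂μ) ∂μ ∂μ := by
        congr 1 with x
        congr 1 with w
        rw [lintegral_add_left measurable_const, lintegral_const_mul _ (m2 w), lintegral_const,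
          Measure.restrict_apply_univ]
    _ = ∫⁻ x in A, (l * (μ B * ∫⁻ w in E, W x w ∂μ) +
          C * ∫⁻ w in E, ∫⁻ y in B, W w y ∂μ ∂μ) ∂μ := by
        congr 1 with x
        rw [lintegral_add_right _ ((m1 B).const_mul C), lintegral_mul_const _ ((m2 x).const_mul l),
          lintegral_const_mul _ (m2 x), lintegral_const_mul _ (m1 B)]
        ring
    _ = _ := by
        rw [lintegral_add_right _ measurable_const, lintegral_const_mul _ ((m1 E).const_mul _),
          lintegral_const_mul _ (m1 E), lintegral_const, Measure.restrict_apply_univ]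
        ring

section Enlarge

variable {p s M : ℝ} {f : Circle → ℂ}

/-- The seminorm condition on arcs, written on the line: the double integral of the kernel over an
arc of length `ℓ` is at most `M ℓ^s`. -/
def ArcBound (p s M : ℝ) (f : Circle → ℂ) : Prop :=
  ∀ θ ℓ : ℝ, 0 < ℓ → ℓ ≤ 2 * Real.pi →
    ∫⁻ x in Set.Icc (θ - ℓ / 2) (θ + ℓ / 2), ∫⁻ y in Set.Icc (θ - ℓ / 2) (θ + ℓ / 2),
      diffKernel p s f (Circle.exp x) (Circle.exp y) ≤ ENNReal.ofReal (M * ℓ ^ s)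

lemma ArcBound.lintegral_diffPow_le (hM : ArcBound p s M f) (hp : 0 < p) (hs : s < 2)
    (hf : Measurable f) (θ : ℝ) {ℓ : ℝ} (h0 : 0 < ℓ) (h1 : ℓ ≤ 2 * Real.pi) :
    ∫⁻ x in Set.Icc (θ - ℓ / 2) (θ + ℓ / 2), ∫⁻ y in Set.Icc (θ - ℓ / 2) (θ + ℓ / 2),
      diffPow p f (Circle.exp x) (Circle.exp y) ≤ ENNReal.ofReal (M * ℓ ^ 2) := by
  have hm := measurable_diffKernel_exp (p := p) (s := s) hf
  calc _ ≤ ∫⁻ x in Set.Icc (θ - ℓ / 2) (θ + ℓ / 2), ∫⁻ y in Set.Icc (θ - ℓ / 2) (θ + ℓ / 2),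
        ENNReal.ofReal (ℓ ^ (2 - s)) * diffKernel p s f (Circle.exp x) (Circle.exp y) := by
        refine setLIntegral_mono' measurableSet_Icc fun x hx =>
          setLIntegral_mono' measurableSet_Icc fun y hy =>
          diffPow_le_diffKernel hp hs ((norm_exp_sub_exp_le x y).trans ?_)
        rw [abs_le]
        constructor <;> linarith [hx.1, hx.2, hy.1, hy.2]
    _ = ENNReal.ofReal (ℓ ^ (2 - s)) * ∫⁻ x in Set.Icc (θ - ℓ / 2) (θ + ℓ / 2),
          ∫⁻ y in Set.Icc (θ - ℓ / 2) (θ + ℓ / 2),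
          diffKernel p s f (Circle.exp x) (Circle.exp y) := by
        rw [← lintegral_const_mul _ (Measurable.lintegral_prod_right' hm)]
        congr 1 with x
        exact lintegral_const_mul _
          (measurable_diffKernel_comp hf measurable_const measurable_circleExp)
    _ ≤ ENNReal.ofReal (ℓ ^ (2 - s)) * ENNReal.ofReal (M * ℓ ^ s) := by
        gcongr
        exact hM θ ℓ h0 h1
    _ = _ := by
        rw [← ENNReal.ofReal_mul (by positivity), mul_left_comm, ← Real.rpow_add h0]
        norm_num

/-- Growth of the oscillation between an arc and its dilates: `ρ` may be any rate above `2`. The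
triangle inequality through a point of the dilate by `2 ^ m` bounds the oscillation at stage `m + 1`
by `2 * l` times that at stage `m`, up to an error of size `4 ^ m * ℓ ^ 2` times the volume ratio
`2 ^ (-m)`. -/
lemma ArcBound.exists_lintegral_diffPow_le (hp : 0 < p) (hs : s < 2) (hM0 : 0 ≤ M)
    (hM : ArcBound p s M f) (hf : Measurable f) {ρ : ℝ} (hρ : 2 < ρ) :
    ∃ K : ℝ, 0 ≤ K ∧ ∀ (θ ℓ : ℝ), 0 < ℓ → ∀ m : ℕ, 2 ^ m * ℓ ≤ 2 * Real.pi →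
      ∫⁻ x in Set.Icc (θ - ℓ / 2) (θ + ℓ / 2),
        ∫⁻ y in Set.Icc (θ - 2 ^ m * ℓ / 2) (θ + 2 ^ m * ℓ / 2),
        diffPow p f (Circle.exp x) (Circle.exp y) ≤ ENNReal.ofReal (K * ρ ^ m * ℓ ^ 2) := by
  obtain ⟨l, hl1, hl2⟩ : ∃ l : ℝ, 1 < l ∧ l < ρ / 2 := exists_between (by linarith)
  obtain ⟨C, hC0, hC⟩ := exists_add_rpow_le hl1 hp
  have hgap : 0 < ρ - 2 * l := by linarith
  set K := M + 4 * C * M / (ρ - 2 * l) with hK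
  have hK0 : 0 ≤ K := by positivity
  have hKM : M ≤ K := le_add_of_nonneg_right (by positivity)
  have hKC : 4 * C * M ≤ K * (ρ - 2 * l) := by
    rw [hK, add_mul, div_mul_cancel₀ _ hgap.ne']
    exact le_add_of_nonneg_left (by positivity)
  refine ⟨K, hK0, fun θ ℓ h0 m => ?_⟩
  induction m with
  | zero =>
    intro h1
    simp only [pow_zero, one_mul, mul_one] at h1 ⊢
    refine (hM.lintegral_diffPow_le hp hs hf θ h0 h1).trans ?_
    gcongr
  | succ m ih =>
    intro h1
    have hm1 : (2:ℝ) ^ m * ℓ ≤ 2 ^ (m + 1) * ℓ := by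
      gcongr <;> norm_num
    have ih' := ih (hm1.trans h1)
    set J : ℕ → Set ℝ := fun m => Set.Icc (θ - 2 ^ m * ℓ / 2) (θ + 2 ^ m * ℓ / 2) with hJ
    have hvol : ∀ m, volume (J m) = ENNReal.ofReal (2 ^ m * ℓ) := fun m => by
      rw [hJ, Real.volume_Icc]; ring_nf
    have hJ0 : Set.Icc (θ - ℓ / 2) (θ + ℓ / 2) = J 0 := by simp [hJ]
    rw [hJ0] at ih' ⊢
    have hpos : 0 < (2:ℝ) ^ m * ℓ := by positivity
    have hD := hM.lintegral_diffPow_le hp hs hf θ (ℓ := 2 ^ (m + 1) * ℓ) (by positivity) h1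
    have hD' : ∫⁻ x in J m, ∫⁻ y in J (m + 1), diffPow p f (Circle.exp x) (Circle.exp y) ≤
        ENNReal.ofReal (M * (2 ^ (m + 1) * ℓ) ^ 2) := by
      refine le_trans (lintegral_mono_set ?_) hD
      exact Set.Icc_subset_Icc (by linarith) (by linarith)
    have key := volume_mul_lintegral_le_of_triangle (μ := volume)
      (W := fun x y : ℝ => diffPow p f (Circle.exp x) (Circle.exp y))
      (measurable_diffPow_exp hf)
      (fun x w y => diffPow_triangle (by linarith) hC0 hp hC f _ _ _) (J 0) (J (m + 1)) (J m)
    have key2 : ENNReal.ofReal (2 ^ m * ℓ) * ∫⁻ x in J 0, ∫⁻ y in J (m + 1),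
        diffPow p f (Circle.exp x) (Circle.exp y) ≤
        ENNReal.ofReal (2 ^ m * ℓ) * ENNReal.ofReal (K * ρ ^ (m + 1) * ℓ ^ 2) := by
      rw [hvol, hvol, hvol] at key
      refine key.trans (le_trans (add_le_add (mul_le_mul_right (mul_le_mul_right ih' _) _)
        (mul_le_mul_right (mul_le_mul_right hD' _) _)) ?_)
      have hρ0 : 0 < ρ := by linarith
      have hl0 : 0 < l := by linarith
      rw [← ENNReal.ofReal_mul (by positivity), ← ENNReal.ofReal_mul (by positivity),
        ← ENNReal.ofReal_mul (by positivity), ← ENNReal.ofReal_mul (by positivity),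
        ← ENNReal.ofReal_mul (by positivity), ← ENNReal.ofReal_add (by positivity) (by positivity)]
      apply ENNReal.ofReal_le_ofReal
      have hpow : (2:ℝ) ^ m ≤ ρ ^ m := by gcongr
      have h2 : 4 * C * M * 2 ^ m ≤ K * (ρ - 2 * l) * ρ ^ m := by gcongr
      have h3 : 0 ≤ (2:ℝ) ^ m * ℓ ^ 3 := by positivity
      have h4 := mul_le_mul_of_nonneg_left h2 h3
      simp only [pow_succ, pow_zero, one_mul] at *
      nlinarith
    exact (ENNReal.mul_le_mul_iff_right (by simpa using hpos) ENNReal.ofReal_ne_top).1 key2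

/-! ### One point of the double integral may roam the whole circle -/

/-- The seminorm condition on arcs improves itself: one of the two points may range over the whole
circle. Far away from the arc the kernel is essentially constant on dyadic annuli, and the
oscillation grows there more slowly than the kernel decays because `s < 1`. -/
theorem ArcBound.exists_lintegral_diffKernel_le (hp : 0 < p) (hs0 : 0 < s) (hs : s < 1)
    (hM0 : 0 ≤ M) (hM : ArcBound p s M f) (hf : Measurable f) :
    ∃ C : ℝ, 0 ≤ C ∧ ∀ (θ ℓ : ℝ), 0 < ℓ → ℓ ≤ 2 * Real.pi →
      ∫⁻ x in Set.Icc (θ - ℓ / 2) (θ + ℓ / 2),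
        ∫⁻ η, diffKernel p s f (Circle.exp x) η ∂arcLength ≤ ENNReal.ofReal (C * ℓ ^ s) := by
  obtain ⟨ρ, hρ2, hρ⟩ : ∃ ρ : ℝ, 2 < ρ ∧ ρ < 2 ^ (2 - s) := by
    apply exists_between
    calc (2:ℝ) = 2 ^ (1:ℝ) := by simp
      _ < 2 ^ (2 - s) := Real.rpow_lt_rpow_of_exponent_lt (by norm_num) (by linarith)
  obtain ⟨K, hK0, hK⟩ := hM.exists_lintegral_diffPow_le hp (by linarith) hM0 hf hρ2
  -- `q` is the ratio of the contributions of consecutive dyadic annuli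
  set q := ρ * 2 ^ (s - 2) with hq
  have hρ0 : 0 < ρ := by linarith
  have hq0 : 0 < q := by positivity
  have hq1 : q < 1 := by
    rw [hq, show s - 2 = -(2 - s) by ring, Real.rpow_neg (by norm_num), ← div_eq_mul_inv,
      div_lt_one (by positivity)]
    exact hρ
  set B := 2 * M + (1 / 20) ^ (s - 2) * K * ρ with hB
  have hB0 : 0 ≤ B := by positivity
  have dyadic : ∀ (θ ℓ : ℝ), 0 < ℓ → ∀ m : ℕ, 2 ^ m * ℓ ≤ 2 * Real.pi →
      ∫⁻ x in Set.Icc (θ - ℓ / 2) (θ + ℓ / 2),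
        ∫⁻ y in Set.Icc (θ - 2 ^ m * ℓ / 2) (θ + 2 ^ m * ℓ / 2),
        diffKernel p s f (Circle.exp x) (Circle.exp y) ≤
        ENNReal.ofReal ((M + B * ∑ i ∈ Finset.range m, q ^ i) * ℓ ^ s) := by
    intro θ ℓ h0 m
    induction m with
    | zero =>
      intro h1
      simp only [pow_zero, one_mul, Finset.range_zero, Finset.sum_empty, mul_zero,
        add_zero] at h1 ⊢
      exact hM θ ℓ h0 h1
    | succ m ih =>
      intro h1
      have hm1 : (2:ℝ) ^ m * ℓ ≤ 2 ^ (m + 1) * ℓ := by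
        gcongr <;> norm_num
      have ih' := ih (hm1.trans h1)
      set J : ℕ → Set ℝ := fun m => Set.Icc (θ - 2 ^ m * ℓ / 2) (θ + 2 ^ m * ℓ / 2) with hJ
      have hJ0 : Set.Icc (θ - ℓ / 2) (θ + ℓ / 2) = J 0 := by simp [hJ]
      have hK' := hK θ ℓ h0 (m + 1) h1
      rw [hJ0] at ih' hK' ⊢
      have hsum : 0 ≤ ∑ i ∈ Finset.range m, q ^ i := Finset.sum_nonneg fun i _ => by positivity
      rcases Nat.eq_zero_or_pos m with rfl | hm
      · have hsub : J 0 ⊆ J 1 := by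
          simp only [hJ, pow_zero, pow_one]
          exact Set.Icc_subset_Icc (by linarith) (by linarith)
        simp only [zero_add, pow_one] at h1
        have h2 := hM θ (2 * ℓ) (by positivity) h1
        refine (lintegral_mono_set hsub).trans ?_
        simp only [zero_add, Finset.range_one, Finset.sum_singleton, pow_zero, mul_one, hJ, pow_one]
        refine h2.trans (ENNReal.ofReal_le_ofReal ?_)
        rw [Real.mul_rpow (by norm_num) h0.le, ← mul_assoc]
        gcongr
        have h3 : (2:ℝ) ^ s ≤ 2 := by
          calc (2:ℝ) ^ s ≤ 2 ^ (1:ℝ) :=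
                Real.rpow_le_rpow_of_exponent_le (by norm_num) hs.le
            _ = 2 := by simp
        -- the second summand of `B` is only needed for the larger annuli
        have h4 : 0 ≤ (1 / 20) ^ (s - 2) * K * ρ := by positivity
        nlinarith
      -- from the second dilate on, the annulus stays away from the arc
      · have h2m : (2:ℝ) ≤ 2 ^ m := by
          calc (2:ℝ) = 2 ^ 1 := by norm_num
            _ ≤ 2 ^ m := pow_le_pow_right₀ (by norm_num) hm
        have hpos : 0 < (2:ℝ) ^ m * ℓ := by positivity
        have h2l : 2 * ℓ ≤ 2 ^ m * ℓ := by gcongr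
        have hpt : ∀ x ∈ J 0, ∀ y ∈ J (m + 1) \ J m,
            diffKernel p s f (Circle.exp x) (Circle.exp y) ≤
              ENNReal.ofReal ((2 ^ m * ℓ / 20) ^ (s - 2)) *
                diffPow p f (Circle.exp x) (Circle.exp y) := by
          rintro x ⟨hx1, hx2⟩ y ⟨⟨hy1, hy2⟩, hy3⟩
          simp only [pow_zero, one_mul, pow_succ] at hx1 hx2 hy1 hy2 h1
          have hfar : 2 ^ m * ℓ / 4 ≤ |x - y| := by
            by_contra! hlt
            rw [abs_lt] at hlt
            refine hy3 ⟨?_, ?_⟩ <;> linarith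
          refine diffKernel_le_diffPow (by linarith) (by positivity)
            (le_trans ?_ (le_norm_exp_sub_exp ?_))
          · linarith
          · rw [abs_le]
            constructor <;> linarith
        have hm1' := measurable_diffPow_exp (p := p) hf
        have hann : ∫⁻ x in J 0, ∫⁻ y in J (m + 1) \ J m,
            diffKernel p s f (Circle.exp x) (Circle.exp y) ≤
            ENNReal.ofReal ((2 ^ m * ℓ / 20) ^ (s - 2) * (K * ρ ^ (m + 1) * ℓ ^ 2)) := by
          rw [ENNReal.ofReal_mul (by positivity)]
          refine le_trans ?_ (mul_le_mul_right hK' _)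
          rw [← lintegral_const_mul _ (Measurable.lintegral_prod_right' hm1')]
          refine setLIntegral_mono' measurableSet_Icc fun x hx => ?_
          refine (setLIntegral_mono' (measurableSet_Icc.diff measurableSet_Icc)
            fun y hy => hpt x hx y hy).trans ?_
          rw [lintegral_const_mul _
            (measurable_diffPow_comp hf measurable_const measurable_circleExp)]
          gcongr
          exact Set.sdiff_subset
        calc ∫⁻ x in J 0, ∫⁻ y in J (m + 1), diffKernel p s f (Circle.exp x) (Circle.exp y)
            ≤ ∫⁻ x in J 0, ((∫⁻ y in J m, diffKernel p s f (Circle.exp x) (Circle.exp y)) +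
              ∫⁻ y in J (m + 1) \ J m, diffKernel p s f (Circle.exp x) (Circle.exp y)) := by
              gcongr with x
              refine (lintegral_mono_set ?_).trans (lintegral_union_le _ _ _)
              simp
          _ = (∫⁻ x in J 0, ∫⁻ y in J m, diffKernel p s f (Circle.exp x) (Circle.exp y)) +
              ∫⁻ x in J 0, ∫⁻ y in J (m + 1) \ J m,
                diffKernel p s f (Circle.exp x) (Circle.exp y) := by
              rw [lintegral_add_left (Measurable.lintegral_prod_right'
                (measurable_diffKernel_exp hf))]
          _ ≤ _ := by
              refine (add_le_add ih' hann).trans ?_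
              rw [← ENNReal.ofReal_add (by positivity) (by positivity)]
              apply ENNReal.ofReal_le_ofReal
              have e1 : (2 ^ m * ℓ / 20) ^ (s - 2) * (K * ρ ^ (m + 1) * ℓ ^ 2) =
                  (1 / 20) ^ (s - 2) * K * ρ * q ^ m * ℓ ^ s := by
                rw [show (2:ℝ) ^ m * ℓ / 20 = (1 / 20) * 2 ^ m * ℓ by ring,
                  Real.mul_rpow (by positivity) h0.le,
                  Real.mul_rpow (by positivity) (by positivity),
                  hq, mul_pow, ← Real.rpow_natCast (2 ^ (s - 2)), ← Real.rpow_natCast 2 m,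
                  ← Real.rpow_mul (by norm_num), ← Real.rpow_mul (by norm_num),
                  mul_comm (m:ℝ) (s - 2)]
                have e2 : ℓ ^ (s - 2) * ℓ ^ 2 = ℓ ^ s := by
                  rw [← Real.rpow_natCast ℓ 2, ← Real.rpow_add h0]
                  norm_num
                rw [← e2]; ring
              rw [e1, Finset.sum_range_succ, ← add_mul, mul_add, ← add_assoc]
              gcongr
              rw [hB]
              exact le_add_of_nonneg_left (by positivity)
  set C := M + B * (1 - q)⁻¹ with hC
  have hq' : 0 < 1 - q := by linarith
  have hC0 : 0 ≤ C := by positivity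
  refine ⟨2 * C, by positivity, fun θ ℓ h0 h1 => ?_⟩
  -- the arc is enlarged to length `L < 2 * ℓ` so that its dilate by `2 ^ n` is the whole circle
  obtain ⟨n, hn1, hn2⟩ := exists_nat_pow_near (x := 2 * Real.pi / ℓ) (y := (2:ℝ))
    ((one_le_div h0).2 h1) (by norm_num)
  set L := 2 * Real.pi / 2 ^ n with hL
  have hnL : 2 ^ n * L = 2 * Real.pi := by rw [hL]; field_simp
  have hL0 : 0 < L := by have := Real.pi_pos; positivity
  have hℓL : ℓ ≤ L := by
    rw [hL, le_div_iff₀ (by positivity), mul_comm]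
    exact (le_div_iff₀ h0).1 hn1
  have hLℓ : L ≤ 2 * ℓ := by
    rw [hL, div_le_iff₀ (by positivity)]
    have := (div_lt_iff₀ h0).1 hn2
    rw [pow_succ] at this
    linarith
  have hdy := dyadic θ L hL0 n hnL.le
  calc ∫⁻ x in Set.Icc (θ - ℓ / 2) (θ + ℓ / 2),
        ∫⁻ η, diffKernel p s f (Circle.exp x) η ∂arcLength
      ≤ ∫⁻ x in Set.Icc (θ - L / 2) (θ + L / 2),
        ∫⁻ η, diffKernel p s f (Circle.exp x) η ∂arcLength := by
        apply lintegral_mono_set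
        exact Set.Icc_subset_Icc (by linarith) (by linarith)
    _ ≤ ∫⁻ x in Set.Icc (θ - L / 2) (θ + L / 2),
        ∫⁻ y in Set.Icc (θ - 2 ^ n * L / 2) (θ + 2 ^ n * L / 2),
        diffKernel p s f (Circle.exp x) (Circle.exp y) := by
        gcongr with x
        rw [lintegral_arcLength (measurable_diffKernel_right hf _)
          (θ - Real.pi), hnL]
        apply lintegral_mono_set
        intro y hy
        exact ⟨by linarith [hy.1], by linarith [hy.2]⟩
    _ ≤ _ := by
        refine hdy.trans (ENNReal.ofReal_le_ofReal ?_)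
        have h2 : ∑ i ∈ Finset.range n, q ^ i ≤ (1 - q)⁻¹ := by
          rw [← tsum_geometric_of_lt_one hq0.le hq1]
          exact (summable_geometric_of_lt_one hq0.le hq1).sum_le_tsum _ fun i _ => by positivity
        have h3 : L ^ s ≤ 2 * ℓ ^ s := by
          calc L ^ s ≤ (2 * ℓ) ^ s := by gcongr
            _ = 2 ^ s * ℓ ^ s := Real.mul_rpow (by norm_num) h0.le
            _ ≤ 2 ^ (1:ℝ) * ℓ ^ s := by gcongr; norm_num
            _ = 2 * ℓ ^ s := by simp
        calc _ ≤ C * (2 * ℓ ^ s) := by rw [hC]; gcongr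
          _ = _ := by ring

end Enlarge

/-! ### The Möbius-invariant integral -/

lemma iSup_div_rpow_lt_top_iff {s : ℝ} (X : ℝ → ℝ → ℝ≥0∞) :
    (⨆ (θ : ℝ) (ℓ ∈ Set.Ioc (0 : ℝ) (2 * Real.pi)), X θ ℓ / ENNReal.ofReal (ℓ ^ s)) < ∞ ↔
      ∃ M : ℝ, 0 ≤ M ∧ ∀ θ ℓ : ℝ, 0 < ℓ → ℓ ≤ 2 * Real.pi →
        X θ ℓ ≤ ENNReal.ofReal (M * ℓ ^ s) := by
  constructor
  · intro h
    refine ⟨(⨆ (θ : ℝ) (ℓ ∈ Set.Ioc (0 : ℝ) (2 * Real.pi)),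
      X θ ℓ / ENNReal.ofReal (ℓ ^ s)).toReal, ENNReal.toReal_nonneg, fun θ ℓ h0 h1 => ?_⟩
    have hpos : 0 < ℓ ^ s := by positivity
    rw [ENNReal.ofReal_mul ENNReal.toReal_nonneg, ENNReal.ofReal_toReal h.ne]
    refine (ENNReal.div_le_iff (by simpa using hpos) ENNReal.ofReal_ne_top).1 ?_
    exact le_iSup_of_le θ (le_iSup₂_of_le ℓ ⟨h0, h1⟩ le_rfl)
  · rintro ⟨M, hM0, hM⟩
    refine lt_of_le_of_lt ?_ (ENNReal.ofReal_lt_top (r := M))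
    refine iSup_le fun θ => iSup₂_le fun ℓ hℓ => ?_
    have hpos : 0 < ℓ ^ s := Real.rpow_pos_of_pos hℓ.1 s
    rw [ENNReal.div_le_iff (by simpa using hpos) ENNReal.ofReal_ne_top, ← ENNReal.ofReal_mul hM0]
    exact hM θ ℓ hℓ.1 hℓ.2

section Invariant

variable {p s M : ℝ} {f : Circle → ℂ}

lemma seminormPow_lt_top_iff (hf : Measurable f) :
    seminormPow p s f < ∞ ↔ ∃ M : ℝ, 0 ≤ M ∧ ArcBound p s M f := by
  unfold seminormPow
  rw [iSup_div_rpow_lt_top_iff]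
  refine exists_congr fun M => and_congr_right fun _ => forall₂_congr fun θ ℓ =>
    forall₂_congr fun h0 h1 => ?_
  have e : ∫⁻ ζ in arc θ ℓ, ∫⁻ η in arc θ ℓ, ENNReal.ofReal
      (‖f ζ - f η‖ ^ p / ‖(ζ : ℂ) - (η : ℂ)‖ ^ (2 - s)) ∂arcLength ∂arcLength =
      ∫⁻ x in Set.Icc (θ - ℓ / 2) (θ + ℓ / 2), ∫⁻ y in Set.Icc (θ - ℓ / 2) (θ + ℓ / 2),
      diffKernel p s f (Circle.exp x) (Circle.exp y) := by
    change ∫⁻ ζ in arc θ ℓ, ∫⁻ η in arc θ ℓ, diffKernel p s f ζ η ∂arcLength ∂arcLength = _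
    have hm : Measurable fun ζ => ∫⁻ η in arc θ ℓ, diffKernel p s f ζ η ∂arcLength :=
      Measurable.lintegral_prod_right'
        (f := fun q : Circle × Circle => diffKernel p s f q.1 q.2)
        (measurable_diffKernel_comp hf measurable_fst measurable_snd)
    rw [setLIntegral_arc hm h1]
    congr 1 with x
    rw [setLIntegral_arc (measurable_diffKernel_right hf _) h1]
  rw [e]

/-- The distance from a boundary point to `a = |a| e^{iθ}` is comparable to `1 - |a|` plus the
angular distance. -/
lemma le_norm_exp_sub_mul_exp {r θ x : ℝ} (hr0 : 0 ≤ r) (hr1 : r ≤ 1)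
    (hx : |x - θ| ≤ 3 * Real.pi / 2) :
    1 - r + |x - θ| ≤ 11 * ‖(Circle.exp x : ℂ) - r * Circle.exp θ‖ := by
  have h1 : 1 - r ≤ ‖(Circle.exp x : ℂ) - r * Circle.exp θ‖ := by
    have := norm_sub_norm_le (Circle.exp x : ℂ) (r * Circle.exp θ)
    rw [norm_mul, Circle.norm_coe, Circle.norm_coe, mul_one, Complex.norm_real,
      Real.norm_eq_abs, abs_of_nonneg hr0] at this
    exact this
  have h2 := le_norm_exp_sub_exp hx
  have h3 : ‖(Circle.exp x : ℂ) - Circle.exp θ‖ ≤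
      ‖(Circle.exp x : ℂ) - r * Circle.exp θ‖ + (1 - r) := by
    calc ‖(Circle.exp x : ℂ) - Circle.exp θ‖
        = ‖((Circle.exp x : ℂ) - r * Circle.exp θ) - ((1 - r : ℝ) : ℂ) * Circle.exp θ‖ := by
          congr 1; push_cast; ring
      _ ≤ _ := by
          refine (norm_sub_le _ _).trans ?_
          rw [norm_mul, Circle.norm_coe, mul_one, Complex.norm_real, Real.norm_eq_abs,
            abs_of_nonneg (by linarith : (0:ℝ) ≤ 1 - r)]
  linarith

/-- The Poisson-type weight `((1 - |a|²) / |ζ - a|²)^s` on the circle. -/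
noncomputable def poissonWeight (s : ℝ) (a : ℂ) (ζ : Circle) : ℝ≥0∞ :=
  ENNReal.ofReal (((1 - ‖a‖ ^ 2) / ‖(ζ : ℂ) - a‖ ^ 2) ^ s)

lemma measurable_poissonWeight (s : ℝ) (a : ℂ) : Measurable (poissonWeight s a) := by
  have h := (((measurable_circle_coe.sub_const a).norm.pow_const 2).const_div (1 - ‖a‖ ^ 2))
  exact (h.pow_const s).ennreal_ofReal

/-- The larger of the two one-point weights already dominates the two-point factor. -/
lemma ofReal_rpow_le_poissonWeight_add (hs : 0 ≤ s) {a : ℂ} (ha : ‖a‖ < 1) (ζ η : Circle) :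
    ENNReal.ofReal (((1 - ‖a‖ ^ 2) / (‖(ζ : ℂ) - a‖ * ‖(η : ℂ) - a‖)) ^ s) ≤
      poissonWeight s a ζ + poissonWeight s a η := by
  have hpos : ∀ ζ : Circle, 0 < ‖(ζ : ℂ) - a‖ := fun ζ => by
    have := norm_sub_norm_le (ζ : ℂ) a
    rw [Circle.norm_coe] at this
    linarith
  have h1 := hpos ζ
  have h2 := hpos η
  have h3 : 0 ≤ 1 - ‖a‖ ^ 2 := by nlinarith [norm_nonneg a]
  rcases le_total ‖(ζ : ℂ) - a‖ ‖(η : ℂ) - a‖ with h | h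
  · refine le_trans (ENNReal.ofReal_le_ofReal ?_) le_self_add
    rw [sq ‖(ζ : ℂ) - a‖]
    gcongr
  · refine le_trans (ENNReal.ofReal_le_ofReal ?_) le_add_self
    rw [sq ‖(η : ℂ) - a‖]
    gcongr

/-- A dyadic majorant of the weight in terms of indicators of arcs around the radial projection
of `a`. -/
lemma poissonWeight_le_tsum (hs : 0 < s) {r θ x : ℝ} (hr0 : 0 ≤ r) (hr1 : r < 1)
    (hx : |x - θ| ≤ Real.pi) :
    poissonWeight s (r * Circle.exp θ) (Circle.exp x) ≤
      ∑' n : ℕ, ENNReal.ofReal ((242 / (1 - r)) ^ s * ((4 : ℝ) ^ (-s)) ^ n) *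
        Set.indicator {y : ℝ | |y - θ| ≤ 2 ^ (n + 1) * (1 - r)} 1 x := by
  set h := 1 - r with hh
  have h0 : 0 < h := by linarith
  -- the single term with `2 ^ n * h ≤ h + |x - θ| < 2 ^ (n + 1) * h` already suffices
  obtain ⟨n, hn1, hn2⟩ := exists_nat_pow_near (x := (h + |x - θ|) / h) (y := (2:ℝ))
    (by rw [one_le_div h0]; linarith [abs_nonneg (x - θ)]) (by norm_num)
  rw [le_div_iff₀ h0] at hn1
  rw [div_lt_iff₀ h0] at hn2
  refine le_trans ?_ (ENNReal.le_tsum n)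
  rw [Set.indicator_of_mem (by simp only [Set.mem_ofPred_eq]; linarith), Pi.one_apply, mul_one]
  have hd := le_norm_exp_sub_mul_exp hr0 hr1.le (x := x) (θ := θ) (by linarith [Real.pi_pos])
  have hnorm : ‖(r * Circle.exp θ : ℂ)‖ = r := by
    rw [norm_mul, Circle.norm_coe, mul_one, Complex.norm_real, Real.norm_eq_abs, abs_of_nonneg hr0]
  apply ENNReal.ofReal_le_ofReal
  rw [hnorm]
  have hd2 : 2 ^ n * h ≤ 11 * ‖(Circle.exp x : ℂ) - r * Circle.exp θ‖ := hn1.trans hd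
  have hpos : 0 < (2:ℝ) ^ n * h := by positivity
  calc ((1 - r ^ 2) / ‖(Circle.exp x : ℂ) - r * Circle.exp θ‖ ^ 2) ^ s
      ≤ (2 * h / (2 ^ n * h / 11) ^ 2) ^ s := by
        have : 0 ≤ 1 - r ^ 2 := by nlinarith
        gcongr
        · nlinarith
        · linarith
    _ = (242 / h * ((4:ℝ) ^ n)⁻¹) ^ s := by
        congr 1
        rw [show (4:ℝ) = 2 ^ 2 by norm_num, ← pow_mul, mul_comm 2 n, pow_mul]
        field_simp
        norm_num
    _ = _ := by
        rw [Real.mul_rpow (by positivity) (by positivity), Real.inv_rpow (by positivity),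
          ← Real.rpow_natCast, ← Real.rpow_natCast, ← Real.rpow_mul (by norm_num),
          ← Real.rpow_mul (by norm_num), ← Real.rpow_neg (by norm_num)]
        congr 2
        ring

/-- Integrals of a Poisson-type weight against a density satisfying a Carleson-type condition on
arcs are bounded uniformly in `a`. -/
lemma exists_lintegral_poissonWeight_mul_le (hs : 0 < s) {C : ℝ} (hC0 : 0 ≤ C)
    {G : Circle → ℝ≥0∞} (hG : Measurable G)
    (hC : ∀ (θ ℓ : ℝ), 0 < ℓ → ℓ ≤ 2 * Real.pi →
      ∫⁻ x in Set.Icc (θ - ℓ / 2) (θ + ℓ / 2), G (Circle.exp x) ≤ ENNReal.ofReal (C * ℓ ^ s)) :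
    ∃ K : ℝ≥0∞, K ≠ ∞ ∧ ∀ a : ℂ, ‖a‖ < 1 →
      ∫⁻ ζ, poissonWeight s a ζ * G ζ ∂arcLength ≤ K := by
  refine ⟨ENNReal.ofReal (C * 968 ^ s) * (1 - ENNReal.ofReal (2 ^ (-s)))⁻¹, ?_, fun a ha => ?_⟩
  · refine ENNReal.mul_ne_top ENNReal.ofReal_ne_top (ENNReal.inv_ne_top.2 ?_)
    refine (tsub_pos_of_lt ?_).ne'
    rw [ENNReal.ofReal_lt_one]
    exact Real.rpow_lt_one_of_one_lt_of_neg (by norm_num) (by linarith)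
  obtain ⟨r, θ, hr0, hr1, rfl⟩ : ∃ r θ : ℝ, 0 ≤ r ∧ r < 1 ∧ a = r * Circle.exp θ := by
    refine ⟨‖a‖, Complex.arg a, norm_nonneg a, ha, ?_⟩
    rw [Circle.coe_exp, Complex.norm_mul_exp_arg_mul_I]
  set h := 1 - r with hh
  have h0 : 0 < h := by linarith
  have hGm : Measurable fun x => G (Circle.exp x) := hG.comp measurable_circleExp
  have hset : ∀ n : ℕ, MeasurableSet {y : ℝ | |y - θ| ≤ 2 ^ (n + 1) * h} := fun n =>
    measurableSet_le (by fun_prop) measurable_const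
  refine (lintegral_arcLength (F := fun ζ => poissonWeight s (r * Circle.exp θ) ζ * G ζ)
    ((measurable_poissonWeight s _).mul hG) (θ - Real.pi)).trans_le ?_
  calc _ ≤ ∫⁻ x in Set.Ioc (θ - Real.pi) (θ - Real.pi + 2 * Real.pi),
        ∑' n : ℕ, ENNReal.ofReal ((242 / h) ^ s * ((4 : ℝ) ^ (-s)) ^ n) *
          Set.indicator {y : ℝ | |y - θ| ≤ 2 ^ (n + 1) * h} (fun x => G (Circle.exp x)) x := by
        refine setLIntegral_mono' measurableSet_Ioc fun x hx => ?_
        have hx' : |x - θ| ≤ Real.pi := by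
          rw [abs_le]; constructor <;> linarith [hx.1, hx.2]
        refine (mul_le_mul_left (poissonWeight_le_tsum hs hr0 hr1 hx') _).trans (le_of_eq ?_)
        rw [← ENNReal.tsum_mul_right]
        congr 1 with n
        rw [mul_assoc]
        congr 1
        by_cases hxn : x ∈ {y : ℝ | |y - θ| ≤ 2 ^ (n + 1) * h}
        · rw [Set.indicator_of_mem hxn, Set.indicator_of_mem hxn, Pi.one_apply, one_mul]
        · rw [Set.indicator_of_notMem hxn, Set.indicator_of_notMem hxn, zero_mul]
    _ = ∑' n : ℕ, ENNReal.ofReal ((242 / h) ^ s * ((4 : ℝ) ^ (-s)) ^ n) *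
          ∫⁻ x in Set.Ioc (θ - Real.pi) (θ - Real.pi + 2 * Real.pi),
          Set.indicator {y : ℝ | |y - θ| ≤ 2 ^ (n + 1) * h} (fun x => G (Circle.exp x)) x := by
        rw [lintegral_tsum fun n => ((hGm.indicator (hset n)).const_mul _).aemeasurable]
        congr 1 with n
        rw [lintegral_const_mul _ (hGm.indicator (hset n))]
    _ ≤ ∑' n : ℕ, ENNReal.ofReal (C * 968 ^ s) * ENNReal.ofReal (2 ^ (-s)) ^ n := by
        refine ENNReal.tsum_le_tsum fun n => ?_
        have hL : 0 < 2 ^ (n + 2) * h := by positivity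
        -- an arc longer than the circle is replaced by the whole circle
        have hmin : 0 < min (2 ^ (n + 2) * h) (2 * Real.pi) :=
          lt_min hL (by have := Real.pi_pos; positivity)
        have hint : ∫⁻ x in Set.Ioc (θ - Real.pi) (θ - Real.pi + 2 * Real.pi),
            Set.indicator {y : ℝ | |y - θ| ≤ 2 ^ (n + 1) * h} (fun x => G (Circle.exp x)) x ≤
            ENNReal.ofReal (C * (2 ^ (n + 2) * h) ^ s) := by
          rw [setLIntegral_indicator (hset n)]
          refine le_trans (lintegral_mono_set ?_)
            ((hC θ _ hmin (min_le_right _ _)).trans (ENNReal.ofReal_le_ofReal ?_))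
          · rintro x ⟨hx1, hx2, hx3⟩
            simp only [Set.mem_ofPred_eq, abs_le] at hx1
            rw [pow_succ] at hx1
            rcases min_cases (2 ^ (n + 2) * h) (2 * Real.pi) with ⟨e, -⟩ | ⟨e, -⟩ <;> rw [e]
            · rw [pow_succ, pow_succ]
              constructor <;> linarith [hx1.1, hx1.2]
            · constructor <;> linarith
          · gcongr
            exact min_le_left _ _
        refine (mul_le_mul_right hint _).trans (le_of_eq ?_)
        rw [← ENNReal.ofReal_pow (by positivity), ← ENNReal.ofReal_mul (by positivity),
          ← ENNReal.ofReal_mul (by positivity)]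
        congr 1
        have e1 : ((2:ℝ) ^ (n + 2) * h) ^ s = (4 * h) ^ s * (2 ^ s) ^ n := by
          rw [show (2:ℝ) ^ (n + 2) * h = (4 * h) * 2 ^ n by ring,
            Real.mul_rpow (by positivity) (by positivity)]
          congr 1
          rw [← Real.rpow_natCast, ← Real.rpow_natCast, ← Real.rpow_mul (by norm_num),
            ← Real.rpow_mul (by norm_num), mul_comm]
        have e2 : (242 / h) ^ s * (4 * h) ^ s = 968 ^ s := by
          rw [← Real.mul_rpow (by positivity) (by positivity)]
          congr 1
          field_simp
          norm_num
        have e3 : (4:ℝ) ^ (-s) * 2 ^ s = 2 ^ (-s) := by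
          rw [show (4:ℝ) = 2 * 2 by norm_num, Real.mul_rpow (by norm_num) (by norm_num), mul_assoc,
            ← Real.rpow_add (by norm_num) (-s) s]
          simp
        rw [e1, ← e2, ← e3, mul_pow]
        ring
    _ = _ := by rw [ENNReal.tsum_mul_left, ENNReal.tsum_geometric]

/-- The double integral in the Möbius-invariant description of `Q^p_s`. -/
noncomputable def invariantIntegral (p s : ℝ) (f : Circle → ℂ) (a : ℂ) : ℝ≥0∞ :=
  ∫⁻ ζ, ∫⁻ η, ENNReal.ofReal (‖f ζ - f η‖ ^ p / ‖(ζ : ℂ) - (η : ℂ)‖ ^ (2 - s) *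
    ((1 - ‖a‖ ^ 2) / (‖(ζ : ℂ) - a‖ * ‖(η : ℂ) - a‖)) ^ s) ∂arcLength ∂arcLength

lemma invariantIntegral_eq (a : ℂ) : invariantIntegral p s f a =
    ∫⁻ ζ, ∫⁻ η, diffKernel p s f ζ η * ENNReal.ofReal
      (((1 - ‖a‖ ^ 2) / (‖(ζ : ℂ) - a‖ * ‖(η : ℂ) - a‖)) ^ s) ∂arcLength ∂arcLength := by
  unfold invariantIntegral diffKernel
  congr 1 with ζ
  congr 1 with η
  rw [ENNReal.ofReal_mul (by positivity)]

lemma ArcBound.iSup_invariantIntegral_lt_top (hp : 0 < p) (hs0 : 0 < s) (hs : s < 1)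
    (hM0 : 0 ≤ M) (hM : ArcBound p s M f) (hf : Measurable f) :
    (⨆ a ∈ Metric.ball (0 : ℂ) 1, invariantIntegral p s f a) < ∞ := by
  obtain ⟨C, hC0, hC⟩ := hM.exists_lintegral_diffKernel_le hp hs0 hs hM0 hf
  have hk : Measurable fun q : Circle × Circle => diffKernel p s f q.1 q.2 :=
    measurable_diffKernel_comp hf measurable_fst measurable_snd
  have hG : Measurable fun ζ => ∫⁻ η, diffKernel p s f ζ η ∂arcLength :=
    hk.lintegral_prod_right'
  obtain ⟨K, hK, hKb⟩ := exists_lintegral_poissonWeight_mul_le hs0 hC0 hG hC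
  refine lt_of_le_of_lt (b := K + K) (iSup₂_le fun a ha => ?_) (by
    rw [ENNReal.add_lt_top]; exact ⟨hK.lt_top, hK.lt_top⟩)
  have ha' : ‖a‖ < 1 := by simpa using ha
  have hw := measurable_poissonWeight s a
  have e1 : ∫⁻ ζ, ∫⁻ η, poissonWeight s a ζ * diffKernel p s f ζ η ∂arcLength ∂arcLength =
      ∫⁻ ζ, poissonWeight s a ζ * ∫⁻ η, diffKernel p s f ζ η ∂arcLength ∂arcLength := by
    congr 1 with ζ
    rw [lintegral_const_mul _ (measurable_diffKernel_right hf ζ)]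
  have e2 : ∫⁻ ζ, ∫⁻ η, poissonWeight s a η * diffKernel p s f ζ η ∂arcLength ∂arcLength =
      ∫⁻ ζ, poissonWeight s a ζ * ∫⁻ η, diffKernel p s f ζ η ∂arcLength ∂arcLength := by
    rw [← e1, lintegral_lintegral_swap
      (f := fun ζ η => poissonWeight s a η * diffKernel p s f ζ η)
      ((hw.comp measurable_snd).mul hk).aemeasurable]
    congr 1 with ζ
    congr 1 with η
    rw [diffKernel_comm]
  rw [invariantIntegral_eq]
  calc _ ≤ ∫⁻ ζ, ∫⁻ η, (poissonWeight s a ζ * diffKernel p s f ζ η +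
        poissonWeight s a η * diffKernel p s f ζ η) ∂arcLength ∂arcLength := by
        gcongr with ζ η
        rw [mul_comm, ← add_mul]
        gcongr
        exact ofReal_rpow_le_poissonWeight_add hs0.le ha' ζ η
    _ = (∫⁻ ζ, ∫⁻ η, poissonWeight s a ζ * diffKernel p s f ζ η ∂arcLength ∂arcLength) +
        ∫⁻ ζ, ∫⁻ η, poissonWeight s a η * diffKernel p s f ζ η ∂arcLength ∂arcLength := by
        rw [← lintegral_add_left]
        · congr 1 with ζ
          rw [lintegral_add_left ((measurable_diffKernel_right hf ζ).const_mul _)]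
        · exact Measurable.lintegral_prod_right'
            (f := fun q : Circle × Circle => poissonWeight s a q.1 * diffKernel p s f q.1 q.2)
            ((hw.comp measurable_fst).mul hk)
    _ ≤ K + K := by
        rw [e2, e1]
        exact add_le_add (hKb a ha') (hKb a ha')

/-- On the arc of length `ℓ` centred at `e^{iθ}` the Möbius factor at `a = (1 - ℓ/4π) e^{iθ}` is
bounded below by a multiple of `ℓ^{-s}`. -/
lemma seminormPow_lt_top_of_iSup_invariantIntegral_lt_top (hs0 : 0 < s)
    (h : (⨆ a ∈ Metric.ball (0 : ℂ) 1, invariantIntegral p s f a) < ∞) :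
    seminormPow p s f < ∞ := by
  have hpi := Real.pi_pos
  unfold seminormPow
  rw [iSup_div_rpow_lt_top_iff]
  set S := ⨆ a ∈ Metric.ball (0 : ℂ) 1, invariantIntegral p s f a with hS
  refine ⟨(4 * Real.pi) ^ s * S.toReal, by positivity, fun θ ℓ h0 h1 => ?_⟩
  have hℓπ : ℓ / (4 * Real.pi) ≤ 1 / 2 := by
    rw [div_le_iff₀ (by positivity)]; linarith
  have hℓ0 : 0 < ℓ / (4 * Real.pi) := by positivity
  set r : ℝ := 1 - ℓ / (4 * Real.pi) with hr
  have hr0 : 0 ≤ r := by linarith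
  have hr1 : r < 1 := by linarith
  set a : ℂ := r * Circle.exp θ with ha
  have hnorm : ‖a‖ = r := by
    rw [ha, norm_mul, Circle.norm_coe, mul_one, Complex.norm_real, Real.norm_eq_abs,
      abs_of_nonneg hr0]
  have hdist : ∀ ζ ∈ arc θ ℓ, 0 < ‖(ζ : ℂ) - a‖ ∧ ‖(ζ : ℂ) - a‖ ≤ ℓ := by
    rintro _ ⟨x, hx, rfl⟩
    constructor
    · have := norm_sub_norm_le (Circle.exp x : ℂ) a
      rw [Circle.norm_coe, hnorm] at this
      linarith
    · have h2 := norm_exp_sub_exp_le x θ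
      have h3 : |x - θ| ≤ ℓ / 2 := by
        rw [abs_le]; constructor <;> linarith [hx.1, hx.2]
      calc ‖(Circle.exp x : ℂ) - a‖
          = ‖((Circle.exp x : ℂ) - Circle.exp θ) + ((1 - r : ℝ) : ℂ) * Circle.exp θ‖ := by
            congr 1; rw [ha]; push_cast; ring
        _ ≤ ℓ / 2 + ℓ / (4 * Real.pi) := by
            refine (norm_add_le _ _).trans (add_le_add (h2.trans h3) ?_)
            rw [norm_mul, Circle.norm_coe, mul_one, Complex.norm_real, Real.norm_eq_abs,
              abs_of_nonneg (by linarith : (0:ℝ) ≤ 1 - r), hr]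
            linarith
        _ ≤ ℓ := by
            have : ℓ / (4 * Real.pi) ≤ ℓ / 2 := by
              gcongr; linarith [Real.pi_gt_three]
            linarith
  have hpt : ∀ ζ ∈ arc θ ℓ, ∀ η ∈ arc θ ℓ,
      ENNReal.ofReal (‖f ζ - f η‖ ^ p / ‖(ζ : ℂ) - (η : ℂ)‖ ^ (2 - s)) ≤
      ENNReal.ofReal ((4 * Real.pi * ℓ) ^ s) *
      ENNReal.ofReal (‖f ζ - f η‖ ^ p / ‖(ζ : ℂ) - (η : ℂ)‖ ^ (2 - s) *
        ((1 - ‖a‖ ^ 2) / (‖(ζ : ℂ) - a‖ * ‖(η : ℂ) - a‖)) ^ s) := by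
    intro ζ hζ η hη
    obtain ⟨z0, z1⟩ := hdist ζ hζ
    obtain ⟨e0, e1⟩ := hdist η hη
    rw [← ENNReal.ofReal_mul (by positivity)]
    apply ENNReal.ofReal_le_ofReal
    rw [mul_left_comm]
    refine le_mul_of_one_le_right (by positivity) ?_
    have h1r : 1 - r = ℓ / (4 * Real.pi) := by rw [hr]; ring
    have hnn : ℓ / (4 * Real.pi) ≤ 1 - ‖a‖ ^ 2 := by rw [hnorm, ← h1r]; nlinarith
    rw [← Real.mul_rpow (by positivity) (by have := hℓ0.le.trans hnn; positivity)]
    refine Real.one_le_rpow ?_ hs0.le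
    rw [← mul_div_assoc, one_le_div (by positivity)]
    calc ‖(ζ : ℂ) - a‖ * ‖(η : ℂ) - a‖ ≤ ℓ * ℓ := by gcongr
      _ = 4 * Real.pi * ℓ * (ℓ / (4 * Real.pi)) := by field_simp
      _ ≤ _ := by gcongr
  calc _ ≤ ∫⁻ ζ in arc θ ℓ, ∫⁻ η in arc θ ℓ, ENNReal.ofReal ((4 * Real.pi * ℓ) ^ s) *
      ENNReal.ofReal (‖f ζ - f η‖ ^ p / ‖(ζ : ℂ) - (η : ℂ)‖ ^ (2 - s) *
        ((1 - ‖a‖ ^ 2) / (‖(ζ : ℂ) - a‖ * ‖(η : ℂ) - a‖)) ^ s) ∂arcLength ∂arcLength :=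
        setLIntegral_mono' (measurableSet_arc θ ℓ) fun ζ hζ =>
          setLIntegral_mono' (measurableSet_arc θ ℓ) fun η hη => hpt ζ hζ η hη
    _ ≤ ENNReal.ofReal ((4 * Real.pi * ℓ) ^ s) * invariantIntegral p s f a := by
        simp_rw [lintegral_const_mul' _ _ ENNReal.ofReal_ne_top]
        unfold invariantIntegral
        gcongr <;> exact Measure.restrict_le_self
    _ ≤ ENNReal.ofReal ((4 * Real.pi * ℓ) ^ s) * S := by
        gcongr
        refine le_iSup₂_of_le a ?_ le_rfl
        simpa [hnorm] using hr1
    _ = _ := by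
        rw [Real.mul_rpow (by positivity) h0.le,
          show (4 * Real.pi) ^ s * S.toReal * ℓ ^ s =
            ((4 * Real.pi) ^ s * ℓ ^ s) * S.toReal by ring,
          ENNReal.ofReal_mul (by positivity) (p := (4 * Real.pi) ^ s * ℓ ^ s),
          ENNReal.ofReal_toReal h.ne]

end Invariant

/-! ### Carleson sectors in polar coordinates -/

lemma measurable_gradNorm (F : ℂ → ℂ) : Measurable (gradNorm F) := by
  unfold gradNorm
  have h1 := (measurable_fderiv_apply_const ℝ F 1).norm.pow_const 2
  have h2 := (measurable_fderiv_apply_const ℝ F Complex.I).norm.pow_const 2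
  exact Real.continuous_sqrt.measurable.comp (h1.add h2)

lemma mul_mem_carlesonSector_iff {θ ℓ r : ℝ} (hℓ : ℓ ≤ 2 * Real.pi) (hr : 0 < r) (ζ : Circle) :
    (r * ζ : ℂ) ∈ carlesonSector θ ℓ ↔ r ∈ Set.Ioo (1 - ℓ / (2 * Real.pi)) 1 ∧ ζ ∈ arc θ ℓ := by
  have hpi := Real.pi_pos
  have hL : ℓ / (2 * Real.pi) ≤ 1 := (div_le_one (by positivity)).2 hℓ
  constructor
  · rintro ⟨t, ht1, ht2, ξ, hξ, h⟩
    have hn := congrArg norm h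
    rw [norm_mul, norm_mul, Circle.norm_coe, Circle.norm_coe, mul_one, mul_one, Complex.norm_real,
      Complex.norm_real, Real.norm_eq_abs, Real.norm_eq_abs, abs_of_pos hr,
      abs_of_nonneg (by linarith)] at hn
    subst hn
    have : ζ = ξ := Subtype.ext (mul_left_cancel₀ (Complex.ofReal_ne_zero.2 hr.ne') h)
    exact ⟨⟨ht1, ht2⟩, this ▸ hξ⟩
  · rintro ⟨⟨h1, h2⟩, h3⟩
    exact ⟨r, h1, h2, ζ, h3, rfl⟩

lemma carlesonSector_subset_ball {θ ℓ : ℝ} (hℓ : ℓ ≤ 2 * Real.pi) :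
    carlesonSector θ ℓ ⊆ Metric.ball 0 1 := by
  have hpi := Real.pi_pos
  have hL : ℓ / (2 * Real.pi) ≤ 1 := (div_le_one (by positivity)).2 hℓ
  rintro _ ⟨t, ht1, ht2, ξ, hξ, rfl⟩
  rw [mem_ball_zero_iff, norm_mul, Circle.norm_coe, mul_one, Complex.norm_real, Real.norm_eq_abs,
    abs_of_nonneg (by linarith)]
  exact ht2

lemma measurableSet_carlesonSector {θ ℓ : ℝ} (hℓ : ℓ ≤ 2 * Real.pi) :
    MeasurableSet (carlesonSector θ ℓ) := by
  have hpi := Real.pi_pos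
  have hL : ℓ / (2 * Real.pi) ≤ 1 := (div_le_one (by positivity)).2 hℓ
  have e : carlesonSector θ ℓ = {z | z ≠ 0} ∩ ((fun z : ℂ => ‖z‖) ⁻¹'
      Set.Ioo (1 - ℓ / (2 * Real.pi)) 1 ∩ (fun z : ℂ => Circle.exp z.arg) ⁻¹' arc θ ℓ) := by
    ext z
    by_cases hz : z = 0
    · subst hz
      simp only [Set.mem_inter_iff, Set.mem_ofPred_eq, ne_eq, not_true_eq_false, false_and,
        iff_false]
      rintro ⟨t, ht1, ht2, ξ, hξ, h⟩
      have hn := congrArg norm h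
      rw [norm_mul, Circle.norm_coe, Complex.norm_real, Real.norm_eq_abs, norm_zero,
        abs_of_nonneg (by linarith)] at hn
      linarith
    · have hz' : z = (‖z‖ : ℂ) * Circle.exp z.arg := by
        rw [Circle.coe_exp, Complex.norm_mul_exp_arg_mul_I]
      have := mul_mem_carlesonSector_iff (θ := θ) hℓ (norm_pos_iff.2 hz) (Circle.exp z.arg)
      rw [← hz'] at this
      rw [this]
      simp [hz]
  rw [e]
  refine (measurableSet_singleton (0 : ℂ)).compl.inter (MeasurableSet.inter ?_ ?_)
  · exact measurable_norm measurableSet_Ioo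
  · exact (measurable_circleExp.comp Complex.measurable_arg) (measurableSet_arc θ ℓ)

lemma setLIntegral_Ioo_comp_one_sub (H : ℝ → ℝ≥0∞) (L : ℝ) :
    ∫⁻ r in Set.Ioo (1 - L) 1, H r = ∫⁻ h in Set.Ioo 0 L, H (1 - h) := by
  have h :=
    (Measure.measurePreserving_sub_left (volume : Measure ℝ) 1).setLIntegral_comp_preimage_emb
    (measurableEmbedding_subLeft 1) H (Set.Ioo (1 - L) 1)
  rw [← h]
  congr 2
  simp

/-- Integration over a Carleson sector in polar coordinates. -/
lemma setLIntegral_carlesonSector {φ : ℂ → ℝ≥0∞} (hφ : Measurable φ) {θ ℓ : ℝ}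
    (hℓ : ℓ ≤ 2 * Real.pi) :
    ∫⁻ z in carlesonSector θ ℓ, φ z = ∫⁻ h in Set.Ioo 0 (ℓ / (2 * Real.pi)),
      ENNReal.ofReal (1 - h) * ∫⁻ x in Set.Icc (θ - ℓ / 2) (θ + ℓ / 2),
        φ ((1 - h : ℝ) * Circle.exp x) := by
  have hpi := Real.pi_pos
  have hL : ℓ / (2 * Real.pi) ≤ 1 := (div_le_one (by positivity)).2 hℓ
  have hS := measurableSet_carlesonSector (θ := θ) hℓ
  have hpm : Measurable fun q : ℝ × Circle => φ (q.1 * q.2) :=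
    hφ.comp ((Complex.measurable_ofReal.comp measurable_fst).mul
      (measurable_circle_coe.comp measurable_snd))
  have hpe : ∀ q : ℝ × ℝ, Complex.polarCoord.symm q = q.1 * Circle.exp q.2 := fun q => by
    rw [Complex.polarCoord_symm_apply, Circle.coe_exp, Complex.exp_mul_I]
    push_cast
    rfl
  rw [← setLIntegral_Ioo_comp_one_sub (fun r => ENNReal.ofReal r *
    ∫⁻ x in Set.Icc (θ - ℓ / 2) (θ + ℓ / 2), φ (r * Circle.exp x)), ← lintegral_indicator hS,
    ← Complex.lintegral_comp_polarCoord_symm]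
  simp_rw [hpe, smul_eq_mul]
  rw [show polarCoord.target = Set.Ioi (0 : ℝ) ×ˢ Set.Ioo (-Real.pi) Real.pi from rfl,
    Measure.volume_eq_prod, setLIntegral_prod]
  swap
  · refine Measurable.aemeasurable ?_
    refine (ENNReal.measurable_ofReal.comp measurable_fst).mul ?_
    exact (hφ.indicator hS).comp ((Complex.measurable_ofReal.comp measurable_fst).mul
      (measurable_circle_coe.comp (measurable_circleExp.comp measurable_snd)))
  have key : ∀ r ∈ Set.Ioi (0:ℝ), ∫⁻ x in Set.Ioo (-Real.pi) Real.pi, ENNReal.ofReal r *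
      (carlesonSector θ ℓ).indicator φ (r * Circle.exp x) =
      (Set.Ioo (1 - ℓ / (2 * Real.pi)) 1).indicator (fun r => ENNReal.ofReal r *
        ∫⁻ x in Set.Icc (θ - ℓ / 2) (θ + ℓ / 2), φ (r * Circle.exp x)) r := by
    intro r hr
    have hr' : 0 < r := hr
    have hφr : Measurable fun ζ : Circle => φ (r * ζ) :=
      hpm.comp (measurable_const.prodMk measurable_id)
    rw [lintegral_const_mul' _ _ ENNReal.ofReal_ne_top]
    by_cases hrI : r ∈ Set.Ioo (1 - ℓ / (2 * Real.pi)) 1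
    · rw [Set.indicator_of_mem hrI]
      congr 1
      rw [← setLIntegral_arc hφr hℓ, ← lintegral_indicator (measurableSet_arc θ ℓ),
        lintegral_arcLength (hφr.indicator (measurableSet_arc θ ℓ)) (-Real.pi),
        show -Real.pi + 2 * Real.pi = Real.pi by ring, restrict_Ioo_eq_restrict_Ioc]
      congr 1 with x
      have e : (r * Circle.exp x : ℂ) ∈ carlesonSector θ ℓ ↔ Circle.exp x ∈ arc θ ℓ :=
        (mul_mem_carlesonSector_iff hℓ hr' _).trans (and_iff_right hrI)
      by_cases hx : Circle.exp x ∈ arc θ ℓ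
      · rw [Set.indicator_of_mem hx, Set.indicator_of_mem (e.2 hx)]
      · rw [Set.indicator_of_notMem hx, Set.indicator_of_notMem (fun h => hx (e.1 h))]
    · rw [Set.indicator_of_notMem hrI]
      simp only [Set.indicator, mul_mem_carlesonSector_iff hℓ hr', hrI, false_and, if_false,
        lintegral_zero, mul_zero]
  rw [setLIntegral_congr_fun measurableSet_Ioi key, setLIntegral_indicator measurableSet_Ioo]
  congr 2
  exact Set.inter_eq_left.2 fun r hr => lt_of_le_of_lt (by linarith) hr.1

/-- The density of `gradMeasure` at the point `(1 - h) e^{ix}`. -/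
noncomputable def gradDensity (p s : ℝ) (F : ℂ → ℂ) (h x : ℝ) : ℝ≥0∞ :=
  ENNReal.ofReal (gradNorm F ((1 - h : ℝ) * Circle.exp x) ^ p * (1 - (1 - h) ^ 2) ^ (p - 2 + s))

lemma gradMeasure_carlesonSector {p s θ ℓ : ℝ} (F : ℂ → ℂ) (hℓ : ℓ ≤ 2 * Real.pi) :
    gradMeasure p s F (carlesonSector θ ℓ) = ∫⁻ h in Set.Ioo 0 (ℓ / (2 * Real.pi)),
      ENNReal.ofReal (1 - h) * ∫⁻ x in Set.Icc (θ - ℓ / 2) (θ + ℓ / 2), gradDensity p s F h x := by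
  have hφ : Measurable fun z : ℂ =>
      ENNReal.ofReal (gradNorm F z ^ p * (1 - ‖z‖ ^ 2) ^ (p - 2 + s)) := by
    have h1 := (measurable_gradNorm F).pow_const p
    have h2 : Measurable fun z : ℂ => (1 - ‖z‖ ^ 2) ^ (p - 2 + s) :=
      ((measurable_norm.pow_const 2).const_sub 1).pow_const _
    exact (h1.mul h2).ennreal_ofReal
  have hpi := Real.pi_pos
  have hL : ℓ / (2 * Real.pi) ≤ 1 := (div_le_one (by positivity)).2 hℓ
  rw [gradMeasure, withDensity_apply' , Measure.restrict_restrict_of_subset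
    (carlesonSector_subset_ball hℓ), setLIntegral_carlesonSector hφ hℓ]
  refine setLIntegral_congr_fun measurableSet_Ioo fun h hh => ?_
  simp only [gradDensity]
  congr 1
  congr 1 with x
  rw [norm_mul, Circle.norm_coe, mul_one, Complex.norm_real, Real.norm_eq_abs, sq_abs]

/-! ### The Poisson extension and its gradient -/

section Poisson

/-- The function on the plane that is constant on rays and agrees with `f` on the unit circle; it
lets the circle averages of functions of a complex variable be applied to functions on `Circle`. -/
noncomputable def radialExt (f : Circle → ℂ) (z : ℂ) : ℂ := f (Circle.exp z.arg)

lemma radialExt_coe (f : Circle → ℂ) (ζ : Circle) : radialExt f (ζ : ℂ) = f ζ := by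
  rw [radialExt, Circle.exp_arg]

lemma circleMap_eq_exp (x : ℝ) : circleMap 0 1 x = (Circle.exp x : ℂ) := by
  simp [circleMap, Circle.coe_exp]

variable {E : Type*} [NormedAddCommGroup E] [NormedSpace ℝ E]

lemma integral_arcLength {F : Circle → E} (hF : AEStronglyMeasurable F arcLength) :
    ∫ ζ, F ζ ∂arcLength = ∫ x in (0 : ℝ)..2 * Real.pi, F (Circle.exp x) := by
  have hper : Function.Periodic (fun x => F (Circle.exp x)) (2 * Real.pi) := fun x => by
    simp only [Circle.periodic_exp x]
  have h := hper.intervalIntegral_add_eq (-Real.pi) 0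
  rw [zero_add] at h
  rw [← h, arcLength, integral_map measurable_circleExp.aemeasurable hF,
    intervalIntegral.integral_of_le (by linarith [Real.pi_pos])]
  congr 3
  ring

lemma circleAverage_eq_integral_arcLength {F : ℂ → E}
    (hF : AEStronglyMeasurable (fun ζ : Circle => F ζ) arcLength) :
    Real.circleAverage F 0 1 = (2 * Real.pi)⁻¹ • ∫ ζ : Circle, F ζ ∂arcLength := by
  rw [integral_arcLength hF, Real.circleAverage]
  simp only [circleMap_eq_exp]

lemma circleIntegrable_radialExt {f : Circle → ℂ} (hf : Integrable f arcLength) :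
    CircleIntegrable (radialExt f) 0 1 := by
  rw [CircleIntegrable]
  simp only [circleMap_eq_exp, radialExt_coe]
  have hper : Function.Periodic (fun x => f (Circle.exp x)) (2 * Real.pi) := fun x => by
    simp only [Circle.periodic_exp x]
  have h : IntervalIntegrable (fun x => f (Circle.exp x)) volume (-Real.pi)
      (-Real.pi + 2 * Real.pi) := by
    rw [intervalIntegrable_iff_integrableOn_Ioc_of_le (by linarith [Real.pi_pos]),
      show -Real.pi + 2 * Real.pi = Real.pi by ring]
    exact hf.comp_measurable measurable_circleExp
  exact hper.intervalIntegrable Real.two_pi_pos.ne' h 0 (2 * Real.pi)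

lemma one_sub_norm_le (z : ℂ) (ζ : Circle) : 1 - ‖z‖ ≤ ‖(ζ : ℂ) - z‖ := by
  have := norm_sub_norm_le (ζ : ℂ) z
  rwa [Circle.norm_coe] at this

lemma measurable_poissonKernel (z : ℂ) : Measurable fun ζ : Circle => poissonKernel 0 z ζ := by
  simp only [poissonKernel_def, sub_zero]
  exact ((measurable_circle_coe.norm.pow_const 2).sub_const _).div
    ((measurable_circle_coe.sub_const z).norm.pow_const 2)

lemma measurable_herglotzRieszKernel (z : ℂ) :
    Measurable fun ζ : Circle => herglotzRieszKernel 0 z ζ := by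
  simp only [herglotzRieszKernel_def, sub_zero]
  exact (measurable_circle_coe.add_const z).div (measurable_circle_coe.sub_const z)

lemma norm_herglotzRieszKernel_le {z : ℂ} (hz : ‖z‖ < 1) (ζ : Circle) :
    ‖herglotzRieszKernel 0 z ζ‖ ≤ 2 / (1 - ‖z‖) := by
  have h := one_sub_norm_le z ζ
  rw [herglotzRieszKernel_def, sub_zero, sub_zero, norm_div]
  have h0 : 0 < 1 - ‖z‖ := sub_pos.2 hz
  gcongr
  refine (norm_add_le _ _).trans ?_
  rw [Circle.norm_coe]; linarith

lemma poissonKernel_nonneg {z : ℂ} (hz : ‖z‖ < 1) (ζ : Circle) : 0 ≤ poissonKernel 0 z ζ := by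
  rw [poissonKernel_def, sub_zero, sub_zero, Circle.norm_coe]
  have : 0 ≤ 1 ^ 2 - ‖z‖ ^ 2 := by nlinarith [norm_nonneg z]
  positivity

lemma abs_poissonKernel_le {z : ℂ} (hz : ‖z‖ < 1) (ζ : Circle) :
    ‖poissonKernel 0 z ζ‖ ≤ 2 / (1 - ‖z‖) := by
  rw [poissonKernel_eq_re_herglotzRieszKernel]
  exact (Complex.abs_re_le_norm _).trans (norm_herglotzRieszKernel_le hz ζ)

variable {f g : Circle → ℂ}

lemma integrable_poissonKernel_smul (hf : Integrable f arcLength) {z : ℂ} (hz : ‖z‖ < 1) :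
    Integrable (fun ζ : Circle => poissonKernel 0 z ζ • f ζ) arcLength :=
  hf.bdd_smul (2 / (1 - ‖z‖)) (measurable_poissonKernel z).aestronglyMeasurable
    (Filter.Eventually.of_forall (abs_poissonKernel_le hz))

lemma integrable_herglotzRieszKernel_smul (hf : Integrable f arcLength) {z : ℂ} (hz : ‖z‖ < 1) :
    Integrable (fun ζ : Circle => herglotzRieszKernel 0 z ζ • f ζ) arcLength :=
  hf.bdd_smul (2 / (1 - ‖z‖)) (measurable_herglotzRieszKernel z).aestronglyMeasurable
    (Filter.Eventually.of_forall (norm_herglotzRieszKernel_le hz))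

lemma poissonExt_sub (hf : Integrable f arcLength) (hg : Integrable g arcLength) {z : ℂ}
    (hz : ‖z‖ < 1) : poissonExt (fun ζ => f ζ - g ζ) z = poissonExt f z - poissonExt g z := by
  unfold poissonExt
  simp only [smul_sub]
  rw [integral_sub (integrable_poissonKernel_smul hf hz) (integrable_poissonKernel_smul hg hz),
    smul_sub]

lemma poissonExt_const (c : ℂ) {z : ℂ} (hz : ‖z‖ < 1) : poissonExt (fun _ => c) z = c := by
  have h := DiffContOnCl.circleAverage_poissonKernel_smul (f := fun _ : ℂ => c) (c := 0) (R := 1)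
    (w := z) diffContOnCl_const (by simpa using hz)
  rw [circleAverage_eq_integral_arcLength] at h
  · exact h
  · exact ((measurable_poissonKernel z).smul measurable_const).aestronglyMeasurable

lemma integral_poissonKernel {z : ℂ} (hz : ‖z‖ < 1) :
    ∫ ζ : Circle, poissonKernel 0 z ζ ∂arcLength = 2 * Real.pi := by
  have h := poissonExt_const 1 hz
  have hpi := Real.pi_pos
  unfold poissonExt at h
  rw [integral_smul_const] at h
  have h2 : (2 * Real.pi)⁻¹ * ∫ ζ : Circle, poissonKernel 0 z ζ ∂arcLength = 1 := by
    have := congrArg Complex.re h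
    simpa using this
  field_simp at h2
  linarith

/-- The Herglotz integral of `f`, a holomorphic function on the unit disk. -/
noncomputable def herglotzExt (f : Circle → ℂ) (z : ℂ) : ℂ :=
  Real.circleAverage (fun ζ => herglotzRieszKernel 0 z ζ • radialExt f ζ) 0 1

lemma herglotzExt_eq (hf : Integrable f arcLength) {z : ℂ} (hz : ‖z‖ < 1) :
    herglotzExt f z =
      (2 * Real.pi)⁻¹ • ∫ ζ : Circle, herglotzRieszKernel 0 z ζ • f ζ ∂arcLength := by
  have h := integrable_herglotzRieszKernel_smul hf hz
  rw [herglotzExt, circleAverage_eq_integral_arcLength]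
  · simp only [radialExt_coe]
  · simpa only [radialExt_coe] using h.aestronglyMeasurable

lemma integrable_conj (hf : Integrable f arcLength) :
    Integrable (fun ζ => (starRingEnd ℂ) (f ζ)) arcLength :=
  (Complex.conjCLE : ℂ →L[ℝ] ℂ).integrable_comp hf

/-- A Poisson extension is the average of a holomorphic and an antiholomorphic function. -/
lemma poissonExt_eq_herglotzExt (hf : Integrable f arcLength) {z : ℂ} (hz : ‖z‖ < 1) :
    poissonExt f z = (1 / 2 : ℂ) * (herglotzExt f z +
      (starRingEnd ℂ) (herglotzExt (fun ζ => (starRingEnd ℂ) (f ζ)) z)) := by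
  have h1 := integrable_herglotzRieszKernel_smul hf hz
  have h2 := integrable_herglotzRieszKernel_smul (integrable_conj hf) hz
  rw [herglotzExt_eq hf hz, herglotzExt_eq (integrable_conj hf) hz, Complex.real_smul,
    Complex.real_smul, map_mul, Complex.conj_ofReal, ← integral_conj, ← mul_add,
    ← integral_add h1 (integrable_conj h2), poissonExt, Complex.real_smul, mul_left_comm,
    ← integral_const_mul (1 / 2 : ℂ)]
  congr 1
  refine integral_congr_ae (Filter.Eventually.of_forall fun ζ => ?_)
  simp only []
  rw [poissonKernel_eq_re_herglotzRieszKernel, Function.comp_apply, Complex.real_smul,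
    Complex.re_eq_add_conj]
  simp only [smul_eq_mul, map_mul, Complex.conj_conj]
  ring

/-- The derivative of the Herglotz integral. -/
noncomputable def herglotzDeriv (f : Circle → ℂ) (z : ℂ) : ℂ :=
  Real.circleAverage (fun ζ => (2 * ζ / (ζ - z) ^ 2) • radialExt f ζ) 0 1

lemma hasDerivAt_herglotzExt (hf : Integrable f arcLength) {z : ℂ} (hz : ‖z‖ < 1) :
    HasDerivAt (herglotzExt f) (herglotzDeriv f z) z :=
  hasDerivAt_circleAverage_herglotzRieszKernel_smul (circleIntegrable_radialExt hf)
    (by simpa using hz)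

lemma norm_herglotzDeriv_le (hf : Integrable f arcLength) {z : ℂ} :
    ‖herglotzDeriv f z‖ ≤ (2 * Real.pi)⁻¹ * (2 * ∫ ζ, ‖f ζ‖ / ‖(ζ : ℂ) - z‖ ^ 2 ∂arcLength) := by
  have hpi := Real.pi_pos
  have hm : AEStronglyMeasurable (fun ζ : Circle => (2 * ζ / (ζ - z) ^ 2 : ℂ) • f ζ) arcLength := by
    have h1 : Measurable fun ζ : Circle => (2 * ζ : ℂ) := measurable_circle_coe.const_mul 2
    have h2 : Measurable fun ζ : Circle => ((ζ : ℂ) - z) ^ 2 :=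
      (measurable_circle_coe.sub_const z).pow_const 2
    exact (h1.div h2).aestronglyMeasurable.smul hf.aestronglyMeasurable
  rw [herglotzDeriv, circleAverage_eq_integral_arcLength]
  swap
  · simpa only [radialExt_coe] using hm
  simp only [radialExt_coe]
  rw [norm_smul, Real.norm_of_nonneg (by positivity), ← integral_const_mul]
  gcongr
  refine (norm_integral_le_integral_norm _).trans (le_of_eq ?_)
  congr 1 with ζ
  rw [norm_smul, norm_div, norm_mul, norm_pow, Circle.norm_coe]
  simp
  ring

lemma hasFDerivAt_poissonExt (hf : Integrable f arcLength) {z : ℂ} (hz : ‖z‖ < 1) :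
    ∃ D : ℂ →L[ℝ] ℂ, HasFDerivAt (poissonExt f) D z ∧ ∀ v, D v = (1 / 2 : ℂ) *
      (v * herglotzDeriv f z +
        (starRingEnd ℂ) (v * herglotzDeriv (fun ζ => (starRingEnd ℂ) (f ζ)) z)) := by
  have h1 := (hasDerivAt_herglotzExt hf hz).hasFDerivAt.restrictScalars ℝ
  have h2 := (hasDerivAt_herglotzExt (integrable_conj hf) hz).hasFDerivAt.restrictScalars ℝ
  have h3 := (h1.add ((Complex.conjCLE : ℂ →L[ℝ] ℂ).hasFDerivAt.comp z h2)).const_mul (1 / 2 : ℂ)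
  refine ⟨_, h3.congr_of_eventuallyEq ?_, fun v => ?_⟩
  · filter_upwards [Metric.isOpen_ball.mem_nhds (show z ∈ Metric.ball (0:ℂ) 1 by simpa using hz)]
      with w hw
    exact poissonExt_eq_herglotzExt hf (by simpa using hw)
  · simp
    ring

lemma contDiffOn_poissonExt (hf : Integrable f arcLength) :
    ContDiffOn ℝ 1 (poissonExt f) (Metric.ball 0 1) := by
  have key : ∀ g : Circle → ℂ, Integrable g arcLength →
      ContDiffOn ℝ 1 (herglotzExt g) (Metric.ball 0 1) := fun g hg => by
    have : DifferentiableOn ℂ (herglotzExt g) (Metric.ball 0 1) := fun z hz =>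
      (hasDerivAt_herglotzExt hg (by simpa using hz)).differentiableAt.differentiableWithinAt
    exact (this.contDiffOn Metric.isOpen_ball).restrict_scalars ℝ
  have h := contDiffOn_const (c := (1 / 2 : ℂ)) |>.mul ((key f hf).add
    ((Complex.conjCLE : ℂ →L[ℝ] ℂ).contDiff.comp_contDiffOn (key _ (integrable_conj hf))))
  refine h.congr fun z hz => ?_
  exact poissonExt_eq_herglotzExt hf (by simpa using hz)

lemma gradNorm_poissonExt_le_aux (hf : Integrable f arcLength) {z : ℂ} (hz : ‖z‖ < 1) :
    gradNorm (poissonExt f) z ≤ ∫ ζ, ‖f ζ‖ / ‖(ζ : ℂ) - z‖ ^ 2 ∂arcLength := by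
  obtain ⟨D, hD, hDv⟩ := hasFDerivAt_poissonExt hf hz
  set T := ∫ ζ, ‖f ζ‖ / ‖(ζ : ℂ) - z‖ ^ 2 ∂arcLength with hT
  have hT0 : 0 ≤ T := integral_nonneg fun ζ => by positivity
  have hpi := Real.pi_gt_three
  have hb : ∀ v : ℂ, ‖v‖ = 1 → ‖D v‖ ≤ T / 3 := fun v hv => by
    rw [hDv, norm_mul]
    have e1 := norm_herglotzDeriv_le hf (z := z)
    have e2 := norm_herglotzDeriv_le (integrable_conj hf) (z := z)
    simp only [RCLike.norm_conj] at e2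
    have e3 := norm_add_le (v * herglotzDeriv f z)
      ((starRingEnd ℂ) (v * herglotzDeriv (fun ζ => (starRingEnd ℂ) (f ζ)) z))
    rw [RCLike.norm_conj, norm_mul, norm_mul, hv, one_mul, one_mul] at e3
    have e4 : (2 * Real.pi)⁻¹ * (2 * T) ≤ T / 3 := by
      rw [mul_inv, show 2⁻¹ * Real.pi⁻¹ * (2 * T) = T * Real.pi⁻¹ by ring, div_eq_mul_inv]
      gcongr
    have e5 : ‖(1 / 2 : ℂ)‖ = 1 / 2 := by norm_num
    rw [e5]
    linarith
  rw [gradNorm, hD.fderiv]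
  have h1 := hb 1 (by simp)
  have h2 := hb Complex.I (by simp)
  refine Real.sqrt_le_iff.2 ⟨hT0, ?_⟩
  have := norm_nonneg (D 1)
  have := norm_nonneg (D Complex.I)
  nlinarith

/-- Since constants have vanishing gradient, an arbitrary constant may be subtracted from the
boundary values in the gradient estimate. -/
lemma gradNorm_poissonExt_le (hf : Integrable f arcLength) {z : ℂ} (hz : ‖z‖ < 1) (c : ℂ) :
    gradNorm (poissonExt f) z ≤ ∫ ζ, ‖f ζ - c‖ / ‖(ζ : ℂ) - z‖ ^ 2 ∂arcLength := by
  have hc : Integrable (fun _ : Circle => c) arcLength := integrable_const c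
  have e : fderiv ℝ (poissonExt fun ζ => f ζ - c) z = fderiv ℝ (poissonExt f) z := by
    rw [← fderiv_sub_const (f := poissonExt f) c]
    refine Filter.EventuallyEq.fderiv_eq ?_
    filter_upwards [Metric.isOpen_ball.mem_nhds (show z ∈ Metric.ball (0:ℂ) 1 by simpa using hz)]
      with w hw
    have hw' : ‖w‖ < 1 := by simpa using hw
    rw [poissonExt_sub hf hc hw', poissonExt_const c hw']
  have := gradNorm_poissonExt_le_aux (hf.sub hc) hz
  unfold gradNorm at this ⊢
  rwa [show (f - fun _ => c) = fun ζ => f ζ - c from rfl, e] at this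

end Poisson

/-! ### The gradient measure of the extension is Carleson -/

/-- Hölder's inequality against the constant function `1`. -/
lemma lintegral_rpow_le {α : Type*} [MeasurableSpace α] (ν : Measure α) {p : ℝ} (hp : 1 < p)
    {G : α → ℝ≥0∞} (hG : AEMeasurable G ν) :
    (∫⁻ x, G x ∂ν) ^ p ≤ ν Set.univ ^ (p - 1) * ∫⁻ x, G x ^ p ∂ν := by
  have hpq := Real.HolderConjugate.conjExponent hp
  set q := p.conjExponent
  have h := ENNReal.lintegral_mul_le_Lp_mul_Lq ν hpq hG (aemeasurable_const (b := (1 : ℝ≥0∞)))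
  simp only [Pi.mul_apply, mul_one, ENNReal.one_rpow, lintegral_one] at h
  have hp0 : 0 < p := by linarith
  calc (∫⁻ x, G x ∂ν) ^ p ≤ ((∫⁻ x, G x ^ p ∂ν) ^ (1 / p) * ν Set.univ ^ (1 / q)) ^ p := by
        gcongr
    _ = _ := by
        rw [ENNReal.mul_rpow_of_nonneg _ _ hp0.le, ← ENNReal.rpow_mul, ← ENNReal.rpow_mul,
          one_div_mul_cancel hp0.ne', ENNReal.rpow_one, mul_comm]
        congr 2
        rw [one_div, mul_comm, ← div_eq_mul_inv, hpq.div_conj_eq_sub_one]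

/-- Hölder's inequality for a weight. -/
lemma lintegral_mul_rpow_le {α : Type*} [MeasurableSpace α] {μ : Measure α} {p : ℝ} (hp : 1 < p)
    {G K : α → ℝ≥0∞} (hG : Measurable G) (hK : Measurable K) :
    (∫⁻ x, K x * G x ∂μ) ^ p ≤ (∫⁻ x, K x ∂μ) ^ (p - 1) * ∫⁻ x, K x * G x ^ p ∂μ := by
  have h := lintegral_rpow_le (μ.withDensity K) hp hG.aemeasurable
  rw [lintegral_withDensity_eq_lintegral_mul _ hK hG,
    lintegral_withDensity_eq_lintegral_mul _ hK (hG.pow_const p),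
    withDensity_apply _ MeasurableSet.univ, Measure.restrict_univ] at h
  exact h

lemma lintegral_Ioo_rpow {q a : ℝ} (hq : -1 < q) (ha : 0 ≤ a) :
    ∫⁻ t in Set.Ioo 0 a, ENNReal.ofReal (t ^ q) = ENNReal.ofReal (a ^ (q + 1) / (q + 1)) := by
  have hi := intervalIntegral.intervalIntegrable_rpow' (a := 0) (b := a) hq
  rw [intervalIntegrable_iff_integrableOn_Ioo_of_le ha] at hi
  rw [← ofReal_integral_eq_lintegral_ofReal hi, ← integral_Ioc_eq_integral_Ioo,
    ← intervalIntegral.integral_of_le ha, integral_rpow (Or.inl hq),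
    Real.zero_rpow (by linarith), sub_zero]
  filter_upwards [self_mem_ae_restrict measurableSet_Ioo] with t ht
  exact Real.rpow_nonneg ht.1.le q

lemma lintegral_Ioi_rpow {q a : ℝ} (hq : q < -1) (ha : 0 < a) :
    ∫⁻ t in Set.Ioi a, ENNReal.ofReal (t ^ q) = ENNReal.ofReal (-a ^ (q + 1) / (q + 1)) := by
  rw [← ofReal_integral_eq_lintegral_ofReal (integrableOn_Ioi_rpow_of_lt hq ha),
    integral_Ioi_rpow_of_lt hq ha]
  filter_upwards [self_mem_ae_restrict measurableSet_Ioi] with t ht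
  exact Real.rpow_nonneg (ha.trans ht).le q

lemma rpow_right_le_of_le_two_mul {h b e : ℝ} (h0 : 0 < h) (h1 : h ≤ b) (h2 : b ≤ 2 * h) :
    b ^ e ≤ 2 ^ |e| * h ^ e := by
  rcases le_total 0 e with he | he
  · rw [abs_of_nonneg he, ← Real.mul_rpow (by norm_num) h0.le]
    exact Real.rpow_le_rpow (by linarith) h2 he
  · calc b ^ e ≤ h ^ e := Real.rpow_le_rpow_of_nonpos h0 h1 he
      _ ≤ _ := le_mul_of_one_le_left (by positivity) (Real.one_le_rpow (by norm_num) (abs_nonneg e))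

lemma gradNorm_nonneg (F : ℂ → ℂ) (z : ℂ) : 0 ≤ gradNorm F z := Real.sqrt_nonneg _

lemma norm_one_sub_mul_exp {h : ℝ} (h1 : h ≤ 1) (x : ℝ) :
    ‖((1 - h : ℝ) : ℂ) * Circle.exp x‖ = 1 - h := by
  rw [norm_mul, Circle.norm_coe, mul_one, Complex.norm_real, Real.norm_eq_abs,
    abs_of_nonneg (by linarith)]

section CarlesonOfArcBound

variable {p s M : ℝ} {f : Circle → ℂ}

/-- The kernel `|ζ - z|^{-2}` that bounds the gradient of the Poisson kernel. -/
noncomputable def invSqDist (z : ℂ) (ζ : Circle) : ℝ≥0∞ := ENNReal.ofReal (1 / ‖(ζ : ℂ) - z‖ ^ 2)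

lemma measurable_invSqDist (z : ℂ) : Measurable (invSqDist z) :=
  (((measurable_circle_coe.sub_const z).norm.pow_const 2).const_div 1).ennreal_ofReal

lemma lintegral_invSqDist_le {h : ℝ} (h0 : 0 < h) (h1 : h < 1) (x : ℝ) :
    ∫⁻ ζ, invSqDist ((1 - h : ℝ) * Circle.exp x) ζ ∂arcLength ≤
      ENNReal.ofReal (2 * Real.pi / h) := by
  set z : ℂ := (1 - h : ℝ) * Circle.exp x with hz
  have hn : ‖z‖ = 1 - h := norm_one_sub_mul_exp h1.le x
  have hz1 : ‖z‖ < 1 := by linarith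
  have e : ∀ ζ : Circle, invSqDist z ζ ≤
      ENNReal.ofReal (1 / h) * ENNReal.ofReal (poissonKernel 0 z ζ) := fun ζ => by
    rw [← ENNReal.ofReal_mul (by positivity), invSqDist, poissonKernel_def, sub_zero, sub_zero,
      Circle.norm_coe, hn, ← mul_div_assoc]
    apply ENNReal.ofReal_le_ofReal
    gcongr
    rw [one_div_mul_eq_div, le_div_iff₀ h0]
    nlinarith
  have hint : Integrable (fun ζ : Circle => poissonKernel 0 z ζ) arcLength := by
    have := integrable_poissonKernel_smul (integrable_const (1 : ℂ)) hz1
    simpa using this.re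
  calc _ ≤ ∫⁻ ζ : Circle, ENNReal.ofReal (1 / h) * ENNReal.ofReal (poissonKernel 0 z ζ)
        ∂arcLength := lintegral_mono e
    _ = ENNReal.ofReal (1 / h) * ENNReal.ofReal (2 * Real.pi) := by
        rw [lintegral_const_mul' _ _ ENNReal.ofReal_ne_top,
          ← ofReal_integral_eq_lintegral_ofReal hint
            (Filter.Eventually.of_forall (poissonKernel_nonneg hz1)), integral_poissonKernel hz1]
    _ = _ := by
        rw [← ENNReal.ofReal_mul (by positivity)]
        congr 1
        ring

/-- Pointwise bound for the gradient of the Poisson extension. The constant subtracted from the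
boundary values is the value at the radial projection. -/
lemma gradDensity_poissonExt_le (hp : 1 < p) (hf : Measurable f) (hfi : Integrable f arcLength)
    {h : ℝ} (h0 : 0 < h) (h1 : h < 1) (x : ℝ) :
    gradDensity p s (poissonExt f) h x ≤
      ENNReal.ofReal (2 ^ |p - 2 + s| * (2 * Real.pi) ^ (p - 1)) * (ENNReal.ofReal (h ^ (s - 1)) *
        ∫⁻ η, invSqDist ((1 - h : ℝ) * Circle.exp x) η * diffPow p f (Circle.exp x) η
          ∂arcLength) := by
  set z : ℂ := (1 - h : ℝ) * Circle.exp x with hz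
  set c := f (Circle.exp x) with hc
  have hn : ‖z‖ = 1 - h := norm_one_sub_mul_exp h1.le x
  have hz1 : ‖z‖ < 1 := by linarith
  have hpi := Real.pi_pos
  have hp0 : 0 < p := by linarith
  have hgrad : ENNReal.ofReal (gradNorm (poissonExt f) z) ≤
      ∫⁻ η, invSqDist z η * ENNReal.ofReal ‖f (Circle.exp x) - f η‖ ∂arcLength := by
    refine (ENNReal.ofReal_le_ofReal (gradNorm_poissonExt_le hfi hz1 c)).trans ?_
    rw [← Real.enorm_eq_ofReal (integral_nonneg fun η => by positivity)]
    refine (enorm_integral_le_lintegral_enorm _).trans (le_of_eq ?_)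
    congr 1 with η
    rw [Real.enorm_eq_ofReal (by positivity), invSqDist, ← ENNReal.ofReal_mul (by positivity),
      norm_sub_rev]
    congr 1
    ring
  have hG : Measurable fun η => ENNReal.ofReal ‖f (Circle.exp x) - f η‖ :=
    (hf.const_sub _).norm.ennreal_ofReal
  have hpow : ENNReal.ofReal (gradNorm (poissonExt f) z ^ p) ≤
      ENNReal.ofReal ((2 * Real.pi / h) ^ (p - 1)) *
        ∫⁻ η, invSqDist z η * diffPow p f (Circle.exp x) η ∂arcLength := by
    rw [← ENNReal.ofReal_rpow_of_nonneg (gradNorm_nonneg _ _) hp0.le]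
    refine (ENNReal.rpow_le_rpow hgrad hp0.le).trans ?_
    refine (lintegral_mul_rpow_le hp hG (measurable_invSqDist z)).trans ?_
    gcongr with η
    · rw [← ENNReal.ofReal_rpow_of_nonneg (by positivity) (by linarith)]
      exact ENNReal.rpow_le_rpow (lintegral_invSqDist_le h0 h1 x) (by linarith)
    · rw [diffPow, ENNReal.ofReal_rpow_of_nonneg (norm_nonneg _) hp0.le]
  have hw : (1 - (1 - h) ^ 2) ^ (p - 2 + s) ≤ 2 ^ |p - 2 + s| * h ^ (p - 2 + s) :=
    rpow_right_le_of_le_two_mul h0 (by nlinarith) (by nlinarith)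
  rw [gradDensity, mul_comm, ENNReal.ofReal_mul (Real.rpow_nonneg (by nlinarith) _)]
  refine (mul_le_mul' (ENNReal.ofReal_le_ofReal hw) hpow).trans (le_of_eq ?_)
  rw [← mul_assoc, ← mul_assoc, ← ENNReal.ofReal_mul (by positivity),
    ← ENNReal.ofReal_mul (by positivity)]
  congr 2
  have e : h ^ (p - 2 + s) = h ^ (s - 1) * h ^ (p - 1) := by
    rw [← Real.rpow_add h0]; congr 1; ring
  rw [Real.div_rpow (by positivity) h0.le, e]
  field_simp

/-- Integrating the kernel over the radius produces the kernel of the seminorm. -/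
lemma lintegral_rpow_mul_invSqDist_le (hs0 : 0 < s) (hs : s < 2) {ξ η : Circle} (hne : ξ ≠ η) :
    ∫⁻ h in Set.Ioo (0 : ℝ) 1, ENNReal.ofReal (h ^ (s - 1)) * invSqDist ((1 - h : ℝ) * ξ) η ≤
      ENNReal.ofReal ((1 / s + 1 / (2 - s)) * 2 ^ (2 - s) * ‖(ξ : ℂ) - η‖ ^ (s - 2)) := by
  -- up to depth `t` the distance to `η` is at least `t`, beyond it the depth itself is a bound
  set t := ‖(ξ : ℂ) - η‖ / 2 with ht
  have hd : 0 < ‖(ξ : ℂ) - η‖ := norm_pos_iff.2 (sub_ne_zero.2 fun h => hne (Subtype.ext h))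
  have ht0 : 0 < t := by positivity
  have hdist : ∀ h ∈ Set.Ioo (0:ℝ) 1, h ≤ ‖(η : ℂ) - (1 - h : ℝ) * ξ‖ ∧
      t ≤ ‖(η : ℂ) - (1 - h : ℝ) * ξ‖ := by
    rintro h ⟨h0, h1⟩
    have e1 : h ≤ ‖(η : ℂ) - (1 - h : ℝ) * ξ‖ := by
      have := norm_sub_norm_le (η : ℂ) ((1 - h : ℝ) * ξ)
      rw [norm_mul, Circle.norm_coe, Circle.norm_coe, mul_one, Complex.norm_real,
        Real.norm_eq_abs, abs_of_nonneg (by linarith : (0:ℝ) ≤ 1 - h)] at this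
      linarith
    refine ⟨e1, ?_⟩
    have e2 : ‖(ξ : ℂ) - η‖ ≤ ‖(η : ℂ) - (1 - h : ℝ) * ξ‖ + h := by
      calc ‖(ξ : ℂ) - η‖ = ‖((η : ℂ) - (1 - h : ℝ) * ξ) - ((h : ℝ) : ℂ) * ξ‖ := by
            rw [norm_sub_rev]; congr 1; push_cast; ring
        _ ≤ _ := by
            refine (norm_sub_le _ _).trans ?_
            rw [norm_mul, Circle.norm_coe, mul_one, Complex.norm_real, Real.norm_eq_abs,
              abs_of_pos h0]
    rw [ht]; linarith
  have hA : ∫⁻ h in Set.Ioo (0 : ℝ) 1 ∩ Set.Ioo 0 t,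
      ENNReal.ofReal (h ^ (s - 1)) * invSqDist ((1 - h : ℝ) * ξ) η ≤
      ENNReal.ofReal (t ^ s / s * (1 / t ^ 2)) := by
    calc _ ≤ ∫⁻ h in Set.Ioo (0 : ℝ) 1 ∩ Set.Ioo 0 t,
          ENNReal.ofReal (h ^ (s - 1)) * ENNReal.ofReal (1 / t ^ 2) := by
          refine setLIntegral_mono' (measurableSet_Ioo.inter measurableSet_Ioo) fun h hh => ?_
          refine mul_le_mul_right (ENNReal.ofReal_le_ofReal ?_) _
          gcongr
          exact (hdist h hh.1).2
      _ ≤ ∫⁻ h in Set.Ioo 0 t, ENNReal.ofReal (h ^ (s - 1)) * ENNReal.ofReal (1 / t ^ 2) :=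
          lintegral_mono_set Set.inter_subset_right
      _ = _ := by
          rw [lintegral_mul_const' _ _ ENNReal.ofReal_ne_top,
            lintegral_Ioo_rpow (by linarith) ht0.le, ← ENNReal.ofReal_mul (by
              rw [sub_add_cancel]; positivity), sub_add_cancel]
  have hB : ∫⁻ h in Set.Ioo (0 : ℝ) 1 \ Set.Ioo 0 t,
      ENNReal.ofReal (h ^ (s - 1)) * invSqDist ((1 - h : ℝ) * ξ) η ≤
      ENNReal.ofReal (t ^ (s - 2) / (2 - s)) := by
    calc _ ≤ ∫⁻ h in Set.Ioo (0 : ℝ) 1 \ Set.Ioo 0 t, ENNReal.ofReal (h ^ (s - 3)) := by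
          refine setLIntegral_mono' (measurableSet_Ioo.diff measurableSet_Ioo) fun h hh => ?_
          have h0 : 0 < h := hh.1.1
          rw [invSqDist, ← ENNReal.ofReal_mul (by positivity)]
          apply ENNReal.ofReal_le_ofReal
          have e : h ^ (s - 3) = h ^ (s - 1) * (1 / h ^ 2) := by
            rw [show s - 3 = (s - 1) - (2 : ℕ) by push_cast; ring, Real.rpow_sub_natCast h0.ne']
            ring
          rw [e]
          gcongr
          exact (hdist h hh.1).1
      _ ≤ ∫⁻ h in Set.Ici t, ENNReal.ofReal (h ^ (s - 3)) := by
          refine lintegral_mono_set fun h hh => ?_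
          by_contra hlt
          exact hh.2 ⟨hh.1.1, not_le.1 hlt⟩
      _ = _ := by
          rw [setLIntegral_congr Ioi_ae_eq_Ici.symm, lintegral_Ioi_rpow (by linarith) ht0,
            show s - 3 + 1 = -(2 - s) by ring, neg_div_neg_eq, neg_sub]
  rw [← lintegral_inter_add_sdiff _ (Set.Ioo (0:ℝ) 1) (measurableSet_Ioo (a := 0) (b := t))]
  refine (add_le_add hA hB).trans ?_
  have h2s : 0 < 2 - s := by linarith
  rw [← ENNReal.ofReal_add (by positivity) (by positivity)]
  apply ENNReal.ofReal_le_ofReal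
  have e1 : t ^ s / s * (1 / t ^ 2) = 1 / s * t ^ (s - 2) := by
    rw [show s - 2 = s - (2 : ℕ) by push_cast; ring, Real.rpow_sub_natCast ht0.ne']
    ring
  have e2 : t ^ (s - 2) = 2 ^ (2 - s) * ‖(ξ : ℂ) - η‖ ^ (s - 2) := by
    rw [ht, Real.div_rpow hd.le (by norm_num), show 2 - s = -(s - 2) by ring,
      Real.rpow_neg (by norm_num)]
    ring
  rw [e1, e2]
  apply le_of_eq
  ring

lemma measurable_gradDensity (F : ℂ → ℂ) :
    Measurable fun q : ℝ × ℝ => gradDensity p s F q.1 q.2 := by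
  have h1 : Measurable fun q : ℝ × ℝ => (((1 - q.1 : ℝ) : ℂ) * Circle.exp q.2) :=
    (Complex.measurable_ofReal.comp (measurable_fst.const_sub 1)).mul
      (measurable_circle_coe.comp (measurable_circleExp.comp measurable_snd))
  have h2 : Measurable fun q : ℝ × ℝ => (1 - (1 - q.1) ^ 2) ^ (p - 2 + s) :=
    (((measurable_fst.const_sub 1).pow_const 2).const_sub 1).pow_const _
  exact ((((measurable_gradNorm F).comp h1).pow_const p).mul h2).ennreal_ofReal

/-- The radial square-function type integral of the gradient is dominated by the circular
integral of the increments from the same boundary point. -/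
lemma exists_lintegral_gradDensity_le (hp : 1 < p) (hs0 : 0 < s) (hs : s < 1) :
    ∃ C : ℝ, 0 ≤ C ∧ ∀ f : Circle → ℂ, Measurable f → Integrable f arcLength → ∀ x : ℝ,
      ∫⁻ h in Set.Ioo (0 : ℝ) 1, gradDensity p s (poissonExt f) h x ≤
        ENNReal.ofReal C * ∫⁻ η, diffKernel p s f (Circle.exp x) η ∂arcLength := by
  have hpi := Real.pi_pos
  set C₁ := (2:ℝ) ^ |p - 2 + s| * (2 * Real.pi) ^ (p - 1) with hC₁
  set C₂ := (1 / s + 1 / (2 - s)) * 2 ^ (2 - s) with hC₂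
  have h2s : 0 < 2 - s := by linarith
  have hC₁0 : 0 ≤ C₁ := by positivity
  have hC₂0 : 0 ≤ C₂ := by positivity
  refine ⟨C₁ * C₂, by positivity, fun f hf hfi x => ?_⟩
  have hdp : Measurable fun η => diffPow p f (Circle.exp x) η :=
    measurable_diffPow_comp hf measurable_const measurable_id
  have hinv : Measurable fun q : ℝ × Circle =>
      invSqDist ((1 - q.1 : ℝ) * Circle.exp x) q.2 := by
    have h1 : Measurable fun q : ℝ × Circle => (((1 - q.1 : ℝ) : ℂ) * Circle.exp x) :=
      (Complex.measurable_ofReal.comp (measurable_fst.const_sub 1)).mul measurable_const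
    have h2 : Measurable fun q : ℝ × Circle => (q.2 : ℂ) :=
      measurable_circle_coe.comp measurable_snd
    exact (((h2.sub h1).norm.pow_const 2).const_div 1).ennreal_ofReal
  have hm : Measurable fun q : ℝ × Circle => ENNReal.ofReal (q.1 ^ (s - 1)) *
      (invSqDist ((1 - q.1 : ℝ) * Circle.exp x) q.2 * diffPow p f (Circle.exp x) q.2) :=
    ((measurable_fst.pow_const (s - 1)).ennreal_ofReal).mul (hinv.mul (hdp.comp measurable_snd))
  calc _ ≤ ∫⁻ h in Set.Ioo (0 : ℝ) 1, ENNReal.ofReal C₁ * ∫⁻ η, ENNReal.ofReal (h ^ (s - 1)) *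
        (invSqDist ((1 - h : ℝ) * Circle.exp x) η * diffPow p f (Circle.exp x) η) ∂arcLength := by
        refine setLIntegral_mono' measurableSet_Ioo fun h hh => ?_
        rw [lintegral_const_mul' _ _ ENNReal.ofReal_ne_top]
        exact gradDensity_poissonExt_le hp hf hfi hh.1 hh.2 x
    _ = ENNReal.ofReal C₁ * ∫⁻ η, (∫⁻ h in Set.Ioo (0 : ℝ) 1, ENNReal.ofReal (h ^ (s - 1)) *
        (invSqDist ((1 - h : ℝ) * Circle.exp x) η * diffPow p f (Circle.exp x) η)) ∂arcLength := by
        rw [lintegral_const_mul' _ _ ENNReal.ofReal_ne_top]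
        congr 1
        exact lintegral_lintegral_swap hm.aemeasurable
    _ ≤ ENNReal.ofReal C₁ * ∫⁻ η, ENNReal.ofReal C₂ * diffKernel p s f (Circle.exp x) η
          ∂arcLength := by
        gcongr with η
        simp_rw [← mul_assoc]
        rw [lintegral_mul_const' (diffPow p f (Circle.exp x) η) _
          (by rw [diffPow]; exact ENNReal.ofReal_ne_top)]
        by_cases hne : Circle.exp x = η
        · have : diffPow p f (Circle.exp x) η = 0 := by
            rw [diffPow, hne, sub_self, norm_zero, Real.zero_rpow (by linarith),
              ENNReal.ofReal_zero]
          rw [this, mul_zero]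
          exact zero_le
        · refine (mul_le_mul_left (lintegral_rpow_mul_invSqDist_le hs0 (by linarith) hne) _).trans
            (le_of_eq ?_)
          have hd : 0 < ‖(Circle.exp x : ℂ) - η‖ :=
            norm_pos_iff.2 (sub_ne_zero.2 fun h => hne (Subtype.ext h))
          rw [diffPow, diffKernel, ← ENNReal.ofReal_mul (by positivity),
            ← ENNReal.ofReal_mul (by positivity), show s - 2 = -(2 - s) by ring,
            Real.rpow_neg hd.le]
          congr 1
          rw [hC₂]
          ring
    _ = _ := by
        rw [lintegral_const_mul' _ _ ENNReal.ofReal_ne_top, ← mul_assoc,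
          ← ENNReal.ofReal_mul hC₁0]

/-- The factor `1 - h` of the area element is dropped, and the radial integral is extended from the
sector to the whole radius. -/
theorem ArcBound.isCarlesonMeasure (hp : 1 < p) (hs0 : 0 < s) (hs : s < 1)
    (hM0 : 0 ≤ M) (hM : ArcBound p s M f) (hf : Measurable f) (hfi : Integrable f arcLength) :
    IsCarlesonMeasure s (gradMeasure p s (poissonExt f)) := by
  obtain ⟨C, hC0, hC⟩ := hM.exists_lintegral_diffKernel_le (by linarith) hs0 hs hM0 hf
  obtain ⟨B, hB0, hB⟩ := exists_lintegral_gradDensity_le hp hs0 hs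
  unfold IsCarlesonMeasure
  rw [iSup_div_rpow_lt_top_iff]
  refine ⟨B * C, by positivity, fun θ ℓ h0 h1 => ?_⟩
  have hpi := Real.pi_pos
  have hL : ℓ / (2 * Real.pi) ≤ 1 := (div_le_one (by positivity)).2 h1
  rw [gradMeasure_carlesonSector _ h1]
  calc _ ≤ ∫⁻ h in Set.Ioo (0 : ℝ) 1, ∫⁻ x in Set.Icc (θ - ℓ / 2) (θ + ℓ / 2),
        gradDensity p s (poissonExt f) h x := by
        refine (lintegral_mono_set (Set.Ioo_subset_Ioo_right hL)).trans ?_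
        refine setLIntegral_mono' measurableSet_Ioo fun h hh => ?_
        refine mul_le_of_le_one_left (zero_le) ?_
        rw [ENNReal.ofReal_le_one]
        linarith [hh.1]
    _ = ∫⁻ x in Set.Icc (θ - ℓ / 2) (θ + ℓ / 2), ∫⁻ h in Set.Ioo (0 : ℝ) 1,
        gradDensity p s (poissonExt f) h x :=
        lintegral_lintegral_swap (measurable_gradDensity _).aemeasurable
    _ ≤ ∫⁻ x in Set.Icc (θ - ℓ / 2) (θ + ℓ / 2),
        ENNReal.ofReal B * ∫⁻ η, diffKernel p s f (Circle.exp x) η ∂arcLength :=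
        lintegral_mono fun x => hB f hf hfi x
    _ ≤ ENNReal.ofReal B * ENNReal.ofReal (C * ℓ ^ s) := by
        rw [lintegral_const_mul' _ _ ENNReal.ofReal_ne_top]
        gcongr
        exact hC θ ℓ h0 h1
    _ = _ := by rw [← ENNReal.ofReal_mul hB0, mul_assoc]

end CarlesonOfArcBound

/-! ### Boundary values of the Poisson extension -/

section BoundaryValues

variable {f : Circle → ℂ}

lemma poissonKernel_symm (r : ℝ) (ζ η : Circle) :
    poissonKernel 0 (r * ζ) η = poissonKernel 0 (r * η) ζ := by
  have key : ‖(η : ℂ) - r * ζ‖ = ‖(ζ : ℂ) - r * η‖ := by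
    have h1 : Complex.normSq ((η : ℂ) - r * ζ) = Complex.normSq ((ζ : ℂ) - r * η) := by
      have hz := Circle.normSq_coe ζ
      have he := Circle.normSq_coe η
      simp only [Complex.normSq_apply, Complex.sub_re, Complex.sub_im, Complex.mul_re,
        Complex.mul_im, Complex.ofReal_re, Complex.ofReal_im] at hz he ⊢
      linear_combination (r ^ 2 - 1) * hz + (1 - r ^ 2) * he
    rw [Complex.normSq_eq_norm_sq, Complex.normSq_eq_norm_sq] at h1
    exact (sq_eq_sq₀ (norm_nonneg _) (norm_nonneg _)).1 h1
  simp only [poissonKernel_def, sub_zero, norm_mul, Circle.norm_coe, key]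

lemma norm_mul_circle {r : ℝ} (hr0 : 0 ≤ r) (ζ : Circle) : ‖(r * ζ : ℂ)‖ = r := by
  rw [norm_mul, Circle.norm_coe, mul_one, Complex.norm_real, Real.norm_of_nonneg hr0]

lemma lintegral_poissonKernel {z : ℂ} (hz : ‖z‖ < 1) :
    ∫⁻ ζ : Circle, ENNReal.ofReal (poissonKernel 0 z ζ) ∂arcLength =
      ENNReal.ofReal (2 * Real.pi) := by
  have hint : Integrable (fun ζ : Circle => poissonKernel 0 z ζ) arcLength := by
    have := integrable_poissonKernel_smul (integrable_const (1 : ℂ)) hz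
    simpa using this.re
  rw [← ofReal_integral_eq_lintegral_ofReal hint
    (Filter.Eventually.of_forall (poissonKernel_nonneg hz)), integral_poissonKernel hz]

lemma measurable_poissonKernel_mul (r : ℝ) :
    Measurable fun q : Circle × Circle => poissonKernel 0 (r * q.1) q.2 := by
  have h1 : Measurable fun q : Circle × Circle => (r * q.1 : ℂ) :=
    (measurable_circle_coe.comp measurable_fst).const_mul _
  have h2 : Measurable fun q : Circle × Circle => (q.2 : ℂ) :=
    measurable_circle_coe.comp measurable_snd
  simp only [poissonKernel_def, sub_zero]
  exact ((h2.norm.pow_const 2).sub (h1.norm.pow_const 2)).div ((h2.sub h1).norm.pow_const 2)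

lemma enorm_poissonExt_le {z : ℂ} (hz : ‖z‖ < 1) (f : Circle → ℂ) :
    ‖poissonExt f z‖ₑ ≤ ENNReal.ofReal (2 * Real.pi)⁻¹ *
      ∫⁻ η : Circle, ENNReal.ofReal (poissonKernel 0 z η) * ‖f η‖ₑ ∂arcLength := by
  have hpi := Real.pi_pos
  rw [poissonExt, enorm_smul, Real.enorm_eq_ofReal (by positivity)]
  gcongr
  refine (enorm_integral_le_lintegral_enorm _).trans (le_of_eq ?_)
  congr 1 with η
  rw [enorm_smul, Real.enorm_eq_ofReal (poissonKernel_nonneg hz η)]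

/-- The Poisson extension is an `L¹` contraction on every circle. -/
lemma lintegral_enorm_poissonExt_le (hf : Measurable f) {r : ℝ} (hr0 : 0 ≤ r) (hr1 : r < 1) :
    ∫⁻ ζ : Circle, ‖poissonExt f (r * ζ)‖ₑ ∂arcLength ≤ ∫⁻ η, ‖f η‖ₑ ∂arcLength := by
  have hpi := Real.pi_pos
  have hlt : ∀ ζ : Circle, ‖(r * ζ : ℂ)‖ < 1 := fun ζ => by rwa [norm_mul_circle hr0]
  have hm := (measurable_poissonKernel_mul r).ennreal_ofReal.mul (hf.enorm.comp measurable_snd)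
  calc _ ≤ ∫⁻ ζ : Circle, ENNReal.ofReal (2 * Real.pi)⁻¹ *
        ∫⁻ η : Circle, ENNReal.ofReal (poissonKernel 0 (r * ζ) η) * ‖f η‖ₑ ∂arcLength
          ∂arcLength := lintegral_mono fun ζ => enorm_poissonExt_le (hlt ζ) f
    _ = ENNReal.ofReal (2 * Real.pi)⁻¹ * ∫⁻ η : Circle, ∫⁻ ζ : Circle,
        ENNReal.ofReal (poissonKernel 0 (r * ζ) η) * ‖f η‖ₑ ∂arcLength ∂arcLength := by
        rw [lintegral_const_mul' _ _ ENNReal.ofReal_ne_top]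
        congr 1
        exact lintegral_lintegral_swap
          (f := fun ζ η : Circle => ENNReal.ofReal (poissonKernel 0 (r * ζ) η) * ‖f η‖ₑ)
          hm.aemeasurable
    _ = ENNReal.ofReal (2 * Real.pi)⁻¹ * ∫⁻ η : Circle,
        ENNReal.ofReal (2 * Real.pi) * ‖f η‖ₑ ∂arcLength := by
        congr 1
        congr 1 with η
        simp_rw [poissonKernel_symm r _ η]
        rw [lintegral_mul_const _ (measurable_poissonKernel _).ennreal_ofReal,
          lintegral_poissonKernel (hlt η)]
    _ = _ := by
        rw [lintegral_const_mul' _ _ ENNReal.ofReal_ne_top, ← mul_assoc,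
          ← ENNReal.ofReal_mul (by positivity), inv_mul_cancel₀ (by positivity),
          ENNReal.ofReal_one, one_mul]

/-- Convergence at the boundary for continuous data, uniformly in the boundary point. -/
lemma exists_norm_poissonExt_sub_le {φ : Circle → ℂ} (hφ : Continuous φ) {ε : ℝ} (hε : 0 < ε) :
    ∃ C : ℝ, 0 ≤ C ∧ ∀ r : ℝ, 0 ≤ r → r < 1 → ∀ ζ : Circle,
      ‖poissonExt φ (r * ζ) - φ ζ‖ ≤ ε + C * (1 - r) := by
  have hpi := Real.pi_pos
  have huc := CompactSpace.uniformContinuous_of_continuous hφ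
  obtain ⟨δ, hδ, hδφ⟩ := Metric.uniformContinuous_iff.1 huc ε hε
  obtain ⟨S, hS⟩ := (isCompact_range hφ).isBounded.exists_norm_le
  have hS' : ∀ ζ, ‖φ ζ‖ ≤ S := fun ζ => hS _ ⟨ζ, rfl⟩
  have hS0 : 0 ≤ S := (norm_nonneg _).trans (hS' 1)
  -- a modulus of continuity that is quadratic up to `ε`, as the Poisson kernel likes it
  have hmod : ∀ ζ η : Circle, ‖φ η - φ ζ‖ ≤ ε + 2 * S / δ ^ 2 * ‖(η : ℂ) - ζ‖ ^ 2 := by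
    intro ζ η
    rcases lt_or_ge (dist η ζ) δ with h | h
    · have := hδφ h
      rw [dist_eq_norm] at this
      have h2 : 0 ≤ 2 * S / δ ^ 2 * ‖(η : ℂ) - ζ‖ ^ 2 := by positivity
      linarith
    · have hd : δ ≤ ‖(η : ℂ) - ζ‖ := by
        rw [← dist_eq_norm]
        exact h
      have h1 : ‖φ η - φ ζ‖ ≤ 2 * S := by
        refine (norm_sub_le _ _).trans ?_
        linarith [hS' η, hS' ζ]
      have h2 : 2 * S ≤ 2 * S / δ ^ 2 * ‖(η : ℂ) - ζ‖ ^ 2 := by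
        rw [div_mul_eq_mul_div, le_div_iff₀ (by positivity)]
        gcongr
      linarith
  refine ⟨2 * S / δ ^ 2 * 8, by positivity, fun r hr0 hr1 ζ => ?_⟩
  have hz : ‖(r * ζ : ℂ)‖ < 1 := by rwa [norm_mul_circle hr0]
  have hφi : Integrable φ arcLength :=
    Integrable.of_bound hφ.measurable.aestronglyMeasurable S (Filter.Eventually.of_forall hS')
  rw [← poissonExt_const (φ ζ) hz, ← poissonExt_sub hφi (integrable_const _) hz]
  have hk : ∀ η : Circle, ‖poissonKernel 0 (r * ζ) η • (φ η - φ ζ)‖ ≤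
      poissonKernel 0 (r * ζ) η * ε + 2 * S / δ ^ 2 * (8 * (1 - r)) := by
    intro η
    have hP := poissonKernel_nonneg hz η
    rw [norm_smul, Real.norm_of_nonneg hP]
    refine (mul_le_mul_of_nonneg_left (hmod ζ η) hP).trans ?_
    rw [mul_add]
    refine add_le_add le_rfl ?_
    rw [mul_left_comm]
    refine mul_le_mul_of_nonneg_left ?_ (by positivity)
    rw [poissonKernel_def, sub_zero, sub_zero, norm_mul_circle hr0, Circle.norm_coe]
    have h1 : 1 - r ≤ ‖(η : ℂ) - r * ζ‖ := by
      have := one_sub_norm_le (r * ζ) η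
      rwa [norm_mul_circle hr0] at this
    have h2 : ‖(η : ℂ) - ζ‖ ≤ 2 * ‖(η : ℂ) - r * ζ‖ := by
      calc ‖(η : ℂ) - ζ‖ = ‖((η : ℂ) - r * ζ) - ((1 - r : ℝ) : ℂ) * ζ‖ := by
            congr 1; push_cast; ring
        _ ≤ ‖(η : ℂ) - r * ζ‖ + (1 - r) := by
            refine (norm_sub_le _ _).trans ?_
            rw [norm_mul_circle (by linarith)]
        _ ≤ _ := by linarith
    have h3 : 0 < ‖(η : ℂ) - r * ζ‖ := by linarith
    rw [div_mul_eq_mul_div, div_le_iff₀ (by positivity)]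
    calc (1 ^ 2 - r ^ 2) * ‖(η : ℂ) - ζ‖ ^ 2
        ≤ (2 * (1 - r)) * (2 * ‖(η : ℂ) - r * ζ‖) ^ 2 := by
          gcongr
          nlinarith
      _ = _ := by ring
  have hint : Integrable (fun η : Circle => poissonKernel 0 (r * ζ) η) arcLength := by
    have := integrable_poissonKernel_smul (integrable_const (1 : ℂ)) hz
    simpa using this.re
  have hmass : arcLength.real Set.univ = 2 * Real.pi := by
    have h := lintegral_arcLength (F := fun _ => 1) measurable_const 0
    simp only [lintegral_const, one_mul, Measure.restrict_apply_univ, Real.volume_Ioc] at h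
    rw [measureReal_def, h, ENNReal.toReal_ofReal (by linarith)]
    ring
  rw [poissonExt, norm_smul, Real.norm_of_nonneg (by positivity)]
  calc _ ≤ (2 * Real.pi)⁻¹ * ∫ η : Circle, (poissonKernel 0 (r * ζ) η * ε +
        2 * S / δ ^ 2 * (8 * (1 - r))) ∂arcLength := by
        gcongr
        refine norm_integral_le_of_norm_le ?_ (Filter.Eventually.of_forall hk)
        exact (hint.mul_const ε).add (integrable_const _)
    _ = (2 * Real.pi)⁻¹ * (2 * Real.pi * ε + 2 * Real.pi * (2 * S / δ ^ 2 * (8 * (1 - r)))) := by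
        rw [integral_add (hint.mul_const ε) (integrable_const _), integral_mul_const,
          integral_poissonKernel hz, integral_const, hmass, smul_eq_mul]
    _ = _ := by field_simp

lemma measurable_poissonExt_mul (hf : Measurable f) (r : ℝ) :
    Measurable fun ζ : Circle => poissonExt f (r * ζ) := by
  have h : StronglyMeasurable fun q : Circle × Circle => poissonKernel 0 (r * q.1) q.2 • f q.2 :=
    ((measurable_poissonKernel_mul r).smul (hf.comp measurable_snd)).stronglyMeasurable
  exact (h.integral_prod_right'.const_smul (2 * Real.pi)⁻¹).measurable

open Filter Topology in
lemma tendsto_lintegral_enorm_poissonExt_sub (hf : Measurable f) (hfi : Integrable f arcLength) :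
    Tendsto (fun h : ℝ => ∫⁻ ζ : Circle, ‖poissonExt f ((1 - h : ℝ) * ζ) - f ζ‖ₑ ∂arcLength)
      (𝓝[>] 0) (𝓝 0) := by
  rw [ENNReal.tendsto_nhds_zero]
  intro ε hε
  rcases eq_or_ne ε ∞ with rfl | hεt
  · exact Eventually.of_forall fun _ => le_top
  have hε4 : ε / 4 ≠ 0 := by simpa using hε.ne'
  obtain ⟨φ, hφ, hφi⟩ := hfi.exists_boundedContinuous_lintegral_sub_le hε4
  set m := arcLength Set.univ with hm
  have hmt : m ≠ ∞ := measure_ne_top _ _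
  -- the uniform error `δ` is spread over the circle, whose mass is `m`
  obtain ⟨δ, hδ0, hδ⟩ : ∃ δ : ℝ, 0 < δ ∧ ENNReal.ofReal (2 * δ) * m ≤ ε / 4 := by
    refine ⟨(ε / 4).toReal / (m.toReal + 1) / 2, ?_, ?_⟩
    · have : 0 < (ε / 4).toReal := ENNReal.toReal_pos hε4 (ENNReal.div_ne_top hεt (by simp))
      positivity
    · have h4 : ε / 4 ≠ ∞ := ENNReal.div_ne_top hεt (by simp)
      rw [← ENNReal.ofReal_toReal hmt, ← ENNReal.ofReal_mul (by positivity),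
        ← ENNReal.ofReal_toReal h4]
      apply ENNReal.ofReal_le_ofReal
      rw [ENNReal.toReal_ofReal ENNReal.toReal_nonneg, ENNReal.toReal_ofReal ENNReal.toReal_nonneg,
        mul_div_cancel₀ _ (two_ne_zero), div_mul_eq_mul_div, div_le_iff₀ (by positivity)]
      have : 0 ≤ (ε / 4).toReal := ENNReal.toReal_nonneg
      nlinarith
  obtain ⟨C, hC0, hC⟩ := exists_norm_poissonExt_sub_le φ.continuous hδ0
  have hsmall : ∀ᶠ h : ℝ in 𝓝[>] 0, h < 1 ∧ C * h < δ := by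
    have h1 : ∀ᶠ h : ℝ in 𝓝 0, h < 1 := eventually_lt_nhds one_pos
    have h2 : ∀ᶠ h : ℝ in 𝓝 0, C * h < δ := by
      have : Tendsto (fun h : ℝ => C * h) (𝓝 0) (𝓝 (C * 0)) := tendsto_id.const_mul C
      rw [mul_zero] at this
      exact this.eventually_lt_const hδ0
    exact (h1.and h2).filter_mono nhdsWithin_le_nhds
  filter_upwards [hsmall, self_mem_nhdsWithin] with h hh h0
  have h0' : 0 < h := h0
  have hr0 : 0 ≤ 1 - h := by linarith [hh.1]
  have hr1 : 1 - h < 1 := by linarith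
  have hφm : Measurable φ := φ.continuous.measurable
  -- approximation by the continuous function `φ`; the outer errors are small in `L¹`
  have hsub : ∀ ζ : Circle, poissonExt f ((1 - h : ℝ) * ζ) - f ζ =
      poissonExt (fun η => f η - φ η) ((1 - h : ℝ) * ζ) +
        (poissonExt φ ((1 - h : ℝ) * ζ) - φ ζ) - (f ζ - φ ζ) := fun ζ => by
    rw [poissonExt_sub hfi hφi (by rwa [norm_mul_circle hr0])]
    ring
  have hA := (lintegral_enorm_poissonExt_le (hf.sub hφm) hr0 hr1).trans hφ
  have hB : ∫⁻ ζ : Circle, ‖poissonExt φ ((1 - h : ℝ) * ζ) - φ ζ‖ₑ ∂arcLength ≤ ε / 4 := by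
    calc _ ≤ ∫⁻ ζ : Circle, ENNReal.ofReal (2 * δ) ∂arcLength := by
          refine lintegral_mono fun ζ => ?_
          rw [← ofReal_norm]
          apply ENNReal.ofReal_le_ofReal
          have := hC (1 - h) hr0 hr1 ζ
          have h2 := hh.2
          rw [sub_sub_cancel] at this
          linarith
      _ ≤ ε / 4 := by rw [lintegral_const]; exact hδ
  have m1 : Measurable fun ζ : Circle => ‖poissonExt (fun η => f η - φ η) ((1 - h : ℝ) * ζ)‖ₑ :=
    (measurable_poissonExt_mul (hf.sub hφm) (1 - h)).enorm
  have m2 : Measurable fun ζ : Circle => ‖poissonExt φ ((1 - h : ℝ) * ζ) - φ ζ‖ₑ :=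
    ((measurable_poissonExt_mul hφm (1 - h)).sub hφm).enorm
  have m3 : Measurable fun ζ : Circle => ‖f ζ - φ ζ‖ₑ := (hf.sub hφm).enorm
  calc _ ≤ ∫⁻ ζ : Circle, (‖poissonExt (fun η => f η - φ η) ((1 - h : ℝ) * ζ)‖ₑ +
        ‖poissonExt φ ((1 - h : ℝ) * ζ) - φ ζ‖ₑ + ‖f ζ - φ ζ‖ₑ) ∂arcLength := by
        refine lintegral_mono fun ζ => ?_
        rw [hsub]
        exact (enorm_sub_le).trans (add_le_add_left (enorm_add_le _ _) _)
    _ = (∫⁻ ζ : Circle, ‖poissonExt (fun η => f η - φ η) ((1 - h : ℝ) * ζ)‖ₑ ∂arcLength) +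
        (∫⁻ ζ : Circle, ‖poissonExt φ ((1 - h : ℝ) * ζ) - φ ζ‖ₑ ∂arcLength) +
        ∫⁻ ζ : Circle, ‖f ζ - φ ζ‖ₑ ∂arcLength := by
        rw [lintegral_add_right _ m3, lintegral_add_right _ m2]
    _ ≤ ε / 4 + ε / 4 + ε / 4 := add_le_add (add_le_add hA hB) hφ
    _ ≤ ε / 4 + ε / 4 + (ε / 4 + ε / 4) := by gcongr; exact le_self_add
    _ = ε := by
        have : ε / 4 + ε / 4 = ε / 2 := by
          rw [← two_mul, show (4 : ℝ≥0∞) = 2 * 2 by norm_num, div_eq_mul_inv,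
            ENNReal.mul_inv (by simp) (by simp), mul_left_comm, ← mul_assoc 2,
            ENNReal.mul_inv_cancel (by simp) (by simp), one_mul, div_eq_mul_inv]
        rw [this, ENNReal.add_halves]

lemma ae_exp_of_ae_arcLength {P : Circle → Prop} (h : ∀ᵐ ζ ∂arcLength, P ζ) :
    ∀ᵐ x : ℝ, P (Circle.exp x) := by
  obtain ⟨N, hN, hNm, hN0⟩ := exists_measurable_superset_of_null h
  have hpiece : ∀ a : ℝ, volume (Circle.exp ⁻¹' N ∩ Set.Ioc a (a + 2 * Real.pi)) = 0 := fun a => by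
    have e := lintegral_arcLength (F := N.indicator 1) (measurable_one.indicator hNm) a
    rw [lintegral_indicator_one hNm, hN0] at e
    have e2 : (fun x : ℝ => N.indicator (1 : Circle → ℝ≥0∞) (Circle.exp x)) =
        (Circle.exp ⁻¹' N).indicator 1 := by
      ext x
      simp only [Set.indicator]
      rfl
    rw [e2, lintegral_indicator_one (measurable_circleExp hNm),
      Measure.restrict_apply (measurable_circleExp hNm)] at e
    exact e.symm
  have hnull : volume (Circle.exp ⁻¹' N) = 0 := by
    have hcov : Circle.exp ⁻¹' N ⊆ ⋃ n : ℤ, Circle.exp ⁻¹' N ∩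
        Set.Ioc (0 + n • (2 * Real.pi)) (0 + n • (2 * Real.pi) + 2 * Real.pi) := by
      rw [← Set.inter_iUnion]
      intro x hx
      refine ⟨hx, ?_⟩
      have := iUnion_Ioc_add_zsmul Real.two_pi_pos 0
      simp only [add_smul, one_smul, ← add_assoc] at this
      rw [this]
      trivial
    exact measure_mono_null hcov (measure_iUnion_null fun n => hpiece _)
  refine measure_mono_null (fun x hx => ?_) hnull
  exact hN hx

open Filter Topology in
/-- Along some sequence of radii the Poisson extension converges to its boundary values almost
everywhere. -/
lemma exists_seq_tendsto_poissonExt (hf : Measurable f) (hfi : Integrable f arcLength) :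
    ∃ hn : ℕ → ℝ, Tendsto hn atTop (𝓝[>] 0) ∧ ∀ᵐ x : ℝ,
      Tendsto (fun n => poissonExt f ((1 - hn n : ℝ) * Circle.exp x)) atTop
        (𝓝 (f (Circle.exp x))) := by
  have hmeas : TendstoInMeasure arcLength
      (fun (h : ℝ) (ζ : Circle) => poissonExt f ((1 - h : ℝ) * ζ)) (𝓝[>] 0) f := by
    refine tendstoInMeasure_of_tendsto_eLpNorm one_ne_zero
      (fun h => (measurable_poissonExt_mul hf (1 - h)).aestronglyMeasurable)
      hf.aestronglyMeasurable ?_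
    simp only [eLpNorm_one_eq_lintegral_enorm]
    exact tendsto_lintegral_enorm_poissonExt_sub hf hfi
  obtain ⟨hn, h1, h2⟩ := hmeas.exists_seq_tendsto_ae'
  exact ⟨hn, h1, ae_exp_of_ae_arcLength h2⟩

end BoundaryValues

/-! ### Increments along paths, and the Hardy inequality -/

section Paths

/-- The gradient of `F` at the point `(1 - h) e^{ix}`. -/
noncomputable def gradAt (F : ℂ → ℂ) (h x : ℝ) : ℝ≥0∞ :=
  ENNReal.ofReal (gradNorm F ((1 - h : ℝ) * Circle.exp x))

lemma measurable_gradAt (F : ℂ → ℂ) : Measurable fun q : ℝ × ℝ => gradAt F q.1 q.2 := by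
  have h1 : Measurable fun q : ℝ × ℝ => (((1 - q.1 : ℝ) : ℂ) * Circle.exp q.2) :=
    (Complex.measurable_ofReal.comp (measurable_fst.const_sub 1)).mul
      (measurable_circle_coe.comp (measurable_circleExp.comp measurable_snd))
  exact ((measurable_gradNorm F).comp h1).ennreal_ofReal

lemma norm_fderiv_apply_le (F : ℂ → ℂ) (z v : ℂ) :
    ‖fderiv ℝ F z v‖ ≤ gradNorm F z * ‖v‖ := by
  set D := fderiv ℝ F z with hD
  have hv : D v = v.re • D 1 + v.im • D Complex.I := by
    rw [← map_smul, ← map_smul, ← map_add]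
    congr 1
    simp only [Complex.real_smul, mul_one]
    exact (Complex.re_add_im v).symm
  have h1 : ‖D v‖ ≤ |v.re| * ‖D 1‖ + |v.im| * ‖D Complex.I‖ := by
    rw [hv]
    refine (norm_add_le _ _).trans (le_of_eq ?_)
    rw [norm_smul, norm_smul, Real.norm_eq_abs, Real.norm_eq_abs]
  refine h1.trans (abs_le_of_sq_le_sq' ?_ (mul_nonneg (gradNorm_nonneg _ _) (norm_nonneg _))).2
  rw [mul_pow, gradNorm, Real.sq_sqrt (by positivity), ← Complex.normSq_eq_norm_sq v,
    Complex.normSq_apply v, ← hD]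
  have e1 := sq_abs v.re
  have e2 := sq_abs v.im
  nlinarith [sq_nonneg (|v.re| * ‖D Complex.I‖ - |v.im| * ‖D 1‖)]

/-- The increment of `F` along a curve of speed at most one. -/
lemma enorm_sub_le_lintegral_gradNorm {F : ℂ → ℂ} (hF : ContDiffOn ℝ 1 F (Metric.ball 0 1))
    {γ : ℝ → ℂ} (hγ : ContDiff ℝ 1 γ) (hγ1 : ∀ t, ‖deriv γ t‖ ≤ 1) {a b : ℝ} (hab : a ≤ b)
    (hmaps : ∀ t ∈ Set.Icc a b, γ t ∈ Metric.ball (0 : ℂ) 1) :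
    ‖F (γ b) - F (γ a)‖ₑ ≤ ∫⁻ t in Set.Icc a b, ENNReal.ofReal (gradNorm F (γ t)) := by
  refine (enorm_sub_le_lintegral_deriv_of_contDiffOn_Icc (f := F ∘ γ)
    (hF.comp hγ.contDiffOn hmaps) hab).trans ?_
  refine setLIntegral_mono' measurableSet_Icc fun t ht => ?_
  have hd : DifferentiableAt ℝ F (γ t) :=
    (hF.contDiffAt (Metric.isOpen_ball.mem_nhds (hmaps t ht))).differentiableAt one_ne_zero
  rw [fderiv_comp_deriv t hd (hγ.differentiable one_ne_zero).differentiableAt, ← ofReal_norm]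
  apply ENNReal.ofReal_le_ofReal
  refine (norm_fderiv_apply_le F (γ t) _).trans ?_
  exact mul_le_of_le_one_right (gradNorm_nonneg _ _) (hγ1 t)

lemma enorm_sub_le_radial {F : ℂ → ℂ} (hF : ContDiffOn ℝ 1 F (Metric.ball 0 1)) {a b : ℝ}
    (ha : 0 < a) (hab : a ≤ b) (hb : b ≤ 1) (x : ℝ) :
    ‖F ((1 - a : ℝ) * Circle.exp x) - F ((1 - b : ℝ) * Circle.exp x)‖ₑ ≤
      ∫⁻ h in Set.Ioc 0 b, gradAt F h x := by
  have hd : ∀ t, HasDerivAt (fun t : ℝ => ((1 - t : ℝ) : ℂ) * (Circle.exp x : ℂ))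
      (-(Circle.exp x : ℂ)) t := fun t => by
    have h1 : HasDerivAt (fun t : ℝ => ((1 - t : ℝ) : ℂ)) (-1) t := by
      have := ((hasDerivAt_id t).const_sub 1).ofReal_comp
      simpa using this
    simpa using h1.mul_const (Circle.exp x : ℂ)
  have hγ : ContDiff ℝ 1 fun t : ℝ => ((1 - t : ℝ) : ℂ) * (Circle.exp x : ℂ) :=
    (Complex.ofRealCLM.contDiff.comp (contDiff_const.sub contDiff_id)).mul contDiff_const
  have h := enorm_sub_le_lintegral_gradNorm hF hγ
    (fun t => by rw [(hd t).deriv, norm_neg, Circle.norm_coe]) hab (fun t ht => by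
      rw [mem_ball_zero_iff, norm_one_sub_mul_exp (by linarith [ht.2])]
      linarith [ht.1])
  rw [enorm_sub_rev]
  refine h.trans (lintegral_mono_set fun t ht => ⟨by linarith [ht.1], ht.2⟩)

lemma enorm_sub_le_angular {F : ℂ → ℂ} (hF : ContDiffOn ℝ 1 F (Metric.ball 0 1)) {h : ℝ}
    (h0 : 0 < h) (h1 : h ≤ 1) (x t : ℝ) :
    ‖F ((1 - h : ℝ) * Circle.exp x) - F ((1 - h : ℝ) * Circle.exp (x + t))‖ₑ ≤
      ∫⁻ v in Set.Icc (-|t|) |t|, gradAt F h (x + v) := by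
  have hd : ∀ v, HasDerivAt (fun v : ℝ => ((1 - h : ℝ) : ℂ) * (Circle.exp (x + v) : ℂ))
      (((1 - h : ℝ) : ℂ) * ((Circle.exp (x + v) : ℂ) * Complex.I)) v := fun v => by
    refine HasDerivAt.const_mul _ ?_
    simp only [Circle.coe_exp]
    have e1 : HasDerivAt (fun v : ℝ => ((x + v : ℝ) : ℂ) * Complex.I) Complex.I v := by
      have := (((hasDerivAt_id v).const_add x).ofReal_comp).mul_const Complex.I
      simpa using this
    exact e1.cexp
  have hγ : ContDiff ℝ 1 fun v : ℝ => ((1 - h : ℝ) : ℂ) * (Circle.exp (x + v) : ℂ) := by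
    simp only [Circle.coe_exp]
    refine contDiff_const.mul (ContDiff.cexp ?_)
    exact (Complex.ofRealCLM.contDiff.comp (contDiff_const.add contDiff_id)).mul contDiff_const
  have hle : ∀ v, ‖deriv (fun v : ℝ => ((1 - h : ℝ) : ℂ) * (Circle.exp (x + v) : ℂ)) v‖ ≤ 1 := by
    intro v
    rw [(hd v).deriv, norm_mul, norm_mul, Circle.norm_coe, Complex.norm_I, Complex.norm_real,
      Real.norm_of_nonneg (by linarith)]
    linarith
  have hmaps : ∀ v, ((1 - h : ℝ) : ℂ) * (Circle.exp (x + v) : ℂ) ∈ Metric.ball (0 : ℂ) 1 := by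
    intro v
    rw [mem_ball_zero_iff, norm_one_sub_mul_exp h1]
    linarith
  rcases le_total 0 t with ht | ht
  · have := enorm_sub_le_lintegral_gradNorm hF hγ hle ht fun v _ => hmaps v
    rw [add_zero] at this
    rw [enorm_sub_rev]
    refine this.trans (lintegral_mono_set ?_)
    rw [abs_of_nonneg ht]
    exact Set.Icc_subset_Icc_left (by linarith)
  · have := enorm_sub_le_lintegral_gradNorm hF hγ hle ht fun v _ => hmaps v
    rw [add_zero] at this
    refine this.trans (lintegral_mono_set ?_)
    rw [abs_of_nonpos ht, neg_neg]
    exact Set.Icc_subset_Icc_right (by linarith)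

end Paths

section OneDimensional

/-- Hardy's inequality with power weights: the weight exponent `s - 2 < -1` makes averages from
the origin controllable by the function itself. -/
lemma exists_hardy {p s : ℝ} (hp : 1 < p) (hs : s < 1) :
    ∃ C : ℝ, 0 ≤ C ∧ ∀ (U : ℝ → ℝ≥0∞), Measurable U → ∀ L : ℝ,
      ∫⁻ h in Set.Ioo 0 L, ENNReal.ofReal (h ^ (s - 2)) * (∫⁻ r in Set.Ioc 0 h, U r) ^ p ≤
        ENNReal.ofReal C * ∫⁻ r in Set.Ioo 0 L, ENNReal.ofReal (r ^ (p - 2 + s)) * U r ^ p := by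
  have hp1 : 0 < p - 1 := by linarith
  -- Hölder is applied with the weight `r ^ (e - 1)`, `e` small enough for the outer integral
  set e := min (1 / 2) ((1 - s) / (2 * (p - 1))) with he
  have h1s : 0 < 1 - s := by linarith
  have he0 : 0 < e := by rw [he]; positivity
  have hes : e * (p - 1) < 1 - s := by
    have h2 : e ≤ (1 - s) / (2 * (p - 1)) := min_le_right _ _
    rw [le_div_iff₀ (by positivity)] at h2
    nlinarith
  set a := s - 2 + e * (p - 1) with ha
  have ha1 : a < -1 := by linarith
  set C₁ := (1 / e) ^ (p - 1) with hC₁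
  set C₂ := 1 / (-(a + 1)) with hC₂
  have hC₂0 : 0 < C₂ := one_div_pos.2 (by linarith)
  have hC₁0 : 0 ≤ C₁ := by positivity
  refine ⟨C₁ * C₂, by positivity, fun U hU L => ?_⟩
  set V : ℝ → ℝ≥0∞ := fun r => ENNReal.ofReal (r ^ ((1 - e) * (p - 1))) * U r ^ p with hV
  have hVm : Measurable V :=
    (measurable_id.pow_const ((1 - e) * (p - 1))).ennreal_ofReal.mul (hU.pow_const p)
  have hstep : ∀ h ∈ Set.Ioo 0 L, ENNReal.ofReal (h ^ (s - 2)) * (∫⁻ r in Set.Ioc 0 h, U r) ^ p ≤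
      ENNReal.ofReal C₁ * (ENNReal.ofReal (h ^ a) * ∫⁻ r in Set.Ioo 0 h, V r) := by
    rintro h ⟨h0, -⟩
    have hH := lintegral_mul_rpow_le (μ := volume.restrict (Set.Ioo 0 h)) hp
      (G := fun r => ENNReal.ofReal (r ^ (1 - e)) * U r)
      (K := fun r => ENNReal.ofReal (r ^ (e - 1)))
      ((measurable_id.pow_const (1 - e)).ennreal_ofReal.mul hU)
      (measurable_id.pow_const (e - 1)).ennreal_ofReal
    have e1 : ∫⁻ r in Set.Ioo 0 h, ENNReal.ofReal (r ^ (e - 1)) *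
        (ENNReal.ofReal (r ^ (1 - e)) * U r) = ∫⁻ r in Set.Ioo 0 h, U r := by
      refine setLIntegral_congr_fun measurableSet_Ioo fun r hr => ?_
      have hr0 : 0 < r := hr.1
      rw [← mul_assoc, ← ENNReal.ofReal_mul (by positivity), ← Real.rpow_add hr0]
      simp
    have e2 : ∫⁻ r in Set.Ioo 0 h, ENNReal.ofReal (r ^ (e - 1)) *
        (ENNReal.ofReal (r ^ (1 - e)) * U r) ^ p = ∫⁻ r in Set.Ioo 0 h, V r := by
      refine setLIntegral_congr_fun measurableSet_Ioo fun r hr => ?_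
      have hr0 : 0 < r := hr.1
      simp only [hV]
      rw [ENNReal.mul_rpow_of_nonneg _ _ (by linarith), ← mul_assoc,
        ENNReal.ofReal_rpow_of_nonneg (by positivity) (by linarith),
        ← ENNReal.ofReal_mul (by positivity), ← Real.rpow_mul hr0.le, ← Real.rpow_add hr0]
      congr 3
      ring
    have e3 : (∫⁻ r in Set.Ioo 0 h, ENNReal.ofReal (r ^ (e - 1))) ^ (p - 1) =
        ENNReal.ofReal (C₁ * h ^ (e * (p - 1))) := by
      rw [lintegral_Ioo_rpow (by linarith) h0.le, sub_add_cancel,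
        ENNReal.ofReal_rpow_of_nonneg (by positivity) hp1.le, Real.div_rpow (by positivity) he0.le,
        ← Real.rpow_mul h0.le, hC₁, Real.div_rpow (by norm_num) he0.le, Real.one_rpow]
      congr 1
      ring
    rw [e1, e2, e3] at hH
    rw [← restrict_Ioo_eq_restrict_Ioc]
    refine (mul_le_mul_right hH _).trans (le_of_eq ?_)
    rw [← mul_assoc, ← mul_assoc, ← ENNReal.ofReal_mul (by positivity),
      ← ENNReal.ofReal_mul hC₁0, mul_left_comm, ← Real.rpow_add h0]
  have hm : Measurable fun q : ℝ × ℝ => ENNReal.ofReal (q.1 ^ a) *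
      (Set.Ioo 0 q.1).indicator V q.2 := by
    refine ((measurable_fst.pow_const a).ennreal_ofReal).mul ?_
    have hS : MeasurableSet {q : ℝ × ℝ | 0 < q.2 ∧ q.2 < q.1} :=
      (measurableSet_lt measurable_const measurable_snd).inter
        (measurableSet_lt measurable_snd measurable_fst)
    exact (hVm.comp measurable_snd).indicator hS
  have hra : Measurable fun h : ℝ => ENNReal.ofReal (h ^ a) :=
    (measurable_id.pow_const a).ennreal_ofReal
  calc _ ≤ ∫⁻ h in Set.Ioo 0 L, ENNReal.ofReal C₁ * (ENNReal.ofReal (h ^ a) *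
        ∫⁻ r in Set.Ioo 0 h, V r) := setLIntegral_mono' measurableSet_Ioo hstep
    _ = ENNReal.ofReal C₁ * ∫⁻ h in Set.Ioo 0 L, ∫⁻ r in Set.Ioo 0 L, ENNReal.ofReal (h ^ a) *
        (Set.Ioo 0 h).indicator V r := by
        rw [lintegral_const_mul' _ _ ENNReal.ofReal_ne_top]
        congr 1
        refine setLIntegral_congr_fun measurableSet_Ioo fun h hh => ?_
        rw [lintegral_const_mul' _ _ ENNReal.ofReal_ne_top,
          setLIntegral_indicator measurableSet_Ioo]
        congr 3
        exact (Set.inter_eq_left.2 (Set.Ioo_subset_Ioo_right hh.2.le)).symm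
    _ = ENNReal.ofReal C₁ * ∫⁻ r in Set.Ioo 0 L, ∫⁻ h in Set.Ioo 0 L, ENNReal.ofReal (h ^ a) *
        (Set.Ioo 0 h).indicator V r := by
        congr 1
        exact lintegral_lintegral_swap
          (f := fun h r => ENNReal.ofReal (h ^ a) * (Set.Ioo 0 h).indicator V r) hm.aemeasurable
    _ ≤ ENNReal.ofReal C₁ * ∫⁻ r in Set.Ioo 0 L, ENNReal.ofReal C₂ *
        (ENNReal.ofReal (r ^ (p - 2 + s)) * U r ^ p) := by
        gcongr ENNReal.ofReal C₁ * ?_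
        refine setLIntegral_mono' measurableSet_Ioo fun r hr => ?_
        have hr0 : 0 < r := hr.1
        calc _ ≤ ∫⁻ h in Set.Ioo 0 L, (Set.Ioi r).indicator
              (fun h => ENNReal.ofReal (h ^ a) * V r) h := by
              refine lintegral_mono fun h => ?_
              by_cases hrh : r < h
              · rw [Set.indicator_of_mem (show r ∈ Set.Ioo 0 h from ⟨hr0, hrh⟩),
                  Set.indicator_of_mem (show h ∈ Set.Ioi r from hrh)]
              · rw [Set.indicator_of_notMem (fun hh => hrh hh.2), mul_zero]
                exact zero_le
          _ ≤ ∫⁻ h, (Set.Ioi r).indicator (fun h => ENNReal.ofReal (h ^ a) * V r) h :=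
              setLIntegral_le_lintegral _ _
          _ = ENNReal.ofReal (-r ^ (a + 1) / (a + 1)) * V r := by
              rw [lintegral_indicator measurableSet_Ioi,
                lintegral_mul_const _ hra,
                lintegral_Ioi_rpow ha1 hr0]
          _ = _ := by
              have hneg : 0 < -(a + 1) := by linarith
              have e4 : -r ^ (a + 1) / (a + 1) = C₂ * r ^ (a + 1) := by
                rw [hC₂, one_div_mul_eq_div, div_neg, neg_div]
              simp only [hV]
              rw [e4, ← mul_assoc, ← mul_assoc, ← ENNReal.ofReal_mul (by positivity),
                ← ENNReal.ofReal_mul (by positivity), mul_assoc C₂, ← Real.rpow_add hr0]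
              congr 4
              rw [ha]; ring
    _ = _ := by
        rw [lintegral_const_mul' _ _ ENNReal.ofReal_ne_top, ← mul_assoc, ← ENNReal.ofReal_mul hC₁0]

lemma setLIntegral_Ioo_comp_mul {H : ℝ → ℝ≥0∞} (hH : Measurable H) {c : ℝ} (hc : 0 < c) (τ : ℝ) :
    ∫⁻ t in Set.Ioo 0 τ, H (c * t) = ENNReal.ofReal c⁻¹ * ∫⁻ h in Set.Ioo 0 (c * τ), H h := by
  have h := Real.map_volume_mul_left hc.ne'
  have e : ∫⁻ t, (Set.Ioo 0 (c * τ)).indicator H (c * t) =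
      ∫⁻ h, (Set.Ioo 0 (c * τ)).indicator H h ∂(Measure.map (c * ·) volume) :=
    (lintegral_map (hH.indicator measurableSet_Ioo) (measurable_const_mul c)).symm
  rw [h, lintegral_smul_measure, abs_of_pos (inv_pos.2 hc), lintegral_indicator measurableSet_Ioo,
    smul_eq_mul] at e
  rw [← e, ← lintegral_indicator measurableSet_Ioo]
  congr 1 with t
  have hmem : c * t ∈ Set.Ioo 0 (c * τ) ↔ t ∈ Set.Ioo 0 τ := by
    simp only [Set.mem_Ioo, mul_pos_iff_of_pos_left hc, mul_lt_mul_iff_right₀ hc]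
  by_cases ht : t ∈ Set.Ioo 0 τ
  · rw [Set.indicator_of_mem ht, Set.indicator_of_mem (hmem.2 ht)]
  · rw [Set.indicator_of_notMem ht, Set.indicator_of_notMem (fun h => ht (hmem.1 h))]

lemma setLIntegral_Icc_comp_abs_le (H : ℝ → ℝ≥0∞) (τ : ℝ) :
    ∫⁻ t in Set.Icc (-τ) τ, H |t| ≤ 2 * ∫⁻ t in Set.Ioo 0 τ, H t := by
  have hsub : Set.Icc (-τ) τ ⊆ Set.Icc 0 τ ∪ Set.Icc (-τ) 0 := by
    rintro t ⟨h1, h2⟩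
    rcases le_total 0 t with h | h
    · exact Or.inl ⟨h, h2⟩
    · exact Or.inr ⟨h1, h⟩
  have hneg : ∫⁻ t in Set.Icc (-τ) 0, H |t| = ∫⁻ t in Set.Icc 0 τ, H |t| := by
    have := (Measure.measurePreserving_neg (volume : Measure ℝ)).setLIntegral_comp_preimage_emb
      (MeasurableEquiv.neg ℝ).measurableEmbedding (fun t => H |t|) (Set.Icc (-τ) 0)
    rw [← this]
    simp
  refine (lintegral_mono_set hsub).trans ((lintegral_union_le _ _ _).trans ?_)
  rw [hneg, ← two_mul, ← restrict_Ioo_eq_restrict_Icc]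
  gcongr 2 * ?_
  refine setLIntegral_mono' measurableSet_Ioo fun t ht => ?_
  rw [abs_of_pos ht.1]

end OneDimensional

/-! ### Recovering the seminorm from the gradient measure -/

section ArcBoundOfSectorBound

variable {p s M : ℝ} {f : Circle → ℂ}

/-- The integral of the gradient along the radius from the point `(1 - h) e^{ix}` to the
boundary. -/
noncomputable def radialIntegral (F : ℂ → ℂ) (h x : ℝ) : ℝ≥0∞ := ∫⁻ r in Set.Ioc 0 h, gradAt F r x

lemma measurable_radialIntegral (F : ℂ → ℂ) :
    Measurable fun q : ℝ × ℝ => radialIntegral F q.1 q.2 := by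
  have hS : MeasurableSet {w : (ℝ × ℝ) × ℝ | 0 < w.2 ∧ w.2 ≤ w.1.1} :=
    (measurableSet_lt measurable_const measurable_snd).inter
      (measurableSet_le measurable_snd (measurable_fst.comp measurable_fst))
  have hm : Measurable fun w : (ℝ × ℝ) × ℝ =>
      Set.indicator {w : (ℝ × ℝ) × ℝ | 0 < w.2 ∧ w.2 ≤ w.1.1} (fun w => gradAt F w.2 w.1.2) w :=
    ((measurable_gradAt F).comp
      (measurable_snd.prodMk (measurable_snd.comp measurable_fst))).indicator hS
  have e : (fun q : ℝ × ℝ => radialIntegral F q.1 q.2) = fun q => ∫⁻ r,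
      Set.indicator {w : (ℝ × ℝ) × ℝ | 0 < w.2 ∧ w.2 ≤ w.1.1} (fun w => gradAt F w.2 w.1.2)
        (q, r) := by
    ext q
    rw [radialIntegral, ← lintegral_indicator measurableSet_Ioc]
    rfl
  rw [e]
  exact hm.lintegral_prod_right'

lemma measurable_gradAt_angle (F : ℂ → ℂ) (h : ℝ) : Measurable fun x => gradAt F h x :=
  (measurable_gradAt F).of_uncurry_left

lemma measurable_gradAt_depth (F : ℂ → ℂ) (x : ℝ) : Measurable fun h => gradAt F h x :=
  (measurable_gradAt F).of_uncurry_right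

lemma measurable_radialIntegral_angle (F : ℂ → ℂ) (h : ℝ) :
    Measurable fun x => radialIntegral F h x :=
  (measurable_radialIntegral F).of_uncurry_left

open Filter Topology in
lemma enorm_boundary_sub_le {F : ℂ → ℂ} (hF : ContDiffOn ℝ 1 F (Metric.ball 0 1)) {hn : ℕ → ℝ}
    (hhn : Tendsto hn atTop (𝓝[>] 0)) {x : ℝ} {w : ℂ}
    (hx : Tendsto (fun n => F ((1 - hn n : ℝ) * Circle.exp x)) atTop (𝓝 w)) {h : ℝ} (h0 : 0 < h)
    (h1 : h ≤ 1) :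
    ‖w - F ((1 - h : ℝ) * Circle.exp x)‖ₑ ≤ radialIntegral F h x := by
  have ht := (continuous_enorm.tendsto _).comp (hx.sub_const (F ((1 - h : ℝ) * Circle.exp x)))
  refine le_of_tendsto ht ?_
  filter_upwards [hhn (Ioc_mem_nhdsGT h0)] with n hn'
  exact enorm_sub_le_radial hF hn'.1 hn'.2 h1 x

lemma add_add_rpow_le (hp : 1 < p) (a b c : ℝ≥0∞) :
    (a + b + c) ^ p ≤ 2 ^ (p - 1) * 2 ^ (p - 1) * (a ^ p + b ^ p + c ^ p) := by
  have h1 := ENNReal.rpow_add_le_mul_rpow_add_rpow (a + b) c hp.le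
  have h2 := ENNReal.rpow_add_le_mul_rpow_add_rpow a b hp.le
  have h3 : (1 : ℝ≥0∞) ≤ 2 ^ (p - 1) := ENNReal.one_le_rpow (by norm_num) (by linarith)
  calc _ ≤ 2 ^ (p - 1) * (2 ^ (p - 1) * (a ^ p + b ^ p) + 2 ^ (p - 1) * c ^ p) := by
        refine h1.trans ?_
        gcongr
        exact le_mul_of_one_le_left zero_le h3
    _ = _ := by rw [← mul_add, mul_assoc]

lemma diffPow_eq_enorm_rpow (hp : 0 ≤ p) (ζ η : Circle) : diffPow p f ζ η = ‖f ζ - f η‖ₑ ^ p := by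
  rw [diffPow, ← ENNReal.ofReal_rpow_of_nonneg (norm_nonneg _) hp, ofReal_norm]

lemma setLIntegral_Icc_comp_add (H : ℝ → ℝ≥0∞) (a b w : ℝ) :
    ∫⁻ x in Set.Icc a b, H (w + x) = ∫⁻ y in Set.Icc (w + a) (w + b), H y := by
  have := (measurePreserving_add_left (volume : Measure ℝ) w).setLIntegral_comp_preimage_emb
    (measurableEmbedding_addLeft w) H (Set.Icc (w + a) (w + b))
  rw [← this]
  congr 2
  simp

lemma setLIntegral_comp_add_le (H : ℝ → ℝ≥0∞) {θ ℓ w : ℝ} (hw : |w| ≤ ℓ) :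
    ∫⁻ x in Set.Icc (θ - ℓ / 2) (θ + ℓ / 2), H (x + w) ≤
      ∫⁻ x in Set.Icc (θ - 3 * ℓ / 2) (θ + 3 * ℓ / 2), H x := by
  simp_rw [add_comm _ w]
  rw [setLIntegral_Icc_comp_add]
  rw [abs_le] at hw
  exact lintegral_mono_set (Set.Icc_subset_Icc (by linarith) (by linarith))

lemma lintegral_lintegral_rpow_le (hp : 1 < p) {g : ℝ → ℝ≥0∞} (hgm : Measurable g) {θ ℓ t : ℝ}
    (ht : |t| ≤ ℓ) :
    ∫⁻ x in Set.Icc (θ - ℓ / 2) (θ + ℓ / 2), (∫⁻ v in Set.Icc (-|t|) |t|, g (x + v)) ^ p ≤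
      ENNReal.ofReal ((2 * |t|) ^ p) *
        ∫⁻ x in Set.Icc (θ - 3 * ℓ / 2) (θ + 3 * ℓ / 2), g x ^ p := by
  have hAm : Measurable fun q : ℝ × ℝ => g (q.1 + q.2) :=
    hgm.comp (measurable_fst.add measurable_snd)
  have hvol : volume (Set.Icc (-|t|) |t|) = ENNReal.ofReal (2 * |t|) := by
    rw [Real.volume_Icc]; congr 1; ring
  calc _ ≤ ∫⁻ x in Set.Icc (θ - ℓ / 2) (θ + ℓ / 2), ENNReal.ofReal (2 * |t|) ^ (p - 1) *
        ∫⁻ v in Set.Icc (-|t|) |t|, g (x + v) ^ p := by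
        refine lintegral_mono fun x => ?_
        have := lintegral_rpow_le (volume.restrict (Set.Icc (-|t|) |t|)) hp
          (G := fun v => g (x + v)) (hgm.comp (measurable_const_add x)).aemeasurable
        rwa [Measure.restrict_apply_univ, hvol] at this
    _ = ENNReal.ofReal (2 * |t|) ^ (p - 1) * ∫⁻ v in Set.Icc (-|t|) |t|,
        ∫⁻ x in Set.Icc (θ - ℓ / 2) (θ + ℓ / 2), g (x + v) ^ p := by
        rw [lintegral_const_mul' _ _ (ENNReal.rpow_ne_top_of_nonneg (by linarith)
          ENNReal.ofReal_ne_top)]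
        congr 1
        exact lintegral_lintegral_swap (f := fun x v => g (x + v) ^ p)
          (hAm.pow_const p).aemeasurable
    _ ≤ ENNReal.ofReal (2 * |t|) ^ (p - 1) * ∫⁻ v in Set.Icc (-|t|) |t|,
        ∫⁻ x in Set.Icc (θ - 3 * ℓ / 2) (θ + 3 * ℓ / 2), g x ^ p := by
        gcongr ENNReal.ofReal (2 * |t|) ^ (p - 1) * ?_
        refine setLIntegral_mono' measurableSet_Icc fun v hv => ?_
        exact setLIntegral_comp_add_le (fun x => g x ^ p) ((abs_le.2 hv).trans ht)
    _ = _ := by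
        rw [lintegral_const, Measure.restrict_apply_univ, hvol, mul_comm _ (ENNReal.ofReal _),
          ← mul_assoc]
        congr 1
        have hp' : 0 ≤ 2 * |t| := by positivity
        rw [ENNReal.ofReal_rpow_of_nonneg hp' (by linarith), ← ENNReal.ofReal_mul (by positivity)]
        congr 1
        rcases hp'.eq_or_lt with h' | h'
        · rw [← h', mul_zero, Real.zero_rpow (by linarith)]
        · nth_rewrite 2 [← Real.rpow_one (2 * |t|)]
          rw [← Real.rpow_add h']
          congr 1
          ring

open Filter Topology in
/-- The oscillation of the boundary values at distance `t` is controlled by the gradient above the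
enlarged interval, through a path that runs down a radius to depth `h`, along a circle and up
another radius. -/
lemma lintegral_diffPow_add_le (hp : 1 < p) {F : ℂ → ℂ} (hF : ContDiffOn ℝ 1 F (Metric.ball 0 1))
    {hn : ℕ → ℝ} (hhn : Tendsto hn atTop (𝓝[>] 0))
    (hlim : ∀ᵐ x : ℝ, Tendsto (fun n => F ((1 - hn n : ℝ) * Circle.exp x)) atTop
      (𝓝 (f (Circle.exp x)))) {θ ℓ t h : ℝ} (ht : |t| ≤ ℓ) (h0 : 0 < h) (h1 : h ≤ 1) :
    ∫⁻ x in Set.Icc (θ - ℓ / 2) (θ + ℓ / 2), diffPow p f (Circle.exp x) (Circle.exp (x + t)) ≤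
      2 ^ (p - 1) * 2 ^ (p - 1) *
        (2 * (∫⁻ x in Set.Icc (θ - 3 * ℓ / 2) (θ + 3 * ℓ / 2), radialIntegral F h x ^ p) +
          ENNReal.ofReal ((2 * |t|) ^ p) *
            ∫⁻ x in Set.Icc (θ - 3 * ℓ / 2) (θ + 3 * ℓ / 2), gradAt F h x ^ p) := by
  have hp0 : 0 < p := by linarith
  set I := Set.Icc (θ - ℓ / 2) (θ + ℓ / 2) with hI
  have hRm : Measurable fun x => radialIntegral F h x ^ p :=
    (measurable_radialIntegral_angle F h).pow_const p
  have hgm : Measurable fun x => gradAt F h x := measurable_gradAt_angle F h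
  have hshift : ∀ᵐ x : ℝ, Tendsto (fun n => F ((1 - hn n : ℝ) * Circle.exp (x + t))) atTop
      (𝓝 (f (Circle.exp (x + t)))) :=
    (measurePreserving_add_right (volume : Measure ℝ) t).quasiMeasurePreserving.ae hlim
  have hpt : ∀ᵐ x : ℝ, diffPow p f (Circle.exp x) (Circle.exp (x + t)) ≤
      2 ^ (p - 1) * 2 ^ (p - 1) * (radialIntegral F h x ^ p + radialIntegral F h (x + t) ^ p +
        (∫⁻ v in Set.Icc (-|t|) |t|, gradAt F h (x + v)) ^ p) := by
    filter_upwards [hlim, hshift] with x hx hxt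
    rw [diffPow_eq_enorm_rpow hp0.le]
    refine le_trans (ENNReal.rpow_le_rpow ?_ hp0.le) (add_add_rpow_le hp _ _ _)
    have e1 := enorm_boundary_sub_le hF hhn hx h0 h1
    have e2 := enorm_boundary_sub_le hF hhn hxt h0 h1
    have e3 := enorm_sub_le_angular hF h0 h1 x t
    have e4 : f (Circle.exp x) - f (Circle.exp (x + t)) =
        ((f (Circle.exp x) - F ((1 - h : ℝ) * Circle.exp x)) -
        (f (Circle.exp (x + t)) - F ((1 - h : ℝ) * Circle.exp (x + t)))) +
        (F ((1 - h : ℝ) * Circle.exp x) - F ((1 - h : ℝ) * Circle.exp (x + t))) := by ring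
    rw [e4]
    refine (enorm_add_le _ _).trans (add_le_add (enorm_sub_le.trans (add_le_add e1 e2)) e3)
  have hR1 : ∫⁻ x in I, radialIntegral F h x ^ p ≤
      ∫⁻ x in Set.Icc (θ - 3 * ℓ / 2) (θ + 3 * ℓ / 2), radialIntegral F h x ^ p := by
    have hℓ : 0 ≤ ℓ := (abs_nonneg t).trans ht
    exact lintegral_mono_set (Set.Icc_subset_Icc (by linarith) (by linarith))
  have hR2 : ∫⁻ x in I, radialIntegral F h (x + t) ^ p ≤
      ∫⁻ x in Set.Icc (θ - 3 * ℓ / 2) (θ + 3 * ℓ / 2), radialIntegral F h x ^ p :=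
    setLIntegral_comp_add_le (fun x => radialIntegral F h x ^ p) ht
  have hK : (2 : ℝ≥0∞) ^ (p - 1) * 2 ^ (p - 1) ≠ ∞ := by
    have : (2 : ℝ≥0∞) ^ (p - 1) ≠ ∞ := ENNReal.rpow_ne_top_of_nonneg (by linarith) (by simp)
    exact ENNReal.mul_ne_top this this
  have hRm' : Measurable fun x => radialIntegral F h (x + t) ^ p :=
    hRm.comp (measurable_add_const t)
  refine (lintegral_mono_ae (ae_restrict_of_ae hpt)).trans ?_
  rw [lintegral_const_mul' _ _ hK, lintegral_add_left (f := fun x => radialIntegral F h x ^ p +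
    radialIntegral F h (x + t) ^ p) (hRm.add hRm'), lintegral_add_left hRm, two_mul]
  exact mul_le_mul_right (add_le_add (add_le_add hR1 hR2) (lintegral_lintegral_rpow_le hp hgm ht)) _

/-- A Carleson condition in polar coordinates. -/
def SectorBound (p s M : ℝ) (F : ℂ → ℂ) : Prop :=
  ∀ θ ℓ : ℝ, 0 < ℓ → ℓ ≤ 2 * Real.pi →
    ∫⁻ h in Set.Ioo 0 (ℓ / (2 * Real.pi)), ENNReal.ofReal (1 - h) *
      ∫⁻ x in Set.Icc (θ - ℓ / 2) (θ + ℓ / 2), gradDensity p s F h x ≤ ENNReal.ofReal (M * ℓ ^ s)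

lemma isCarlesonMeasure_gradMeasure_iff (F : ℂ → ℂ) :
    IsCarlesonMeasure s (gradMeasure p s F) ↔ ∃ M : ℝ, 0 ≤ M ∧ SectorBound p s M F := by
  unfold IsCarlesonMeasure
  rw [iSup_div_rpow_lt_top_iff]
  refine exists_congr fun M => and_congr_right fun _ => forall₂_congr fun θ ℓ =>
    forall₂_congr fun h0 h1 => ?_
  rw [gradMeasure_carlesonSector F h1]

lemma rpow_left_le_of_le_two_mul {h b e : ℝ} (h0 : 0 < h) (h1 : h ≤ b) (h2 : b ≤ 2 * h) :
    h ^ e ≤ 2 ^ |e| * b ^ e := by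
  have hb : 0 < b := h0.trans_le h1
  rcases le_total 0 e with he | he
  · calc h ^ e ≤ b ^ e := Real.rpow_le_rpow h0.le h1 he
      _ ≤ _ := le_mul_of_one_le_left (by positivity) (Real.one_le_rpow (by norm_num) (abs_nonneg e))
  · calc h ^ e = 2 ^ |e| * (2 * h) ^ e := by
          rw [abs_of_nonpos he, Real.mul_rpow (by norm_num) h0.le, ← mul_assoc,
            ← Real.rpow_add (by norm_num)]
          simp
      _ ≤ _ := by
          exact mul_le_mul_of_nonneg_left (Real.rpow_le_rpow_of_nonpos hb h2 he) (by positivity)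

/-- The weighted gradient integral over the lower half of the box above the threefold interval,
which is covered by three intervals of length `ℓ`. In the lower half `1 - h ≥ 1 / 2`, so the area
element may be dropped. -/
lemma SectorBound.lintegral_le {F : ℂ → ℂ} (hp : 0 < p) (hM : SectorBound p s M F) (θ : ℝ) {ℓ : ℝ}
    (h0 : 0 < ℓ) (h1 : ℓ ≤ 2 * Real.pi) :
    ∫⁻ h in Set.Ioo 0 (ℓ / (4 * Real.pi)), ENNReal.ofReal (h ^ (p - 2 + s)) *
      ∫⁻ x in Set.Icc (θ - 3 * ℓ / 2) (θ + 3 * ℓ / 2), gradAt F h x ^ p ≤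
      ENNReal.ofReal (2 * 2 ^ |p - 2 + s|) * (3 * ENNReal.ofReal (M * ℓ ^ s)) := by
  have hpi := Real.pi_pos
  have hL : ℓ / (4 * Real.pi) ≤ 1 / 2 := by rw [div_le_iff₀ (by positivity)]; linarith
  have hL2 : ℓ / (4 * Real.pi) ≤ ℓ / (2 * Real.pi) := by gcongr; linarith
  set A := ENNReal.ofReal (2 * 2 ^ |p - 2 + s|) with hA
  have hAt : A ≠ ∞ := ENNReal.ofReal_ne_top
  have hpt : ∀ h ∈ Set.Ioo 0 (ℓ / (4 * Real.pi)), ∀ x : ℝ,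
      ENNReal.ofReal (h ^ (p - 2 + s)) * gradAt F h x ^ p ≤
        A * (ENNReal.ofReal (1 - h) * gradDensity p s F h x) := by
    rintro h ⟨hh0, hh1⟩ x
    have hb : 0 ≤ 1 - (1 - h) ^ 2 := by nlinarith
    have hg := gradNorm_nonneg F ((1 - h : ℝ) * Circle.exp x)
    rw [gradAt, gradDensity, ENNReal.ofReal_rpow_of_nonneg hg hp.le,
      ← ENNReal.ofReal_mul (by positivity), hA, ← ENNReal.ofReal_mul (by linarith),
      ← ENNReal.ofReal_mul (by positivity)]
    apply ENNReal.ofReal_le_ofReal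
    have e1 := rpow_left_le_of_le_two_mul (e := p - 2 + s) hh0 (b := 1 - (1 - h) ^ 2)
      (by nlinarith) (by nlinarith)
    set G := gradNorm F ((1 - h : ℝ) * Circle.exp x) ^ p with hG
    have hG0 : 0 ≤ G := by positivity
    have e2 : 0 ≤ 2 ^ |p - 2 + s| * (1 - (1 - h) ^ 2) ^ (p - 2 + s) * G := by positivity
    calc h ^ (p - 2 + s) * G ≤ 2 ^ |p - 2 + s| * (1 - (1 - h) ^ 2) ^ (p - 2 + s) * G := by gcongr
      _ ≤ (2 * (1 - h)) * (2 ^ |p - 2 + s| * (1 - (1 - h) ^ 2) ^ (p - 2 + s) * G) :=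
          le_mul_of_one_le_left e2 (by linarith)
      _ = _ := by ring
  have hone : ∀ θ' : ℝ, ∫⁻ h in Set.Ioo 0 (ℓ / (4 * Real.pi)), ENNReal.ofReal (h ^ (p - 2 + s)) *
      ∫⁻ x in Set.Icc (θ' - ℓ / 2) (θ' + ℓ / 2), gradAt F h x ^ p ≤
      A * ENNReal.ofReal (M * ℓ ^ s) := by
    intro θ'
    calc _ ≤ ∫⁻ h in Set.Ioo 0 (ℓ / (4 * Real.pi)), A * (ENNReal.ofReal (1 - h) *
          ∫⁻ x in Set.Icc (θ' - ℓ / 2) (θ' + ℓ / 2), gradDensity p s F h x) := by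
          refine setLIntegral_mono' measurableSet_Ioo fun h hh => ?_
          rw [← lintegral_const_mul' _ _ ENNReal.ofReal_ne_top,
            ← lintegral_const_mul' _ _ ENNReal.ofReal_ne_top, ← lintegral_const_mul' _ _ hAt]
          exact lintegral_mono fun x => hpt h hh x
      _ ≤ _ := by
          rw [lintegral_const_mul' _ _ hAt]
          gcongr
          exact (lintegral_mono_set (Set.Ioo_subset_Ioo_right hL2)).trans (hM θ' ℓ h0 h1)
  have hcov : Set.Icc (θ - 3 * ℓ / 2) (θ + 3 * ℓ / 2) ⊆
      (Set.Icc (θ - ℓ - ℓ / 2) (θ - ℓ + ℓ / 2) ∪ Set.Icc (θ - ℓ / 2) (θ + ℓ / 2)) ∪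
        Set.Icc (θ + ℓ - ℓ / 2) (θ + ℓ + ℓ / 2) := by
    rintro x ⟨hx1, hx2⟩
    rcases le_total x (θ - ℓ / 2) with h | h
    · exact Or.inl (Or.inl ⟨by linarith, by linarith⟩)
    · rcases le_total x (θ + ℓ / 2) with h' | h'
      · exact Or.inl (Or.inr ⟨h, h'⟩)
      · exact Or.inr ⟨by linarith, by linarith⟩
  have hm : ∀ θ' : ℝ, Measurable fun h : ℝ => ENNReal.ofReal (h ^ (p - 2 + s)) *
      ∫⁻ x in Set.Icc (θ' - ℓ / 2) (θ' + ℓ / 2), gradAt F h x ^ p := fun θ' =>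
    (measurable_id.pow_const (p - 2 + s)).ennreal_ofReal.mul
      (Measurable.lintegral_prod_right' (f := fun q : ℝ × ℝ => gradAt F q.1 q.2 ^ p)
        ((measurable_gradAt F).pow_const p))
  calc _ ≤ ∫⁻ h in Set.Ioo 0 (ℓ / (4 * Real.pi)),
        (ENNReal.ofReal (h ^ (p - 2 + s)) *
          (∫⁻ x in Set.Icc (θ - ℓ - ℓ / 2) (θ - ℓ + ℓ / 2), gradAt F h x ^ p) +
        ENNReal.ofReal (h ^ (p - 2 + s)) *
          (∫⁻ x in Set.Icc (θ - ℓ / 2) (θ + ℓ / 2), gradAt F h x ^ p) +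
        ENNReal.ofReal (h ^ (p - 2 + s)) *
          (∫⁻ x in Set.Icc (θ + ℓ - ℓ / 2) (θ + ℓ + ℓ / 2), gradAt F h x ^ p)) := by
        refine lintegral_mono fun h => ?_
        simp only [← mul_add]
        gcongr
        refine (lintegral_mono_set hcov).trans ((lintegral_union_le _ _ _).trans ?_)
        gcongr
        exact lintegral_union_le _ _ _
    _ ≤ A * ENNReal.ofReal (M * ℓ ^ s) + A * ENNReal.ofReal (M * ℓ ^ s) +
        A * ENNReal.ofReal (M * ℓ ^ s) := by
        rw [lintegral_add_right _ (hm (θ + ℓ)), lintegral_add_right _ (hm θ)]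
        exact add_le_add (add_le_add (hone _) (hone _)) (hone _)
    _ = _ := by ring

/-- The double integral over an arc in terms of a base point and an increment. -/
lemma setLIntegral_diffKernel_le (hp : 0 < p) (hs : s < 2) {θ ℓ x : ℝ}
    (h1 : ℓ ≤ 2 * Real.pi) (hx : x ∈ Set.Icc (θ - ℓ / 2) (θ + ℓ / 2)) :
    ∫⁻ y in Set.Icc (θ - ℓ / 2) (θ + ℓ / 2), diffKernel p s f (Circle.exp x) (Circle.exp y) ≤
      ∫⁻ t in Set.Icc (-min ℓ Real.pi) (min ℓ Real.pi), ENNReal.ofReal ((|t| / 5) ^ (s - 2)) *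
        diffPow p f (Circle.exp x) (Circle.exp (x + t)) := by
  have hpi := Real.pi_pos
  set H : ℝ → ℝ≥0∞ := fun y => diffKernel p s f (Circle.exp x) (Circle.exp y) with hH
  have hper : Function.Periodic H (2 * Real.pi) := fun y => by
    simp only [hH, Circle.periodic_exp y]
  have hτ : ∫⁻ y in Set.Icc (θ - ℓ / 2) (θ + ℓ / 2), H y ≤
      ∫⁻ t in Set.Icc (-min ℓ Real.pi) (min ℓ Real.pi), H (x + t) := by
    rw [setLIntegral_Icc_comp_add]
    rcases le_total ℓ Real.pi with h | h
    · rw [min_eq_left h]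
      exact lintegral_mono_set (Set.Icc_subset_Icc (by linarith [hx.2]) (by linarith [hx.1]))
    · rw [min_eq_right h]
      calc _ ≤ ∫⁻ y in Set.Icc (θ - Real.pi) (θ - Real.pi + 2 * Real.pi), H y :=
            lintegral_mono_set (Set.Icc_subset_Icc (by linarith) (by linarith))
        _ = ∫⁻ y in Set.Ioc (x - Real.pi) (x - Real.pi + 2 * Real.pi), H y := by
            rw [← restrict_Ioc_eq_restrict_Icc, setLIntegral_Ioc_eq_of_periodic hper]
        _ ≤ _ := by
            refine lintegral_mono_set ?_
            intro y hy
            exact ⟨by linarith [hy.1], by linarith [hy.2]⟩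
  refine hτ.trans (setLIntegral_mono' measurableSet_Icc fun t ht => ?_)
  rcases eq_or_ne t 0 with rfl | hne
  · simp only [hH, add_zero, diffKernel, sub_self, norm_zero, Real.zero_rpow hp.ne', zero_div,
      ENNReal.ofReal_zero]
    exact zero_le
  · have ht' : |t| ≤ Real.pi := (abs_le.2 ht).trans (min_le_right _ _)
    refine diffKernel_le_diffPow hs (by positivity) ?_
    have e : |x - (x + t)| = |t| := by rw [sub_add_cancel_left, abs_neg]
    rw [← e]
    exact le_norm_exp_sub_exp (by rw [e]; linarith)

/-- The path between the points at `x` and `x + t` descends to depth `|t| / (4 * π)`, so that it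
stays in the lower half of the box. -/
theorem SectorBound.exists_arcBound (hp : 1 < p) (hs : s < 1)
    (hM : SectorBound p s M (poissonExt f)) (hf : Measurable f) (hfi : Integrable f arcLength) :
    ∃ M' : ℝ, 0 ≤ M' ∧ ArcBound p s M' f := by
  have hpi := Real.pi_pos
  have hp0 : 0 < p := by linarith
  obtain ⟨hn, hhn, hlim⟩ := exists_seq_tendsto_poissonExt hf hfi
  have hF := contDiffOn_poissonExt hfi
  set F := poissonExt f with hFdef
  obtain ⟨C, hC0, hC⟩ := exists_hardy hp hs
  set c := 1 / (4 * Real.pi) with hc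
  have hc0 : 0 < c := by positivity
  set K : ℝ≥0∞ := 2 ^ (p - 1) * 2 ^ (p - 1) with hK
  have hKt : K ≠ ∞ := by
    have : (2 : ℝ≥0∞) ^ (p - 1) ≠ ∞ := ENNReal.rpow_ne_top_of_nonneg (by linarith) (by simp)
    exact ENNReal.mul_ne_top this this
  set B : ℝ≥0∞ := 2 * ENNReal.ofReal C + ENNReal.ofReal ((2 / c) ^ p) with hB
  have hBt : B ≠ ∞ := by
    rw [hB]; finiteness
  set D : ℝ≥0∞ := K * (2 * (ENNReal.ofReal c⁻¹ * (ENNReal.ofReal ((5 * c) ^ (2 - s)) * (B *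
    (ENNReal.ofReal (2 * 2 ^ |p - 2 + s|) * (3 * ENNReal.ofReal M)))))) with hD
  have hDt : D ≠ ∞ := by
    rw [hD]; finiteness
  refine ⟨D.toReal, ENNReal.toReal_nonneg, fun θ ℓ h0 h1 => ?_⟩
  -- increments beyond half a turn are not needed
  set τ := min ℓ Real.pi with hτ
  have hτ0 : 0 < τ := lt_min h0 hpi
  have hτℓ : c * τ ≤ ℓ / (4 * Real.pi) := by
    rw [hc, one_div_mul_eq_div]
    gcongr
    exact min_le_left _ _
  set I := Set.Icc (θ - ℓ / 2) (θ + ℓ / 2) with hI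
  set I3 := Set.Icc (θ - 3 * ℓ / 2) (θ + 3 * ℓ / 2) with hI3
  have hRm2 : Measurable fun q : ℝ × ℝ => radialIntegral F q.1 q.2 ^ p :=
    (measurable_radialIntegral F).pow_const p
  have hgm2 : Measurable fun q : ℝ × ℝ => gradAt F q.1 q.2 ^ p := (measurable_gradAt F).pow_const p
  have hRm : Measurable fun h : ℝ => ∫⁻ x in I3, radialIntegral F h x ^ p :=
    hRm2.lintegral_prod_right'
  have hgm : Measurable fun h : ℝ => ∫⁻ x in I3, gradAt F h x ^ p := hgm2.lintegral_prod_right'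
  have hpowm : ∀ a : ℝ, Measurable fun h : ℝ => ENNReal.ofReal (h ^ a) := fun a =>
    (measurable_id.pow_const a).ennreal_ofReal
  -- the bound for the increment `t` up to the factor `K`, as a function of the depth `h = c * |t|`
  set Θ : ℝ → ℝ≥0∞ := fun h => ENNReal.ofReal ((5 * c) ^ (2 - s)) *
    (2 * (ENNReal.ofReal (h ^ (s - 2)) * ∫⁻ x in I3, radialIntegral F h x ^ p) +
      ENNReal.ofReal ((2 / c) ^ p) *
        (ENNReal.ofReal (h ^ (p - 2 + s)) * ∫⁻ x in I3, gradAt F h x ^ p)) with hΘ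
  have hm1 : Measurable fun h : ℝ => 2 * (ENNReal.ofReal (h ^ (s - 2)) *
      ∫⁻ x in I3, radialIntegral F h x ^ p) := ((hpowm _).mul hRm).const_mul 2
  have hΘm : Measurable Θ := by
    refine Measurable.const_mul (hm1.add ?_) _
    exact ((hpowm _).mul hgm).const_mul _
  have hinc : ∀ t ∈ Set.Icc (-τ) τ, t ≠ 0 → ENNReal.ofReal ((|t| / 5) ^ (s - 2)) *
      ∫⁻ x in I, diffPow p f (Circle.exp x) (Circle.exp (x + t)) ≤ K * Θ (c * |t|) := by
    intro t ht hne
    have htτ : |t| ≤ τ := abs_le.2 ht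
    have ht0 : 0 < |t| := abs_pos.2 hne
    have hct : c * |t| ≤ 1 := by
      have h2 : c * |t| ≤ c * τ := by gcongr
      have h3 : ℓ / (4 * Real.pi) ≤ 1 := by rw [div_le_one (by positivity)]; linarith
      linarith
    have key := lintegral_diffPow_add_le hp hF hhn hlim (θ := θ) (t := t)
      (htτ.trans (min_le_left _ _)) (h := c * |t|) (by positivity) hct
    refine (mul_le_mul_right key _).trans (le_of_eq ?_)
    rw [mul_left_comm]
    congr 1
    simp only [hΘ]
    have e1 : (|t| / 5) ^ (s - 2) = (5 * c) ^ (2 - s) * (c * |t|) ^ (s - 2) := by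
      rw [show 2 - s = -(s - 2) by ring, Real.rpow_neg (by positivity), ← Real.inv_rpow
        (by positivity), ← Real.mul_rpow (by positivity) (by positivity)]
      congr 1
      field_simp
    have e2 : (c * |t|) ^ (s - 2) * (2 * |t|) ^ p = (2 / c) ^ p * (c * |t|) ^ (p - 2 + s) := by
      rw [show p - 2 + s = (s - 2) + p by ring, Real.rpow_add (by positivity), mul_left_comm,
        ← Real.mul_rpow (by positivity) (by positivity)]
      congr 2
      field_simp
    rw [e1, ENNReal.ofReal_mul (by positivity), mul_assoc, mul_add, mul_left_comm _ 2, ← mul_assoc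
      (ENNReal.ofReal ((c * |t|) ^ (s - 2))) (ENNReal.ofReal ((2 * |t|) ^ p)),
      ← ENNReal.ofReal_mul (by positivity), e2, ENNReal.ofReal_mul (by positivity), mul_assoc
      (ENNReal.ofReal ((2 / c) ^ p))]
  have hΘint : ∫⁻ h in Set.Ioo 0 (c * τ), Θ h ≤ ENNReal.ofReal ((5 * c) ^ (2 - s)) * (B *
      (ENNReal.ofReal (2 * 2 ^ |p - 2 + s|) * (3 * ENNReal.ofReal (M * ℓ ^ s)))) := by
    have hN := (lintegral_mono_set (Set.Ioo_subset_Ioo_right hτℓ)).trans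
      (hM.lintegral_le hp0 θ h0 h1)
    set N := ∫⁻ h in Set.Ioo 0 (c * τ), ENNReal.ofReal (h ^ (p - 2 + s)) *
      ∫⁻ x in I3, gradAt F h x ^ p with hNdef
    have hRint : ∫⁻ h in Set.Ioo 0 (c * τ), ENNReal.ofReal (h ^ (s - 2)) *
        ∫⁻ x in I3, radialIntegral F h x ^ p ≤ ENNReal.ofReal C * N := by
      calc _ = ∫⁻ x in I3, ∫⁻ h in Set.Ioo 0 (c * τ), ENNReal.ofReal (h ^ (s - 2)) *
            radialIntegral F h x ^ p := by
            simp_rw [← lintegral_const_mul' _ _ ENNReal.ofReal_ne_top]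
            exact lintegral_lintegral_swap
              (f := fun h x => ENNReal.ofReal (h ^ (s - 2)) * radialIntegral F h x ^ p)
              (((hpowm _).comp measurable_fst).mul hRm2).aemeasurable
        _ ≤ ∫⁻ x in I3, ENNReal.ofReal C * ∫⁻ h in Set.Ioo 0 (c * τ),
            ENNReal.ofReal (h ^ (p - 2 + s)) * gradAt F h x ^ p :=
            lintegral_mono fun x => hC (fun r => gradAt F r x) (measurable_gradAt_depth F x) (c * τ)
        _ = _ := by
            rw [lintegral_const_mul' _ _ ENNReal.ofReal_ne_top, hNdef]
            congr 1
            simp_rw [← lintegral_const_mul' _ _ ENNReal.ofReal_ne_top]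
            exact (lintegral_lintegral_swap
              (f := fun h x => ENNReal.ofReal (h ^ (p - 2 + s)) * gradAt F h x ^ p)
              (((hpowm _).comp measurable_fst).mul hgm2).aemeasurable).symm
    simp only [hΘ]
    rw [lintegral_const_mul' _ _ ENNReal.ofReal_ne_top, lintegral_add_left hm1,
      lintegral_const_mul' _ _ (by simp), lintegral_const_mul' _ _ ENNReal.ofReal_ne_top]
    gcongr
    calc _ ≤ 2 * (ENNReal.ofReal C * N) + ENNReal.ofReal ((2 / c) ^ p) * N := by gcongr
      _ = B * N := by rw [hB]; ring
      _ ≤ _ := by gcongr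
  have hdm : Measurable fun q : ℝ × ℝ => ENNReal.ofReal ((|q.2| / 5) ^ (s - 2)) *
      diffPow p f (Circle.exp q.1) (Circle.exp (q.1 + q.2)) := by
    have h2 : Measurable fun q : ℝ × ℝ => (|q.2| / 5) ^ (s - 2) := by fun_prop
    exact h2.ennreal_ofReal.mul (measurable_diffPow_comp hf
      (measurable_circleExp.comp measurable_fst)
      (measurable_circleExp.comp (measurable_fst.add measurable_snd)))
  calc _ ≤ ∫⁻ x in I, ∫⁻ t in Set.Icc (-τ) τ, ENNReal.ofReal ((|t| / 5) ^ (s - 2)) *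
        diffPow p f (Circle.exp x) (Circle.exp (x + t)) :=
        setLIntegral_mono' measurableSet_Icc fun x hx =>
          setLIntegral_diffKernel_le hp0 (by linarith) h1 hx
    _ = ∫⁻ t in Set.Icc (-τ) τ, ENNReal.ofReal ((|t| / 5) ^ (s - 2)) *
        ∫⁻ x in I, diffPow p f (Circle.exp x) (Circle.exp (x + t)) := by
        simp_rw [← lintegral_const_mul' _ _ ENNReal.ofReal_ne_top]
        exact lintegral_lintegral_swap
          (f := fun x t => ENNReal.ofReal ((|t| / 5) ^ (s - 2)) *
            diffPow p f (Circle.exp x) (Circle.exp (x + t))) hdm.aemeasurable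
    _ ≤ ∫⁻ t in Set.Icc (-τ) τ, K * Θ (c * |t|) := by
        refine lintegral_mono_ae ?_
        have hne : ∀ᵐ t : ℝ, t ≠ 0 := by simp [ae_iff]
        filter_upwards [self_mem_ae_restrict measurableSet_Icc, ae_restrict_of_ae hne] with t ht ht0
        exact hinc t ht ht0
    _ ≤ K * (2 * (ENNReal.ofReal c⁻¹ * ∫⁻ h in Set.Ioo 0 (c * τ), Θ h)) := by
        rw [lintegral_const_mul' _ _ hKt, ← setLIntegral_Ioo_comp_mul hΘm hc0]
        gcongr
        exact setLIntegral_Icc_comp_abs_le (fun t => Θ (c * t)) τ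
    _ ≤ D * ENNReal.ofReal (ℓ ^ s) := by
        refine (mul_le_mul_right (mul_le_mul_right (mul_le_mul_right hΘint _) _) _).trans
          (le_of_eq ?_)
        rw [ENNReal.ofReal_mul' (p := M) (by positivity : 0 ≤ ℓ ^ s), hD]
        ring
    _ = _ := by
        rw [ENNReal.ofReal_mul ENNReal.toReal_nonneg, ENNReal.ofReal_toReal hDt]

end ArcBoundOfSectorBound

/-! ### Independence of the representative -/

section Congruence

variable {p s : ℝ} {f g : Circle → ℂ}

lemma seminormPow_congr_ae (h : f =ᵐ[arcLength] g) : seminormPow p s f = seminormPow p s g := by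
  unfold seminormPow
  refine iSup_congr fun θ => iSup_congr fun ℓ => iSup_congr fun _ => ?_
  congr 1
  refine lintegral_congr_ae (ae_restrict_of_ae (h.mono fun ζ hζ => ?_))
  refine lintegral_congr_ae (ae_restrict_of_ae (h.mono fun η hη => ?_))
  simp only [hζ, hη]

lemma invariantIntegral_congr_ae (h : f =ᵐ[arcLength] g) (a : ℂ) :
    invariantIntegral p s f a = invariantIntegral p s g a := by
  refine lintegral_congr_ae (h.mono fun ζ hζ => ?_)
  refine lintegral_congr_ae (h.mono fun η hη => ?_)
  simp only [hζ, hη]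

lemma poissonExt_congr_ae (h : f =ᵐ[arcLength] g) : poissonExt f = poissonExt g := by
  funext z
  unfold poissonExt
  congr 1
  refine integral_congr_ae (h.mono fun ζ hζ => ?_)
  simp only [hζ]

end Congruence

end QSpace

theorem theorem2p4 (p s : ℝ) (hp : 1 < p) (hs0 : 0 < s) (hs1 : s < 1)
    (f : Circle → ℂ) (hf : MemLp f (ENNReal.ofReal p) QSpace.arcLength) :
    List.TFAE
      [f ∈ QSpace.Q p s,
       QSpace.IsCarlesonMeasure s (QSpace.gradMeasure p s (QSpace.poissonExt f)),
       (⨆ a ∈ Metric.ball (0 : ℂ) 1, ∫⁻ ζ, ∫⁻ η,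
          ENNReal.ofReal (‖f ζ - f η‖ ^ p / ‖(ζ : ℂ) - (η : ℂ)‖ ^ (2 - s) *
            ((1 - ‖a‖ ^ 2) / (‖(ζ : ℂ) - a‖ * ‖(η : ℂ) - a‖)) ^ s)
          ∂QSpace.arcLength ∂QSpace.arcLength) < ∞] := by
  -- All three conditions depend only on the almost everywhere class of `f`, so that `f` may be
  -- replaced by a Borel measurable representative.
  obtain ⟨g, hg, hfg⟩ : ∃ g : Circle → ℂ, Measurable g ∧ f =ᵐ[QSpace.arcLength] g :=
    ⟨hf.1.mk f, hf.1.stronglyMeasurable_mk.measurable, hf.1.ae_eq_mk⟩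
  have hgi : Integrable g QSpace.arcLength :=
    (hf.integrable (by simpa using ENNReal.ofReal_le_ofReal hp.le)).congr hfg
  have hQ : f ∈ QSpace.Q p s ↔ QSpace.seminormPow p s g < ∞ := by
    rw [← QSpace.seminormPow_congr_ae hfg]
    exact and_iff_right hf
  have hC : (⨆ a ∈ Metric.ball (0 : ℂ) 1, QSpace.invariantIntegral p s f a) =
      ⨆ a ∈ Metric.ball (0 : ℂ) 1, QSpace.invariantIntegral p s g a :=
    iSup_congr fun a => iSup_congr fun _ => QSpace.invariantIntegral_congr_ae hfg a
  change List.TFAE [_, _, (⨆ a ∈ Metric.ball (0 : ℂ) 1, QSpace.invariantIntegral p s f a) < ∞]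
  rw [hC, hQ, QSpace.poissonExt_congr_ae hfg]
  tfae_have 1 → 3 := fun h => by
    obtain ⟨M, hM0, hM⟩ := (QSpace.seminormPow_lt_top_iff hg).1 h
    exact hM.iSup_invariantIntegral_lt_top (by linarith) hs0 hs1 hM0 hg
  tfae_have 3 → 1 := QSpace.seminormPow_lt_top_of_iSup_invariantIntegral_lt_top hs0
  tfae_have 1 → 2 := fun h => by
    obtain ⟨M, hM0, hM⟩ := (QSpace.seminormPow_lt_top_iff hg).1 h
    exact hM.isCarlesonMeasure hp hs0 hs1 hM0 hg hgi
  tfae_have 2 → 1 := fun h => by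
    obtain ⟨M, -, hM⟩ := (QSpace.isCarlesonMeasure_gradMeasure_iff _).1 h
    exact (QSpace.seminormPow_lt_top_iff hg).2 (hM.exists_arcBound hp hs1 hg hgi)
  tfae_finish
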